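/- Let $m,n\ge 0$ be integers, let $U_1,\dots,U_m$ be unitaries on $n$ qubits, and let $|\psi\rangle$ be an $n$-qubit state (a unit vector of $\mathbb{C}^{2^n}$). The (uniform, unnormalized) order interference state is $$\mathbf{OI}(\{U_i\},|\psi\rangle)=\sum_{\sigma\in S_m}U_{\sigma^{-1}(m)}\cdots U_{\sigma^{-1}(2)}U_{\sigma^{-1}(1)}|\psi\rangle .$$ Circuits are over the gates $X$, $Z$, $P=\mathrm{diag}(1,i)$, $H$, $T=\mathrm{diag}(1,e^{i\pi/4})$, CNOT, SWAP, Toffoli and the exact phase gates $\mathrm{diag}\bigl(1,(\sqrt a+i\sqrt b)/\sqrt{a+b}\bigr)$ with integers $a,b\ge 0$, $a+b>0$. A unitary circuit with $k$ ancillas implements an $n$-qubit unitary $U$ if it maps $|\phi\rangle|0^k\rangle$ to $(U|\phi\rangle)|0^k\rangle$ for every $|\phi\rangle$. A description of a circuit lists its number of ancillas, its gates and, if it has any, its measured qubits, as a string over a finite alphabet (numbers of qubits and wires in unary, the parameters $a,b$ in binary). There is a quantum polynomial-time algorithm $Q$, that is, a deterministic Turing machine that runs in time polynomial in the length of its input and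 outputs the description of a quantum circuit with measurement, with the following property. Let the classical input consist of $n$ and of descriptions of $m$ unitary circuits that implement $n$-qubit unitaries $U_1,\dots,U_m$. Then the circuit written by the machine is well-formed; it acts on the $n$ input qubits together with ancillas initialized to zero, applies its gates, measures designated qubits in the computational basis, and reports success if all outcomes are $0$. For every $n$-qubit state $|\psi\rangle$, given as one copy in the input qubits, it reports success with probability at least $$\left(\frac{\|\mathbf{OI}(\{U_i\},|\psi\rangle)\|}{m!}\right)^2 ,$$ and whenever the probability of success is positive, $\mathbf{OI}(\{U_i\},|\psi\rangle)\neq 0$ and, conditioned on success, the $n$-qubit output register is exactly in the pure state $\mathbf{OI}(\{U_i\},|\psi\rangle)/\|\mathbf{OI}(\{U_i\},|\psi\rangle)\|$. -/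

import Mathlib

namespace OrderInterference

noncomputable section

/-! ### Qubits, states and operators -/

/-- Computational basis labels of `n` qubits, that is, `n`-bit strings. -/
abbrev Bits (n : ℕ) : Type := Fin n → Bool

/-- The space `ℂ^(2^n)` with the Euclidean norm; an `n`-qubit state is a unit vector of it. -/
abbrev State (n : ℕ) : Type := EuclideanSpace ℂ (Bits n)

/-- Complex matrices of size `2^n × 2^n`. -/
abbrev Op (n : ℕ) : Type := Matrix (Bits n) (Bits n) ℂ

/-- `n`-qubit unitaries. -/
abbrev QUnitary (n : ℕ) : Type := Matrix.unitaryGroup (Bits n) ℂ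

/-- The matrix `A` applied to the vector `ψ`. -/
def Op.app {n : ℕ} (A : Op n) (ψ : State n) : State n := Matrix.toEuclideanLin A ψ

/-- The state `ψ ⊗ |0^k⟩`. -/
def withAncilla {n : ℕ} (k : ℕ) (ψ : State n) : State (n + k) :=
  WithLp.toLp 2 fun z =>
    if ∀ j : Fin k, z (Fin.natAdd n j) = false then ψ (fun i => z (Fin.castAdd k i)) else 0

/-! ### The order interference state -/

/-- The product `U (σ⁻¹ m) ⋯ U (σ⁻¹ 2) * U (σ⁻¹ 1)`: the unitary `U (σ⁻¹ 1)` acts first. -/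
def orderedProduct {n m : ℕ} (U : Fin m → QUnitary n) (σ : Equiv.Perm (Fin m)) : Op n :=
  ((List.ofFn fun i : Fin m => (U (σ⁻¹ i) : Op n)).reverse).prod

/-- The (unnormalized) uniform order interference state. -/
def OI {n m : ℕ} (U : Fin m → QUnitary n) (ψ : State n) : State n :=
  ∑ σ : Equiv.Perm (Fin m), (orderedProduct U σ).app ψ

/-! ### Gates -/

/-- Names of one-qubit gates. -/
inductive OneQubit : Type
  | X | Z | P | H | T
  | phase (a b : ℕ)

/-- The diagonal gate `diag(1, z)`. -/
def phaseMatrix (z : ℂ) : Matrix Bool Bool ℂ := Matrix.diagonal fun b => if b then z else 1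

/-- The matrix of a one-qubit gate. The gate `phase a b` is `diag(1, e^{iθ})` with
`0 ≤ θ ≤ π/2` and `cos² θ = a / (a + b)`. -/
def OneQubit.toMatrix : OneQubit → Matrix Bool Bool ℂ
  | .X => Matrix.of fun x y => if x = y then 0 else 1
  | .Z => phaseMatrix (-1)
  | .P => phaseMatrix Complex.I
  | .H => Matrix.of fun x y => (if x && y then -1 else 1) / (Real.sqrt 2 : ℂ)
  | .T => phaseMatrix (Complex.exp (Complex.I * Real.pi / 4))
  | .phase a b =>
      phaseMatrix (((Real.sqrt a : ℂ) + Complex.I * (Real.sqrt b : ℂ)) / (Real.sqrt (a + b) : ℂ))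

/-- Gates, with the wires they act on (wires are numbered from `0`): a one-qubit gate, a controlled
`X` with control `c` and target `t`, a swap, and a Toffoli gate with controls `c`, `d` and
target `t`. -/
inductive Gate : Type
  | one (u : OneQubit) (q : ℕ)
  | cnot (c t : ℕ)
  | swap (a b : ℕ)
  | tof (c d t : ℕ)

/-- The parameters of a phase gate must not both vanish. -/
def OneQubit.Valid : OneQubit → Prop
  | .phase a b => 0 < a + b
  | _ => True

/-- The gate makes sense on `N` qubits: its wires exist and are distinct. -/
def Gate.Valid (N : ℕ) : Gate → Prop
  | .one u q => u.Valid ∧ q < N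
  | .cnot c t => c < N ∧ t < N ∧ c ≠ t
  | .swap a b => a < N ∧ b < N ∧ a ≠ b
  | .tof c d t => c < N ∧ d < N ∧ t < N ∧ c ≠ d ∧ c ≠ t ∧ d ≠ t

/-- The bit of `x` on wire `q`. -/
def wire {N : ℕ} (x : Bits N) (q : ℕ) : Bool := if h : q < N then x ⟨q, h⟩ else false

/-- The operator `|y⟩ ↦ |f y⟩`. -/
def basisMap {N : ℕ} (f : Bits N → Bits N) : Op N :=
  Matrix.of fun x y => if x = f y then 1 else 0

/-- The action of a gate on `N` qubits. -/
def Gate.toOp (N : ℕ) : Gate → Op N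
  | .one u q => Matrix.of fun x y =>
      if ∀ j : Fin N, (j : ℕ) ≠ q → x j = y j then u.toMatrix (wire x q) (wire y q) else 0
  | .cnot c t => basisMap fun y j => if (j : ℕ) = t then xor (y j) (wire y c) else y j
  | .swap a b => basisMap fun y j =>
      if (j : ℕ) = a then wire y b else if (j : ℕ) = b then wire y a else y j
  | .tof c d t => basisMap fun y j =>
      if (j : ℕ) = t then xor (y j) (wire y c && wire y d) else y j

/-- The action of a list of gates; the head of the list is executed first. -/
def gatesOp (N : ℕ) : List Gate → Op N
  | [] => 1
  | g :: gs => gatesOp N gs * g.toOp N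

/-! ### Circuits -/

/-- Description of a unitary circuit: the number of ancillary qubits and the list of gates. On `n`
input qubits, wires `0, …, n - 1` are the input and wires `n, …, n + anc - 1` the ancillas. -/
structure UnitaryCircuit : Type where
  anc : ℕ
  gates : List Gate

/-- On `n` qubits the circuit `c` implements the unitary `U`: started with its ancillas in the
state zero, it applies `U` to the input and returns the ancillas to zero. -/
def UnitaryCircuit.Implements {n : ℕ} (c : UnitaryCircuit) (U : QUnitary n) : Prop :=
  (∀ g ∈ c.gates, g.Valid (n + c.anc)) ∧
    ∀ ψ : State n, (gatesOp (n + c.anc) c.gates).app (withAncilla c.anc ψ) =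
      withAncilla c.anc (Op.app (U : Op n) ψ)

/-- Description of a quantum circuit with measurement: `anc` ancillary qubits in the state zero are
added after the input qubits, the gates are executed, and then the wires in `measured` are measured
in the computational basis. The circuit reports success if all outcomes are zero. Its output
register is the register of the input qubits, the ancillas being discarded. -/
structure MeasuredCircuit : Type where
  anc : ℕ
  gates : List Gate
  measured : List ℕ

namespace MeasuredCircuit

/-- The circuit makes sense on `n` input qubits. -/
def Valid (n : ℕ) (C : MeasuredCircuit) : Prop :=
  (∀ g ∈ C.gates, g.Valid (n + C.anc)) ∧ ∀ q ∈ C.measured, q < n + C.anc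

/-- The state just before the measurement. -/
def finalState {n : ℕ} (C : MeasuredCircuit) (ψ : State n) : State (n + C.anc) :=
  (gatesOp (n + C.anc) C.gates).app (withAncilla C.anc ψ)

/-- The projection of the final state to the outcome zero on all measured wires. -/
def successState {n : ℕ} (C : MeasuredCircuit) (ψ : State n) : State (n + C.anc) :=
  WithLp.toLp 2 fun z => if ∀ q ∈ C.measured, wire z q = false then C.finalState ψ z else 0

/-- The probability that the circuit reports success on input `ψ`. -/
def successProb {n : ℕ} (C : MeasuredCircuit) (ψ : State n) : ℝ := ‖C.successState ψ‖ ^ 2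

/-- The density matrix of the output register, conditioned on success: the partial trace over the
ancillas of the projected state, divided by the success probability. -/
def outputDensity {n : ℕ} (C : MeasuredCircuit) (ψ : State n) : Op n :=
  Matrix.of fun x x' => ((C.successProb ψ : ℂ))⁻¹ *
    ∑ y : Bits C.anc,
      C.successState ψ (Fin.append x y) * star (C.successState ψ (Fin.append x' y))

end MeasuredCircuit

/-- The density matrix `|φ⟩⟨φ|`. -/
def pureDensity {n : ℕ} (φ : State n) : Op n := Matrix.of fun x x' => φ x * star (φ x')

/-- The vector `φ` divided by its norm. -/
def normalization {n : ℕ} (φ : State n) : State n := (‖φ‖⁻¹ : ℂ) • φ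

/-! ### Descriptions as strings -/

/-- The alphabet in which inputs and circuits are written. -/
inductive Sym : Type
  | tick | sep | close | zero | one
  | X | Z | P | H | T | phase | cnot | swap | tof
  deriving DecidableEq

instance : Fintype Sym where
  elems := {.tick, .sep, .close, .zero, .one, .X, .Z, .P, .H, .T, .phase, .cnot, .swap, .tof}
  complete x := by cases x <;> decide

/-- Wires and numbers of qubits are written in unary. -/
def encUnary (n : ℕ) : List Sym := List.replicate n Sym.tick ++ [Sym.sep]

/-- The parameters of phase gates are written in binary, least significant bit first. -/
def encBinary (n : ℕ) : List Sym :=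
  (Computability.encodeNat n).map (fun b => if b then Sym.one else Sym.zero) ++ [Sym.sep]

def encOneQubit : OneQubit → List Sym
  | .X => [Sym.X]
  | .Z => [Sym.Z]
  | .P => [Sym.P]
  | .H => [Sym.H]
  | .T => [Sym.T]
  | .phase a b => Sym.phase :: (encBinary a ++ encBinary b)

def encGate : Gate → List Sym
  | .one u q => encOneQubit u ++ encUnary q
  | .cnot c t => Sym.cnot :: (encUnary c ++ encUnary t)
  | .swap a b => Sym.swap :: (encUnary a ++ encUnary b)
  | .tof c d t => Sym.tof :: (encUnary c ++ (encUnary d ++ encUnary t))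

/-- A list is written as the concatenation of its entries, followed by a closing symbol. -/
def encList {α : Type} (enc : α → List Sym) (l : List α) : List Sym :=
  l.flatMap enc ++ [Sym.close]

def encUnitaryCircuit (c : UnitaryCircuit) : List Sym := encUnary c.anc ++ encList encGate c.gates

def encMeasuredCircuit (C : MeasuredCircuit) : List Sym :=
  encUnary C.anc ++ (encList encGate C.gates ++ encList encUnary C.measured)

/-- The classical input of the algorithm: the number `n` of qubits of the input state and the
descriptions of the unitary circuits. -/
structure OIInput : Type where
  n : ℕ
  circuits : List UnitaryCircuit

def encOIInput (x : OIInput) : List Sym := encUnary x.n ++ encList encUnitaryCircuit x.circuits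

/-! The encodings are injective: the strings determine the objects. -/

def PrefixFree {α : Type} (enc : α → List Sym) : Prop :=
  ∀ a b s t, enc a ++ s = enc b ++ t → a = b ∧ s = t

def NoClose {α : Type} (enc : α → List Sym) : Prop :=
  ∀ a s t, enc a ++ s ≠ Sym.close :: t

theorem PrefixFree.injective {α : Type} {enc : α → List Sym} (h : PrefixFree enc) :
    Function.Injective enc := fun a b hab => (h a b [] [] (by rw [hab])).1

theorem prefixFree_encUnary : PrefixFree encUnary := by
  intro a
  induction a with
  | zero => rintro (_ | b) s t h <;> simp_all [encUnary, List.replicate_succ]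
  | succ a ih =>
    rintro (_ | b) s t h
    · simp [encUnary, List.replicate_succ] at h
    · have := ih b s t (by simpa [encUnary, List.replicate_succ] using h)
      simpa using this

theorem noClose_encUnary : NoClose encUnary := by
  rintro (_ | a) s t h <;> simp [encUnary, List.replicate_succ] at h

theorem prefixFree_encBinary : PrefixFree encBinary := by
  have key : ∀ (l l' : List Bool) (s t : List Sym),
      l.map (fun b => if b then Sym.one else Sym.zero) ++ Sym.sep :: s =
        l'.map (fun b => if b then Sym.one else Sym.zero) ++ Sym.sep :: t → l = l' ∧ s = t := by
    intro l
    induction l with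
    | nil => rintro (_ | ⟨_ | _, l'⟩) s t h <;> simp_all
    | cons b l ih =>
      rintro (_ | ⟨b', l'⟩) s t h
      · cases b <;> simp at h
      · cases b <;> cases b' <;> simp at h <;> simpa using ih l' s t (by simpa using h)
  intro a b s t h
  obtain ⟨h1, h2⟩ := key _ _ s t (by simpa [encBinary] using h)
  refine ⟨?_, h2⟩
  have := congrArg Computability.decodeNat h1
  simpa using this

theorem prefixFree_encOneQubit : PrefixFree encOneQubit := by
  intro a b s t h
  cases a <;> cases b <;> simp_all [encOneQubit]
  obtain ⟨h1, h2⟩ := prefixFree_encBinary _ _ _ _ h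
  obtain ⟨h3, h4⟩ := prefixFree_encBinary _ _ _ _ h2
  exact ⟨⟨h1, h3⟩, h4⟩

theorem prefixFree_encGate : PrefixFree encGate := by
  intro a b s t h
  rcases a with ⟨u, q⟩ | ⟨c, d⟩ | ⟨c, d⟩ | ⟨c, d, e⟩ <;>
    rcases b with ⟨u', q'⟩ | ⟨c', d'⟩ | ⟨c', d'⟩ | ⟨c', d', e'⟩
  · simp only [encGate, List.append_assoc] at h
    obtain ⟨h1, h2⟩ := prefixFree_encOneQubit _ _ _ _ h
    obtain ⟨h3, h4⟩ := prefixFree_encUnary _ _ _ _ h2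
    exact ⟨by rw [h1, h3], h4⟩
  · cases u <;> simp [encGate, encOneQubit] at h
  · cases u <;> simp [encGate, encOneQubit] at h
  · cases u <;> simp [encGate, encOneQubit] at h
  · cases u' <;> simp [encGate, encOneQubit] at h
  · simp only [encGate, List.cons_append, List.append_assoc, List.cons.injEq, true_and] at h
    obtain ⟨h1, h2⟩ := prefixFree_encUnary _ _ _ _ h
    obtain ⟨h3, h4⟩ := prefixFree_encUnary _ _ _ _ h2
    exact ⟨by rw [h1, h3], h4⟩
  · simp [encGate] at h
  · simp [encGate] at h
  · cases u' <;> simp [encGate, encOneQubit] at h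
  · simp [encGate] at h
  · simp only [encGate, List.cons_append, List.append_assoc, List.cons.injEq, true_and] at h
    obtain ⟨h1, h2⟩ := prefixFree_encUnary _ _ _ _ h
    obtain ⟨h3, h4⟩ := prefixFree_encUnary _ _ _ _ h2
    exact ⟨by rw [h1, h3], h4⟩
  · simp [encGate] at h
  · cases u' <;> simp [encGate, encOneQubit] at h
  · simp [encGate] at h
  · simp [encGate] at h
  · simp only [encGate, List.cons_append, List.append_assoc, List.cons.injEq, true_and] at h
    obtain ⟨h1, h2⟩ := prefixFree_encUnary _ _ _ _ h
    obtain ⟨h3, h4⟩ := prefixFree_encUnary _ _ _ _ h2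
    obtain ⟨h5, h6⟩ := prefixFree_encUnary _ _ _ _ h4
    exact ⟨by rw [h1, h3, h5], h6⟩

theorem noClose_encGate : NoClose encGate := by
  rintro (⟨u, q⟩ | ⟨c, d⟩ | ⟨c, d⟩ | ⟨c, d, e⟩) s t h
  · cases u <;> simp [encGate, encOneQubit] at h
  all_goals simp [encGate] at h

theorem prefixFree_encList {α : Type} {enc : α → List Sym} (h : PrefixFree enc)
    (h' : NoClose enc) : PrefixFree (encList enc) := by
  intro l
  induction l with
  | nil =>
    rintro (_ | ⟨b, l'⟩) s t e
    · simpa [encList] using e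
    · exact absurd (by simpa [encList] using e.symm) (h' b _ _)
  | cons a l ih =>
    rintro (_ | ⟨b, l'⟩) s t e
    · exact absurd (by simpa [encList] using e) (h' a _ _)
    · simp only [encList, List.flatMap_cons, List.append_assoc] at e
      obtain ⟨h1, h2⟩ := h _ _ _ _ e
      obtain ⟨h3, h4⟩ := ih l' s t (by simpa [encList] using h2)
      exact ⟨by rw [h1, h3], h4⟩

theorem prefixFree_encUnitaryCircuit : PrefixFree encUnitaryCircuit := by
  rintro ⟨k, gs⟩ ⟨k', gs'⟩ s t h
  simp only [encUnitaryCircuit, List.append_assoc] at h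
  obtain ⟨h1, h2⟩ := prefixFree_encUnary _ _ _ _ h
  obtain ⟨h3, h4⟩ := prefixFree_encList prefixFree_encGate noClose_encGate _ _ _ _ h2
  exact ⟨by rw [h1, h3], h4⟩

theorem noClose_encUnitaryCircuit : NoClose encUnitaryCircuit := by
  intro c s t h
  rw [encUnitaryCircuit, List.append_assoc] at h
  exact noClose_encUnary _ _ _ h

theorem encMeasuredCircuit_injective : Function.Injective encMeasuredCircuit := by
  rintro ⟨k, gs, ms⟩ ⟨k', gs', ms'⟩ h
  simp only [encMeasuredCircuit] at h
  obtain ⟨h1, h2⟩ := prefixFree_encUnary _ _ _ _ h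
  obtain ⟨h3, h4⟩ := prefixFree_encList prefixFree_encGate noClose_encGate _ _ _ _ h2
  have h5 := (prefixFree_encList prefixFree_encUnary noClose_encUnary).injective h4
  rw [h1, h3, h5]

theorem encOIInput_injective : Function.Injective encOIInput := by
  rintro ⟨k, cs⟩ ⟨k', cs'⟩ h
  simp only [encOIInput] at h
  obtain ⟨h1, h2⟩ := prefixFree_encUnary _ _ _ _ h
  have h3 :=
    (prefixFree_encList prefixFree_encUnitaryCircuit noClose_encUnitaryCircuit).injective h2
  rw [h1, h3]

/-! ### Quantum polynomial time -/

/-- A quantum polynomial-time algorithm whose classical input is an element of `α`, written as a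
string by `enc`: a deterministic Turing machine that runs in time polynomial in the length of the
classical input and outputs the description of a measured circuit, which is then executed on the
quantum input. As the machine writes the whole description (with one symbol at least for every gate,
ancilla and measured wire), the size of the circuit is polynomial in the length of the input too. -/
structure QPTAlgorithm {α : Type} (enc : α → List Sym) : Type where
  circuit : α → MeasuredCircuit
  polyTime : Nonempty (Turing.TM2ComputableInPolyTime enc encMeasuredCircuit circuit)

end

end OrderInterference

open OrderInterference

/-! The circuit prepares a superposition over the orders in which the unitaries can act, with control
qubits whose joint distribution is uniform on the permutations, and then undoes the preparation of
the controls. Finding all controls zero leaves the data in the mean of the `m!` ordered products.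
For this three things have to be arranged.

*Controlled orders without controlled unitaries.* There are `m` token qubits and `m` dummy registers
of `n` qubits. In round `t` token `t` is cleared while all others are set, and the tokens are
permuted by the permutation `σ` that the controls describe, so that token `σ t` is the one that is
cleared. Now every given circuit is executed once, circuit `i` on dummy register `i` if token `i` is
set, and otherwise on the data: the two registers are exchanged before and after by swaps controlled
by the token (`acts_controlled`, `acts_round`). After `m` rounds the data have undergone
`U (σ (m - 1)) ⋯ U (σ 0)`. Dummy register `i` has undergone `U i` exactly `m - 1` times for every
`σ`, so it is in a pure state that is not entangled with the controls (`acts_allRounds`). This is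
what makes the interference exact.

*A uniform permutation from independent qubits.* The controls are coins, numbered by the pairs
`l < k < m`. The coin `(k, l)` decides on a swap of the neighbours `l` and `l + 1`. In stage `k` these
swaps are done for `l = 0, …, k - 1`, and with probability `(l + 1) / (l + 2)` for swapping they carry
a uniformly distributed item to position `k` (`coinMean_stage`). The stages `m - 1, …, 0` thus give a
uniform permutation (`coinMean_shuffle`).

*Exact coins.* With `z = (1 + i √(l + 1)) / √(l + 2)`, an exact phase gate, the amplitudes of the coin
`H diag(1, z²) H |0⟩` are `(1 ± z²) / 2`, with squared moduli `1 / (l + 2)` and `(l + 1) / (l + 2)`.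
The inverse of this preparation consists of available gates too. Its matrix element from `b` to zero
times that of the preparation from zero to `b` is the probability of `b`
(`unprepMatrix_mul_prepMatrix`), and so the amplitude of the outcome zero on all coins is the mean over
independent tosses (`coinOp_unprep`).

The success probability is therefore equal to `(‖OI‖ / m!)²`, and after success the data are in a
product state with the ancillas (`oiCircuit_successState`).

Gates are treated as acting on amplitudes of infinitely many wires, and all states that occur
have the shape `form`: for each outcome `r` of the coins a product of a state of the data, states of
the dummy registers and basis states of the other ancillas.

That the circuit is computable in polynomial time is shown by compilation. A language of bounded
loops that write strings (`Em`) is translated to programs over stacks (`Prog`), and these to Turing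
machines with several stacks, with a polynomial bound on the number of steps
(`computableInPolyTime_of_em`). The circuit description is then given by a loop program `circuitE`. -/

namespace OrderInterference

/-! ### Stack programs and their compilation to Turing machines -/

/-- The contents of a family of stacks of symbols. -/
abbrev Stacks (K : Type) : Type := K → List Sym

/-- Structured programs over a family of stacks: `push k s` pushes the symbol `s` on the stack `k`,
`move k ks` pops a symbol of `k` and pushes it on each stack of the list `ks`, and `loop k P p`
repeats `p` while the top of `k` (or `none` if `k` is empty) satisfies `P`. -/
inductive Prog (K : Type) : Type
  | push (k : K) (s : Sym)
  | move (k : K) (ks : List K)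
  | seq (p q : Prog K)
  | loop (k : K) (P : Option Sym → Bool) (p : Prog K)

namespace Prog

variable {K : Type}

/-- The labels of the Turing machine of a program: the positions in the program. -/
def Lab : Prog K → Type
  | push _ _ => Unit
  | move _ _ => Unit
  | seq p q => p.Lab ⊕ q.Lab
  | loop _ _ p => Option p.Lab

/-- A program has finitely many positions. -/
@[reducible]
def labFintype : (p : Prog K) → Fintype p.Lab
  | push _ _ => inferInstanceAs (Fintype Unit)
  | move _ _ => inferInstanceAs (Fintype Unit)
  | seq p q => @instFintypeSum _ _ p.labFintype q.labFintype
  | loop _ _ p => @instFintypeOption _ p.labFintype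

/-- The position at which a program starts. -/
def entry : (p : Prog K) → p.Lab
  | push _ _ => ()
  | move _ _ => ()
  | seq p _ => Sum.inl p.entry
  | loop _ _ _ => none

/-- Statements of the machines that programs are compiled to. Every stack has the alphabet `Sym`;
the internal state holds the symbol read last and is `none` between statements. -/
abbrev MStmt (K L : Type) : Type := Turing.TM2.Stmt (fun _ : K => Sym) L (Option Sym)

/-- Push the symbol in the internal state on the given stacks. -/
def pushCode {L : Type} : List K → MStmt K L → MStmt K L
  | [], q => q
  | k :: ks, q => .push k (fun v => v.getD Sym.tick) (pushCode ks q)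

/-- The statement at a position of a program, when positions are embedded by `emb` in the labels
of a machine that continues at `ex` after the program. -/
def code : (p : Prog K) → {L : Type} → (p.Lab → L) → L → p.Lab → MStmt K L
  | push k s, _, _, ex, _ => .push k (fun _ => s) (.goto fun _ => ex)
  | move k ks, _, _, ex, _ =>
      .pop k (fun _ o => o) (pushCode ks (.load (fun _ => none) (.goto fun _ => ex)))
  | seq p q, _, emb, _, Sum.inl a =>
      p.code (fun l => emb (Sum.inl l)) (emb (Sum.inr q.entry)) a
  | seq _ q, _, emb, ex, Sum.inr b => q.code (fun l => emb (Sum.inr l)) ex b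
  | loop k P p, _, emb, ex, none =>
      .peek k (fun _ o => o) (.branch P
        (.load (fun _ => none) (.goto fun _ => emb (some p.entry)))
        (.load (fun _ => none) (.goto fun _ => ex)))
  | loop _ _ p, _, emb, _, some a => p.code (fun l => emb (some l)) (emb none) a

variable [DecidableEq K]

/-- Push the symbol `s` on each of the given stacks. -/
def pushes (s : Sym) : List K → Stacks K → Stacks K
  | [], S => S
  | k :: ks, S => pushes s ks (Function.update S k (s :: S k))

/-- `Run p S t S'`: started on the stacks `S`, the program `p` ends after `t` steps with the
stacks `S'`. -/
inductive Run : Prog K → Stacks K → ℕ → Stacks K → Prop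
  | push (k : K) (s : Sym) (S : Stacks K) :
      Run (push k s) S 1 (Function.update S k (s :: S k))
  | move (k : K) (ks : List K) (S : Stacks K) :
      Run (move k ks) S 1
        (pushes ((S k).head?.getD Sym.tick) ks (Function.update S k (S k).tail))
  | seq {p q : Prog K} {S S' S'' : Stacks K} {t t' : ℕ} :
      Run p S t S' → Run q S' t' S'' → Run (seq p q) S (t + t') S''
  | halted {k : K} {P : Option Sym → Bool} (p : Prog K) {S : Stacks K} :
      P (S k).head? = false → Run (loop k P p) S 1 S
  | step {k : K} {P : Option Sym → Bool} {p : Prog K} {S S' S'' : Stacks K} {t t' : ℕ} :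
      P (S k).head? = true → Run p S t S' → Run (loop k P p) S' t' S'' →
        Run (loop k P p) S (1 + t + t') S''

theorem stepAux_pushCode {L : Type} (q : MStmt K L) (v : Option Sym) (ks : List K) (S : Stacks K) :
    Turing.TM2.stepAux (pushCode ks q) v S =
      Turing.TM2.stepAux q v (pushes (v.getD Sym.tick) ks S) := by
  induction ks generalizing S with
  | nil => rfl
  | cons k ks ih => simp only [pushCode, pushes, Turing.TM2.stepAux]; exact ih _

/-- A machine that contains the code of `p` simulates the runs of `p` step by step. -/
theorem Run.iterate_step {p : Prog K} {S S' : Stacks K} {t : ℕ} (h : Run p S t S') {L : Type}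
    {M : L → MStmt K L} {emb : p.Lab → L} {ex : L} (hM : ∀ l, M (emb l) = p.code emb ex l) :
    (flip bind (Turing.TM2.step M))^[t] (some ⟨some (emb p.entry), none, S⟩) =
      some ⟨some ex, none, S'⟩ := by
  have one (l : L) (S : Stacks K) : (flip bind (Turing.TM2.step M))^[1] (some ⟨some l, none, S⟩) =
      some (Turing.TM2.stepAux (M l) none S) := rfl
  induction h generalizing ex with
  | push k s S => exact (one _ _).trans (by rw [hM]; rfl)
  | move k ks S =>
    exact (one _ _).trans (by rw [hM]; simp [code, Turing.TM2.stepAux, stepAux_pushCode])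
  | @seq p q S S' S'' t t' _ _ ih₁ ih₂ =>
    rw [Nat.add_comm t t', Function.iterate_add_apply]
    have h₁ := ih₁ (emb := fun l => emb (Sum.inl l)) (ex := emb (Sum.inr q.entry))
      (fun l => hM (Sum.inl l))
    have h₂ := ih₂ (emb := fun l => emb (Sum.inr l)) (ex := ex) (fun l => hM (Sum.inr l))
    exact (congrArg _ h₁).trans h₂
  | @halted k P p S hP =>
    exact (one _ _).trans (by rw [hM]; simp [entry, code, Turing.TM2.stepAux, hP])
  | @step k P p S S' S'' t t' hP _ _ ih₁ ih₂ =>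
    rw [Nat.add_comm (1 + t) t', Function.iterate_add_apply, Nat.add_comm 1 t,
      Function.iterate_add_apply]
    have h₁ := ih₁ (emb := fun l => emb (some l)) (ex := emb none) (fun l => hM (some l))
    have h₂ := ih₂ hM
    have h₀ : (flip bind (Turing.TM2.step M))^[1]
        (some ⟨some (emb (loop k P p).entry), none, S⟩) =
          some ⟨some (emb (some p.entry)), none, S⟩ :=
      (one _ _).trans (by rw [hM]; simp [entry, code, Turing.TM2.stepAux, hP])
    rw [h₀]
    exact (congrArg _ h₁).trans h₂

/-- The machine of a program, with an additional label at which it halts. -/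
def machine [Fintype K] (p : Prog K) (k₀ k₁ : K) : Turing.FinTM2 where
  K := K
  k₀ := k₀
  k₁ := k₁
  Γ := fun _ => Sym
  Λ := Option p.Lab
  main := some p.entry
  ΛFin := @instFintypeOption _ p.labFintype
  σ := Option Sym
  initialState := none
  Γk₀Fin := inferInstanceAs (Fintype Sym)
  m := fun l => match l with
    | none => .halt
    | some a => p.code some none a

/-- The stacks with `s` on the stack `k` and nothing on the others. -/
def single (k : K) (s : List Sym) : Stacks K := fun j => if j = k then s else []

theorem initList_machine [Fintype K] (p : Prog K) (k₀ k₁ : K) (s : List Sym) :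
    Turing.initList (p.machine k₀ k₁) s = ⟨some (some p.entry), none, single k₀ s⟩ := by
  refine congrArg (Turing.TM2.Cfg.mk _ _) (funext fun k => ?_)
  by_cases hk : k = k₀
  · cases hk; exact (dif_pos rfl).trans (if_pos rfl).symm
  · exact (dif_neg hk).trans (if_neg hk).symm

theorem haltList_machine [Fintype K] (p : Prog K) (k₀ k₁ : K) (s : List Sym) :
    Turing.haltList (p.machine k₀ k₁) s = ⟨none, none, single k₁ s⟩ := by
  refine congrArg (Turing.TM2.Cfg.mk _ _) (funext fun k => ?_)
  by_cases hk : k = k₁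
  · cases hk; exact (dif_pos rfl).trans (if_pos rfl).symm
  · exact (dif_neg hk).trans (if_neg hk).symm

/-- A function on strings that a program computes, with the input and the output on two of its
stacks and within a polynomial number of steps, is computable in polynomial time. -/
theorem computableInPolyTime [Fintype K] {α β : Type} {ea : α → List Sym} {eb : β → List Sym}
    {f : α → β} (p : Prog K) (k₀ k₁ : K) (time : Polynomial ℕ)
    (h : ∀ a, ∃ t ≤ time.eval (ea a).length,
      Run p (single k₀ (ea a)) t (single k₁ (eb (f a)))) :
    Nonempty (Turing.TM2ComputableInPolyTime ea eb f) := by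
  choose t ht hrun using h
  refine ⟨{
    tm := p.machine k₀ k₁
    inputAlphabet := Equiv.refl Sym
    outputAlphabet := Equiv.refl Sym
    time := time + 1
    outputsFun := fun a => {
      steps := t a + 1
      evals_in_steps := ?_
      steps_le_m := by simpa using ht a } }⟩
  have key := (hrun a).iterate_step (M := (p.machine k₀ k₁).m) (emb := some) (ex := none)
    (fun _ => rfl)
  have map_id (l : List Sym) : l.map (Equiv.refl Sym).invFun = l := List.map_id l
  rw [Function.iterate_succ_apply']
  have e₀ := (congrArg (Turing.initList (p.machine k₀ k₁)) (map_id (ea a))).trans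
    (p.initList_machine k₀ k₁ _)
  have e₁ := (congrArg (Turing.haltList (p.machine k₀ k₁)) (map_id (eb (f a)))).trans
    (p.haltList_machine k₀ k₁ _)
  exact (congrArg _ ((congrArg _ (congrArg some e₀)).trans key)).trans (congrArg some e₁).symm

/-! ### Running times of stack programs -/

/-- Move symbols from the top of `k` to each of the stacks `ks` while they satisfy `P`. -/
def moveWhile (k : K) (P : Option Sym → Bool) (ks : List K) : Prog K := loop k P (move k ks)

/-- Move the whole stack `k` to each of the stacks `ks`, which reverses it. -/
def transfer (k : K) (ks : List K) : Prog K := moveWhile k Option.isSome ks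

theorem pushes_eq (s : Sym) {ks : List K} (h : ks.Nodup) (S : Stacks K) :
    pushes s ks S = fun j => if j ∈ ks then s :: S j else S j := by
  induction ks generalizing S with
  | nil => simp [pushes]
  | cons k ks ih =>
    rw [List.nodup_cons] at h
    rw [pushes, ih h.2]
    funext j
    by_cases hj : j = k
    · subst hj; simp [h.1]
    · simp [hj]

theorem run_move {k : K} {ks : List K} (h : ks.Nodup) (hk : k ∉ ks) {S : Stacks K} {s : Sym}
    {rest : List Sym} (hS : S k = s :: rest) :
    Run (move k ks) S 1
      (fun j => if j = k then rest else if j ∈ ks then s :: S j else S j) := by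
  convert! Run.move k ks S using 1
  rw [pushes_eq _ h, hS]
  funext j
  by_cases hj : j = k
  · subst hj; simp [hk]
  · simp [hj]

theorem run_moveWhile {k : K} {P : Option Sym → Bool} {ks : List K} (h : ks.Nodup) (hk : k ∉ ks)
    {l rest : List Sym} {S : Stacks K} (hS : S k = l ++ rest) (hl : ∀ s ∈ l, P (some s) = true)
    (hr : P rest.head? = false) :
    Run (moveWhile k P ks) S (2 * l.length + 1)
      (fun j => if j = k then rest else if j ∈ ks then l.reverse ++ S j else S j) := by
  induction l generalizing S with
  | nil =>
    convert! Run.halted (k := k) (P := P) (move k ks) (S := S) (by simpa [hS] using hr) using 1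
    funext j
    by_cases hj : j = k
    · subst hj; simp [hS]
    · simp [hj]
  | cons s l ih =>
    have h₁ := run_move h hk (S := S) (s := s) (rest := l ++ rest) hS
    have h₂ := ih (S := fun j => if j = k then l ++ rest else if j ∈ ks then s :: S j else S j)
      (by simp) (fun s' hs' => hl s' (List.mem_cons_of_mem _ hs'))
    have h₃ := Run.step (P := P) (by simpa [hS] using hl s) h₁ h₂
    convert! h₃ using 1
    · simp; ring
    · funext j
      by_cases hj : j = k
      · simp [hj]
      · by_cases hj' : j ∈ ks <;> simp [hj, hj']

/-- `RunIn p S c S'`: started on the stacks `S`, the program `p` ends within `c` steps with the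
stacks `S'`. -/
def RunIn (p : Prog K) (S : Stacks K) (c : ℕ) (S' : Stacks K) : Prop := ∃ t ≤ c, Run p S t S'

theorem RunIn.mono {p : Prog K} {S S' : Stacks K} {a b : ℕ} (h : RunIn p S a S') (hab : a ≤ b) :
    RunIn p S b S' := by
  obtain ⟨t, ht, hr⟩ := h
  exact ⟨t, ht.trans hab, hr⟩

theorem RunIn.seq {p q : Prog K} {S S' S'' : Stacks K} {a b : ℕ} (hp : RunIn p S a S')
    (hq : RunIn q S' b S'') : RunIn (seq p q) S (a + b) S'' := by
  obtain ⟨t, ht, hr⟩ := hp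
  obtain ⟨t', ht', hr'⟩ := hq
  exact ⟨t + t', by omega, hr.seq hr'⟩

theorem runIn_push {k : K} {s : Sym} {S S' : Stacks K}
    (hS' : ∀ j, S' j = if j = k then s :: S k else S j) : RunIn (push k s) S 1 S' := by
  refine ⟨1, le_rfl, ?_⟩
  convert! Run.push k s S using 1
  funext j
  rw [hS', Function.update_apply]

theorem runIn_pop {k : K} {S S' : Stacks K}
    (hS' : ∀ j, S' j = if j = k then (S k).tail else S j) : RunIn (move k []) S 1 S' := by
  refine ⟨1, le_rfl, ?_⟩
  convert! Run.move k [] S using 1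
  funext j
  rw [hS', pushes, Function.update_apply]

theorem runIn_move {k : K} {ks : List K} (h : ks.Nodup) (hk : k ∉ ks) {S S' : Stacks K} {s : Sym}
    {rest : List Sym} (hS : S k = s :: rest)
    (hS' : ∀ j, S' j = if j = k then rest else if j ∈ ks then s :: S j else S j) :
    RunIn (move k ks) S 1 S' :=
  ⟨1, le_rfl, funext hS' ▸ run_move h hk hS⟩

theorem runIn_moveWhile {k : K} {P : Option Sym → Bool} {ks : List K} (h : ks.Nodup) (hk : k ∉ ks)
    {l rest : List Sym} {S S' : Stacks K} {c : ℕ} (hS : S k = l ++ rest)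
    (hl : ∀ s ∈ l, P (some s) = true) (hr : P rest.head? = false) (hc : l.length ≤ c)
    (hS' : ∀ j, S' j = if j = k then rest else if j ∈ ks then l.reverse ++ S j else S j) :
    RunIn (moveWhile k P ks) S (2 * c + 1) S' :=
  ⟨_, by omega, funext hS' ▸ run_moveWhile h hk hS hl hr⟩

theorem runIn_transfer {k : K} {ks : List K} (h : ks.Nodup) (hk : k ∉ ks) {S S' : Stacks K} {c : ℕ}
    (hc : (S k).length ≤ c)
    (hS' : ∀ j, S' j = if j = k then [] else if j ∈ ks then (S k).reverse ++ S j else S j) :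
    RunIn (transfer k ks) S (2 * c + 1) S' :=
  runIn_moveWhile h hk (by simp) (by simp) rfl hc hS'

/-- A loop that runs through the stacks `f 0, …, f v` takes at most `v (c + 1) + 1` steps if each
pass takes at most `c`. -/
theorem runIn_loop {k : K} {P : Option Sym → Bool} {p : Prog K} (c v : ℕ) (f : ℕ → Stacks K)
    {S S' : Stacks K} (hS : ∀ j, S j = f 0 j) (hS' : ∀ j, S' j = f v j)
    (hP : ∀ j < v, P (f j k).head? = true) (hend : P (f v k).head? = false)
    (hbody : ∀ j < v, RunIn p (f j) c (f (j + 1))) :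
    RunIn (loop k P p) S (v * (c + 1) + 1) S' := by
  rw [funext hS, funext hS']
  clear hS hS' S S'
  induction v generalizing f with
  | zero => exact ⟨1, by simp, Run.halted p hend⟩
  | succ v ih =>
    obtain ⟨t, ht, hr⟩ := hbody 0 v.succ_pos
    obtain ⟨t', ht', hr'⟩ := ih (fun j => f (j + 1)) (fun j hj => hP _ (by omega)) hend
      (fun j hj => hbody _ (by omega))
    refine ⟨1 + t + t', ?_, Run.step (hP 0 v.succ_pos) hr hr'⟩
    have : (v + 1) * (c + 1) = v * (c + 1) + (c + 1) := by ring
    omega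

end Prog

/-! ### Binary counters -/

/-- Addition of one to a binary number, least significant bit first. -/
def incBits : List Bool → List Bool
  | [] => [true]
  | false :: l => true :: l
  | true :: l => false :: incBits l

theorem encodeNat_succ (n : ℕ) :
    Computability.encodeNat (n + 1) = incBits (Computability.encodeNat n) := by
  have hpos : ∀ p : PosNum,
      Computability.encodePosNum p.succ = incBits (Computability.encodePosNum p) := by
    intro p
    induction p with
    | one => rfl
    | bit0 p _ => rfl
    | bit1 p ih => simp [PosNum.succ, Computability.encodePosNum, incBits, ih]
  have hnum : ∀ x : Num, Computability.encodeNum x.succ = incBits (Computability.encodeNum x) := by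
    rintro (_ | p)
    · rfl
    · exact hpos p
  unfold Computability.encodeNat
  rw [← hnum, Nat.cast_succ, Num.add_one]

/-- Addition of one turns the leading ones, to which the carry extends, into zeros and the next bit,
which is zero or beyond the end, into a one. -/
theorem incBits_eq (l : List Bool) : ∃ (j : ℕ) (r : List Bool),
    l = List.replicate j true ++ r ∧ r.head? ≠ some true ∧
      incBits l = List.replicate j false ++ true :: r.tail := by
  induction l with
  | nil => exact ⟨0, [], by simp [incBits]⟩
  | cons b l ih =>
    cases b with
    | false => exact ⟨0, false :: l, by simp [incBits]⟩
    | true =>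
      obtain ⟨j, r, h₁, h₂, h₃⟩ := ih
      exact ⟨j + 1, r, by simp [List.replicate_succ, ← h₁], h₂,
        by simp [incBits, h₃, List.replicate_succ]⟩

theorem length_incBits_le (l : List Bool) : (incBits l).length ≤ l.length + 1 := by
  induction l with
  | nil => simp [incBits]
  | cons b l ih => cases b <;> simp [incBits]; exact ih

theorem length_encodeNat_le (n : ℕ) : (Computability.encodeNat n).length ≤ n := by
  induction n with
  | zero => rfl
  | succ n ih =>
    rw [encodeNat_succ]
    exact (length_incBits_le _).trans (by omega)

/-- The symbols of a list of bits. -/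
def bitSyms (l : List Bool) : List Sym := l.map fun b => if b then Sym.one else Sym.zero

/-! ### Registers -/

/-- Names of loop variables. -/
inductive Var : Type
  | t | k | l | i | j | u | v
  deriving DecidableEq

instance : Fintype Var where
  elems := {.t, .k, .l, .i, .j, .u, .v}
  complete x := by cases x <;> decide

/-- Registers for natural numbers: the number `n` of qubits, the number `m` of circuits and their
total number `a` of ancillas, and for every loop variable its value counted upwards from zero and
counted downwards to zero. -/
inductive Reg : Type
  | n | m | a
  | up (x : Var)
  | down (x : Var)
  deriving DecidableEq, Fintype

/-- The stacks of the machine: input and output, the reversed output, auxiliary stacks, the gates of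
the given circuits (`data`, and `back` for those already read), and the registers in unary. -/
inductive Stk : Type
  | inp | out | acc | tmp | bin | carry | data | back
  | reg (r : Reg)
  deriving DecidableEq, Fintype

/-- Values of the registers. -/
abbrev Env : Type := Reg → ℕ

/-- The environment in which the loop variable `x` is `u` counted upwards and `d` downwards. -/
def Env.bind (e : Env) (x : Var) (u d : ℕ) : Env := fun r =>
  if r = Reg.up x then u else if r = Reg.down x then d else e r

/-- The stacks with given registers, reversed output and gates, and all other stacks empty. -/
def config (e : Env) (acc data back : List Sym) : Stacks Stk
  | .acc => acc
  | .data => data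
  | .back => back
  | .reg r => List.replicate (e r) Sym.tick
  | _ => []

/-! ### A loop language that writes strings -/

/-- Programs that write strings. `loop x r p` runs `p` once for each number below the register `r`,
`bin r` writes in binary the value of `r` plus one, and `circ x p q` runs through the given
circuits, writing the string of `p`, the gates of the circuit and the string of `q`. -/
inductive Em : Type
  | nil
  | sym (s : Sym)
  | seq (p q : Em)
  | loop (x : Var) (r : Reg) (p : Em)
  | bin (r : Reg)
  | circ (x : Var) (p q : Em)

namespace Em

/-- The string written by a program when `gs` are the encoded gate lists of the circuits. -/
def eval (gs : List (List Sym)) : Em → Env → List Sym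
  | nil, _ => []
  | sym s, _ => [s]
  | seq p q, e => p.eval gs e ++ q.eval gs e
  | loop x r p, e => (List.range (e r)).flatMap fun j => p.eval gs (e.bind x j (e r - 1 - j))
  | bin r, e => bitSyms (Computability.encodeNat (e r + 1))
  | circ x p q, e =>
      gs.zipIdx.flatMap fun g => p.eval gs (e.bind x g.2 0) ++ g.1 ++ q.eval gs (e.bind x g.2 0)

/-- The loop variable `x` is not used as such in the program. -/
def free (x : Var) : Em → Bool
  | nil | sym _ | bin _ => true
  | seq p q => p.free x && q.free x
  | loop y _ p => decide (x ≠ y) && p.free x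
  | circ y p q => decide (x ≠ y) && p.free x && q.free x

/-- The program does not read the given circuits. -/
def plain : Em → Bool
  | nil | sym _ | bin _ => true
  | seq p q => p.plain && q.plain
  | loop _ _ p => p.plain
  | circ _ _ _ => false

/-- Nested loops have different variables, no loop is bounded by its own variable, and loops over
the given circuits are not nested. -/
def wf : Em → Bool
  | nil | sym _ | bin _ => true
  | seq p q => p.wf && q.wf
  | loop x r p => decide (r ≠ Reg.up x) && decide (r ≠ Reg.down x) && p.free x && p.wf
  | circ x p q => p.free x && q.free x && p.wf && q.wf && p.plain && q.plain

open Prog in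
/-- Addition of one to the binary number on the stack `bin`. -/
def incProg : Prog Stk :=
  .seq (moveWhile .bin (fun o => decide (o = some Sym.one)) [.carry])
    (.seq (.move .bin [])
      (.seq (.push .bin .one)
        (.loop .carry Option.isSome (.seq (.move .carry []) (.push .bin .zero)))))

open Prog in
/-- The stack program of a loop program. It pushes the string on the stack `acc`. -/
def prog : Em → Prog Stk
  | nil => .loop .tmp Option.isSome (.move .tmp [])
  | sym s => .push .acc s
  | seq p q => .seq p.prog q.prog
  | loop x r p =>
      .seq (transfer (.reg r) [.tmp])
        (.seq (transfer .tmp [.reg r, .reg (.down x)])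
          (.seq (.loop (.reg (.down x)) Option.isSome
              (.seq (.move (.reg (.down x)) []) (.seq p.prog (.push (.reg (.up x)) .tick))))
            (transfer (.reg (.up x)) [])))
  | bin r =>
      .seq (.push .bin .one)
        (.seq (transfer (.reg r) [.tmp])
          (.seq (.loop .tmp Option.isSome (.seq (.move .tmp [.reg r]) incProg))
            (transfer .bin [.acc])))
  | circ x p q =>
      .seq (.loop .data Option.isSome
          (.seq p.prog
            (.seq (moveWhile .data (fun o => decide (o ≠ some Sym.close)) [.back, .acc])
              (.seq (.move .data [.back])
                (.seq q.prog (.push (.reg (.up x)) .tick))))))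
        (.seq (transfer .back [.data]) (transfer (.reg (.up x)) []))

/-- A bound for the number of steps of a program when all registers are at most `M` and the gates
of the circuits have at most `M` symbols. -/
noncomputable def cost : Em → Polynomial ℕ
  | nil => 1
  | sym _ => 1
  | seq p q => p.cost + q.cost
  | loop _ _ p => 10 * (Polynomial.X + 1) + Polynomial.X * (p.cost + 3)
  | bin _ => 100 * (Polynomial.X + 1) ^ 2
  | circ _ p q => 10 * (Polynomial.X + 1) + Polynomial.X * (p.cost + q.cost + 2 * Polynomial.X + 4)

/-! ### Execution of loop programs -/

open Prog

theorem runIn_incProg {S S' : Stacks Stk} {l : List Bool} (hS : S .bin = bitSyms l)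
    (hc : S .carry = [])
    (hS' : ∀ s, S' s = if s = .bin then bitSyms (incBits l) else S s) :
    RunIn incProg S (5 * (l.length + 1)) S' := by
  obtain ⟨j, r, h₁, h₂, h₃⟩ := incBits_eq l
  -- the stacks after `i` passes of the loop that turns the carried ones into zeros
  let f : ℕ → Stacks Stk := fun i s => if s = .carry then List.replicate (j - i) Sym.one else
    if s = .bin then List.replicate i Sym.zero ++ Sym.one :: bitSyms r.tail else S s
  have hlen : j ≤ l.length := by simp [h₁]
  have step₁ := runIn_moveWhile (k := Stk.bin) (P := fun o => decide (o = some Sym.one))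
    (ks := [.carry]) (by simp) (by simp) (l := List.replicate j Sym.one) (rest := bitSyms r)
    (S := S) (c := j) (by simp [hS, h₁, bitSyms])
    (by intro s hs; simpa using (List.mem_replicate.1 hs).2)
    (by rcases r with _ | ⟨_ | _, r⟩ <;> simp [bitSyms] at h₂ ⊢)
    (by simp) (fun _ => rfl)
  have step₂ := step₁.seq ((runIn_pop (k := .bin) (fun _ => rfl)).seq
    ((runIn_push (k := .bin) (s := .one) (fun _ => rfl)).seq (runIn_loop (k := Stk.carry) (P := Option.isSome)
      (p := .seq (.move .carry []) (.push .bin .zero)) 2 j f (S' := S') ?_ ?_ ?_ ?_ ?_)))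
  · exact step₂.mono (by omega)
  · intro s
    by_cases h : s = Stk.bin
    · subst h; simp [f, bitSyms]
    · by_cases h' : s = Stk.carry
      · subst h'; simp [f, hc]
      · simp [f, h, h']
  · intro s
    by_cases h : s = Stk.bin
    · subst h; simp [f, bitSyms, h₃, hS']
    · by_cases h' : s = Stk.carry
      · subst h'; simp [f, hc, hS']
      · simp [f, h, h', hS']
  · intro i hi
    obtain ⟨d, hd⟩ : ∃ d, j - i = d + 1 := ⟨j - i - 1, by omega⟩
    simp [f, hd, List.replicate_succ]
  · simp [f]
  · intro i hi
    obtain ⟨d, hd⟩ : ∃ d, j - i = d + 1 := ⟨j - i - 1, by omega⟩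
    have hd' : j - (i + 1) = d := by omega
    refine (runIn_pop (fun _ => rfl)).seq (runIn_push fun s => ?_)
    by_cases h : s = Stk.bin
    · subst h; simp [f, List.replicate_succ]
    · by_cases h' : s = Stk.carry
      · subst h'; simp [f, hd, hd', List.replicate_succ]
      · simp [f, h, h']

theorem runIn_bin (e : Env) (r : Reg) (acc D B : List Sym) {M : ℕ} (hM : e r ≤ M) :
    RunIn (bin r).prog (config e acc D B) (100 * (M + 1) ^ 2)
      (config e ((bitSyms (Computability.encodeNat (e r + 1))).reverse ++ acc) D B) := by
  let g : ℕ → ℕ → List Bool → Stacks Stk := fun a b l s =>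
    if s = .tmp then List.replicate a Sym.tick else if s = .bin then bitSyms l else
      if s = .reg r then List.replicate b Sym.tick else config e acc D B s
  have hl := length_encodeNat_le (e r + 1)
  have step := (runIn_push (k := .bin) (s := .one) (S := config e acc D B) (fun _ => rfl)).seq
    ((runIn_transfer (k := .reg r) (ks := [.tmp]) (by simp) (by simp)
        (S' := g (e r) 0 [true]) (c := M) ?_ ?_).seq
      ((runIn_loop (k := .tmp) (P := Option.isSome) (p := .seq (.move .tmp [.reg r]) incProg)
          (1 + 5 * (M + 2)) (e r) (fun i => g (e r - i) i (Computability.encodeNat (i + 1)))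
          (fun s => ?_) (fun _ => rfl) ?_ ?_ ?_).seq
        (runIn_transfer (k := .bin) (ks := [.acc]) (by simp) (by simp) (c := M + 1)
          (S' := config e ((bitSyms (Computability.encodeNat (e r + 1))).reverse ++ acc) D B)
          ?_ ?_)))
  · refine step.mono ?_
    have : e r * (1 + 5 * (M + 2) + 1) ≤ M * (1 + 5 * (M + 2) + 1) := Nat.mul_le_mul_right _ hM
    nlinarith
  · simpa [config] using hM
  · intro s
    by_cases h : s = Stk.bin
    · subst h; simp [g, bitSyms, config]
    · by_cases h' : s = Stk.tmp
      · subst h'; simp [g, config]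
      · by_cases h'' : s = Stk.reg r
        · subst h''; simp [g]
        · simp [g, h, h', h'']
  · rfl
  · intro i hi
    obtain ⟨d, hd⟩ : ∃ d, e r - i = d + 1 := ⟨e r - i - 1, by omega⟩
    simp [g, hd, List.replicate_succ]
  · simp [g]
  · intro i hi
    obtain ⟨d, hd⟩ : ∃ d, e r - i = d + 1 := ⟨e r - i - 1, by omega⟩
    have hd' : e r - (i + 1) = d := by omega
    have hl := length_encodeNat_le (i + 1)
    refine (runIn_move (by simp) (by simp) (s := .tick) (rest := List.replicate d Sym.tick)
      (by simp [g, hd, List.replicate_succ]) (fun _ => rfl)).seq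
      ((runIn_incProg (l := Computability.encodeNat (i + 1)) (by simp [g])
        (by simp [g, config]) (fun s => ?_)).mono (by omega))
    simp only [g, hd', encodeNat_succ (i + 1)]
    by_cases h : s = Stk.bin
    · subst h; simp
    · by_cases h' : s = Stk.tmp
      · subst h'; simp
      · by_cases h'' : s = Stk.reg r
        · subst h''; simp [List.replicate_succ]
        · simp [h, h', h'']
  · simpa [g, bitSyms] using hl.trans (by omega)
  · intro s
    by_cases h : s = Stk.bin
    · subst h; simp [config]
    · by_cases h' : s = Stk.acc
      · subst h'; simp [g, config]
      · by_cases h'' : s = Stk.reg r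
        · subst h''; simp [g, config]
        · by_cases h₃ : s = Stk.tmp
          · subst h₃; simp [g, config]
          · cases s <;> simp_all [g, config]

end Em

/-- The gates of the given circuits, each list followed by a closing symbol. -/
def joinData (gs : List (List Sym)) : List Sym := gs.flatMap fun g => g ++ [Sym.close]

theorem joinData_cons (g : List Sym) (gs : List (List Sym)) :
    joinData (g :: gs) = g ++ Sym.close :: joinData gs := by
  simp [joinData]

theorem joinData_append (gs gs' : List (List Sym)) :
    joinData (gs ++ gs') = joinData gs ++ joinData gs' := by
  simp [joinData]

theorem length_le_length_joinData (gs : List (List Sym)) : gs.length ≤ (joinData gs).length := by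
  induction gs with
  | nil => simp
  | cons g gs ih => simp [joinData] at ih ⊢; omega

theorem Env.bind_up (e : Env) (x : Var) (u d : ℕ) : e.bind x u d (.up x) = u := by
  simp [Env.bind]

theorem Env.bind_down (e : Env) (x : Var) (u d : ℕ) : e.bind x u d (.down x) = d := by
  simp [Env.bind]

theorem Env.bind_of_ne (e : Env) (x : Var) (u d : ℕ) {r : Reg} (h : r ≠ .up x) (h' : r ≠ .down x) :
    e.bind x u d r = e r := by
  simp [Env.bind, h, h']

theorem Env.bind_zero {e : Env} {x : Var} (h : e (.up x) = 0 ∧ e (.down x) = 0) :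
    e.bind x 0 0 = e := by
  funext r
  by_cases h₁ : r = .up x
  · subst h₁; simp [Env.bind, h.1]
  · by_cases h₂ : r = .down x
    · subst h₂; simp [Env.bind, h.2]
    · simp [Env.bind, h₁, h₂]

namespace Em

open Prog

/-- A loop pushes the strings of its passes, if pass `j` pushes `w j` within `c` steps. -/
theorem runIn_loopProg {p : Em} {x : Var} {r : Reg} {e : Env} {D B : List Sym} {M c : ℕ}
    {w : ℕ → List Sym} (acc : List Sym) (hr : r ≠ .up x) (hr' : r ≠ .down x)
    (he : e (.up x) = 0 ∧ e (.down x) = 0) (hM : e r ≤ M)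
    (hp : ∀ j < e r, ∀ acc, RunIn p.prog (config (e.bind x j (e r - 1 - j)) acc D B) c
      (config (e.bind x j (e r - 1 - j)) ((w j).reverse ++ acc) D B)) :
    RunIn (loop x r p).prog (config e acc D B) (10 * (M + 1) + M * (c + 3))
      (config e (((List.range (e r)).flatMap w).reverse ++ acc) D B) := by
  let f : ℕ → Stacks Stk := fun j =>
    config (e.bind x j (e r - j)) (((List.range j).flatMap w).reverse ++ acc) D B
  have step := (runIn_transfer (k := .reg r) (ks := [.tmp]) (by simp) (by simp)
      (S := config e acc D B) (c := M) (by simpa [config] using hM) (fun _ => rfl)).seq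
    ((runIn_transfer (k := .tmp) (ks := [.reg r, .reg (.down x)]) (by simpa using hr') (by simp)
        (S' := f 0) (c := M) (by simpa [config] using hM) (fun s => ?_)).seq
      ((runIn_loop (k := .reg (.down x)) (P := Option.isSome)
          (p := .seq (.move (.reg (.down x)) []) (.seq p.prog (.push (.reg (.up x)) .tick)))
          (1 + (c + 1)) (e r) f
          (fun s => rfl) (fun _ => rfl) ?_ ?_ ?_).seq
        (runIn_transfer (k := .reg (.up x)) (ks := []) (by simp) (by simp) (c := M)
          (S' := config e (((List.range (e r)).flatMap w).reverse ++ acc) D B) ?_ ?_)))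
  · refine step.mono ?_
    have : e r * (1 + (c + 1) + 1) ≤ M * (1 + (c + 1) + 1) := Nat.mul_le_mul_right _ hM
    nlinarith
  · by_cases h : s = .reg r
    · subst h; simp [f, config, Env.bind_of_ne _ _ _ _ hr hr']
    · by_cases h' : s = .reg (.down x)
      · subst h'; simp [f, config, Env.bind_down, he.2]
      · cases s with
        | reg r' =>
          by_cases h'' : r' = .up x
          · subst h''; simp_all [f, config, Env.bind_up]
          · simp_all [f, config, Env.bind]
        | _ => simp [f, config]
  · intro j hj
    obtain ⟨d, hd⟩ : ∃ d, e r - j = d + 1 := ⟨e r - j - 1, by omega⟩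
    simp [f, config, Env.bind_down, hd, List.replicate_succ]
  · simp [f, config, Env.bind_down]
  · intro j hj
    obtain ⟨d, hd⟩ : ∃ d, e r - j = d + 1 := ⟨e r - j - 1, by omega⟩
    have hd' : e r - (j + 1) = d := by omega
    have hd'' : e r - 1 - j = d := by omega
    refine (runIn_pop (S' := config (e.bind x j (e r - 1 - j))
      (((List.range j).flatMap w).reverse ++ acc) D B) fun s => ?_).seq ((hp j hj _).seq
        (runIn_push fun s => ?_))
    · rw [hd'']
      by_cases h' : s = .reg (.down x)
      · subst h'; simp [f, config, Env.bind_down, hd, List.replicate_succ]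
      · cases s with
        | reg r' => simp_all [f, config, Env.bind]
        | _ => simp [f, config]
    · rw [hd'']
      by_cases h' : s = .reg (.up x)
      · subst h'; simp [f, config, Env.bind_up, List.replicate_succ]
      · cases s with
        | reg r' => simp_all [f, config, Env.bind]
        | _ => simp [f, config, List.range_succ]
  · simpa [f, config, Env.bind_up] using hM
  · intro s
    by_cases h' : s = .reg (.up x)
    · subst h'; simp [config, he.1]
    · cases s with
      | reg r' =>
        by_cases h'' : r' = .down x
        · subst h''; simp_all [f, config, Env.bind_down]
        · simp_all [f, config, Env.bind]
      | _ => simp [f, config]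

/-- A loop over the given circuits pushes for circuit `j` the string `w j`, the gates and the string
`w' j`, if its body does so within `c` and `d` steps. -/
theorem runIn_circProg {p q : Em} {x : Var} {e : Env} {gs : List (List Sym)} {M c d : ℕ}
    {w w' : ℕ → List Sym} (acc : List Sym) (hgs : ∀ g ∈ gs, Sym.close ∉ g)
    (he : e (.up x) = 0 ∧ e (.down x) = 0) (hM : (joinData gs).length ≤ M)
    (hp : ∀ j < gs.length, ∀ acc D B, RunIn p.prog (config (e.bind x j 0) acc D B) c
      (config (e.bind x j 0) ((w j).reverse ++ acc) D B))
    (hq : ∀ j < gs.length, ∀ acc D B, RunIn q.prog (config (e.bind x j 0) acc D B) d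
      (config (e.bind x j 0) ((w' j).reverse ++ acc) D B)) :
    RunIn (circ x p q).prog (config e acc (joinData gs) [])
      (10 * (M + 1) + M * (c + d + 2 * M + 4))
      (config e ((gs.zipIdx.flatMap fun g => w g.2 ++ g.1 ++ w' g.2).reverse ++ acc)
        (joinData gs) []) := by
  let f : ℕ → Stacks Stk := fun j => config (e.bind x j 0)
    (((gs.zipIdx.take j).flatMap fun g => w g.2 ++ g.1 ++ w' g.2).reverse ++ acc)
      (joinData (gs.drop j)) (joinData (gs.take j)).reverse
  have hlen : gs.length ≤ M := (length_le_length_joinData gs).trans hM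
  have step := (runIn_loop (k := .data) (P := Option.isSome)
      (p := .seq p.prog
        (.seq (moveWhile .data (fun o => decide (o ≠ some Sym.close)) [.back, .acc])
          (.seq (.move .data [.back]) (.seq q.prog (.push (.reg (.up x)) .tick)))))
      (S := config e acc (joinData gs) [])
      (c + ((2 * M + 1) + (1 + (d + 1)))) gs.length f
      (fun s => ?_) (fun _ => rfl) ?_ ?_ ?_).seq
    ((runIn_transfer (k := .back) (ks := [.data]) (by simp) (by simp) (c := M) ?_
        (fun _ => rfl)).seq
      (runIn_transfer (k := .reg (.up x)) (ks := []) (by simp) (by simp) (c := M)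
        (S' := config e ((gs.zipIdx.flatMap fun g => w g.2 ++ g.1 ++ w' g.2).reverse ++ acc)
          (joinData gs) []) ?_ ?_))
  · refine step.mono ?_
    have : gs.length * (c + ((2 * M + 1) + (1 + (d + 1))) + 1) ≤
      M * (c + ((2 * M + 1) + (1 + (d + 1))) + 1) := Nat.mul_le_mul_right _ hlen
    nlinarith
  · simp [f, Env.bind_zero he, joinData]
  · intro j hj
    rw [Option.isSome_iff_ne_none]
    have h : joinData (gs.drop j) ≠ [] := by
      rw [List.drop_eq_getElem_cons hj, joinData_cons]; simp
    simpa [f, config] using h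
  · simp [f, config, joinData]
  · intro j hj
    have hmem : gs[j] ∈ gs := List.getElem_mem hj
    have hg : gs[j].length ≤ M := by
      refine le_trans ?_ hM
      rw [joinData, List.length_flatMap]
      refine le_trans ?_ (List.single_le_sum (by simp) _
        (List.mem_map.2 ⟨gs[j], hmem, rfl⟩))
      simp
    have htake : gs.zipIdx.take (j + 1) = gs.zipIdx.take j ++ [(gs[j], j)] := by
      rw [List.take_succ_eq_append_getElem (by simpa using hj)]
      simp
    refine (hp j hj _ _ _).seq ((runIn_moveWhile (l := gs[j])
      (rest := Sym.close :: joinData (gs.drop (j + 1)))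
      (S' := config (e.bind x j 0) (gs[j].reverse ++ ((w j).reverse ++
        (((gs.zipIdx.take j).flatMap fun g => w g.2 ++ g.1 ++ w' g.2).reverse ++ acc)))
        (Sym.close :: joinData (gs.drop (j + 1))) (gs[j].reverse ++ (joinData (gs.take j)).reverse))
      (by simp) (by simp) ?_ ?_ ?_ hg ?_).seq
      ((runIn_move (s := .close) (rest := joinData (gs.drop (j + 1)))
        (S' := config (e.bind x j 0) (gs[j].reverse ++ ((w j).reverse ++
        (((gs.zipIdx.take j).flatMap fun g => w g.2 ++ g.1 ++ w' g.2).reverse ++ acc)))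
        (joinData (gs.drop (j + 1)))
        (Sym.close :: (gs[j].reverse ++ (joinData (gs.take j)).reverse)))
        (by simp) (by simp) rfl ?_).seq ((hq j hj _ _ _).seq
        (runIn_push ?_))))
    · change joinData (gs.drop j) = _
      rw [List.drop_eq_getElem_cons hj, joinData_cons]
    · intro s hs
      have : s ≠ Sym.close := fun h => hgs _ hmem (h ▸ hs)
      simpa using this
    · simp
    · intro s; cases s <;> simp [config]
    · intro s; cases s <;> simp [config]
    · intro s
      by_cases h' : s = .reg (.up x)
      · subst h'; simp [f, config, Env.bind_up, List.replicate_succ]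
      · cases s with
        | reg r' => simp_all [f, config, Env.bind]
        | back =>
          change (joinData (gs.take (j + 1))).reverse = _
          rw [List.take_succ_eq_append_getElem hj, joinData_append]
          simp [config, joinData]
        | acc => simp only [f, config, htake]; simp
        | _ => simp [f, config]
  · simpa [f, config] using hM
  · simpa [f, config, Env.bind_up] using hlen
  · intro s
    by_cases h' : s = .reg (.up x)
    · subst h'; simp [config, he.1]
    · cases s with
      | reg r' =>
        by_cases h'' : r' = .down x
        · subst h''; simp_all [f, config, Env.bind_down]
        · simp_all [f, config, Env.bind]
      | data => simp [f, config, joinData]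
      | acc => simp [f, config, List.take_of_length_le]
      | _ => simp [f, config]

/-- A loop program pushes the string that it writes, and leaves the registers and the given
circuits as they were. -/
theorem runIn_prog {gs : List (List Sym)} (hgs : ∀ g ∈ gs, Sym.close ∉ g) {M : ℕ}
    (hM : (joinData gs).length ≤ M) (p : Em) (e : Env) (acc D B : List Sym) (hwf : p.wf = true)
    (hfree : ∀ x, p.free x = false → e (.up x) = 0 ∧ e (.down x) = 0) (he : ∀ r, e r ≤ M)
    (hD : p.plain = true ∨ D = joinData gs ∧ B = []) :
    RunIn p.prog (config e acc D B) (p.cost.eval M)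
      (config e ((p.eval gs e).reverse ++ acc) D B) := by
  induction p generalizing e acc D B with
  | nil =>
    refine ⟨1, by simp [cost], ?_⟩
    exact Run.halted _ rfl
  | sym s =>
    refine (runIn_push fun s' => ?_).mono (by simp [cost])
    cases s' <;> simp [config, eval]
  | seq p q ihp ihq =>
    simp only [wf, Bool.and_eq_true, plain, free, Bool.and_eq_false_iff] at hwf hD hfree
    have h₁ := ihp e acc D B hwf.1 (fun x hx => hfree x (.inl hx)) he (hD.imp_left (·.1))
    have h₂ := ihq e ((p.eval gs e).reverse ++ acc) D B hwf.2 (fun x hx => hfree x (.inr hx)) he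
      (hD.imp_left (·.2))
    have h := h₁.seq h₂
    simp only [cost, Polynomial.eval_add, eval, List.reverse_append, List.append_assoc]
    exact h
  | loop x r p ih =>
    simp only [wf, Bool.and_eq_true, decide_eq_true_eq, plain, free, Bool.and_eq_false_iff,
      decide_eq_false_iff_not, not_not] at hwf hD hfree
    obtain ⟨⟨⟨hr, hr'⟩, hx⟩, hp⟩ := hwf
    refine (runIn_loopProg acc hr hr' (hfree x (.inl rfl)) (he r) fun j hj acc =>
      ih _ acc D B hp (fun y hy => ?_) (fun r' => ?_) hD).mono (by simp [cost])
    · have hxy : y ≠ x := by rintro rfl; simp [hx] at hy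
      rw [Env.bind_of_ne, Env.bind_of_ne]
      · exact hfree y (.inr hy)
      all_goals simp [hxy]
    · have := he r
      have := he r'
      unfold Env.bind
      split_ifs <;> omega
  | bin r =>
    refine (runIn_bin e r acc D B (he r)).mono (by simp [cost])
  | circ x p q ihp ihq =>
    simp only [wf, Bool.and_eq_true, plain, free, Bool.and_eq_false_iff, decide_eq_false_iff_not,
      not_not, Bool.false_eq_true, false_or] at hwf hD hfree
    obtain ⟨rfl, rfl⟩ := hD
    obtain ⟨⟨⟨⟨⟨hx, hx'⟩, hp⟩, hq⟩, hp'⟩, hq'⟩ := hwf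
    have hlen := (length_le_length_joinData gs).trans hM
    have hb (j : ℕ) (hj : j < gs.length) (r : Reg) : e.bind x j 0 r ≤ M := by
      have := he r
      unfold Env.bind
      split_ifs <;> omega
    refine (runIn_circProg (w := fun j => p.eval gs (e.bind x j 0))
      (w' := fun j => q.eval gs (e.bind x j 0)) acc hgs (hfree x (.inl (.inl rfl))) hM
      (fun j hj acc D B => ihp _ acc D B hp (fun y hy => ?_) (hb j hj) (.inl hp'))
      (fun j hj acc D B => ihq _ acc D B hq (fun y hy => ?_) (hb j hj) (.inl hq'))).mono
        (by simp [cost])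
    · have hxy : y ≠ x := by rintro rfl; simp [hx] at hy
      rw [Env.bind_of_ne, Env.bind_of_ne]
      · exact hfree y (.inl (.inr hy))
      all_goals simp [hxy]
    · have hxy : y ≠ x := by rintro rfl; simp [hx'] at hy
      rw [Env.bind_of_ne, Env.bind_of_ne]
      · exact hfree y (.inr hy)
      all_goals simp [hxy]

end Em

theorem length_flatMap_le {α β : Type} (l : List α) (f : α → List β) {b : ℕ}
    (h : ∀ a ∈ l, (f a).length ≤ b) : (l.flatMap f).length ≤ l.length * b := by
  rw [List.length_flatMap]
  refine (List.sum_le_card_nsmul _ b ?_).trans (by simp)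
  intro x hx
  obtain ⟨a, ha, rfl⟩ := List.mem_map.1 hx
  exact h a ha

theorem length_le_joinData_of_mem {gs : List (List Sym)} {g : List Sym} (h : g ∈ gs) :
    g.length ≤ (joinData gs).length := by
  induction gs with
  | nil => simp at h
  | cons g' gs ih =>
    rw [joinData_cons]
    rcases List.mem_cons.1 h with rfl | h
    · simp
    · have := ih h
      simp; omega

/-- The bound for the number of steps bounds the length of the written string, too. -/
theorem Em.length_eval_le {gs : List (List Sym)} {M : ℕ} (hM : (joinData gs).length ≤ M) (p : Em)
    (e : Env) (he : ∀ r, e r ≤ M) : (p.eval gs e).length ≤ p.cost.eval M := by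
  have hlen := (length_le_length_joinData gs).trans hM
  have hb (e : Env) (he : ∀ r, e r ≤ M) (x : Var) (u d : ℕ) (hu : u ≤ M) (hd : d ≤ M) (r : Reg) :
      e.bind x u d r ≤ M := by
    have := he r
    unfold Env.bind
    split_ifs <;> omega
  induction p generalizing e with
  | nil => simp [eval]
  | sym s => simp [eval, cost]
  | seq p q ihp ihq =>
    simp only [eval, cost, List.length_append, Polynomial.eval_add]
    exact Nat.add_le_add (ihp e he) (ihq e he)
  | loop x r p ih =>
    have hr := he r
    have h := length_flatMap_le (List.range (e r))
      (fun j => p.eval gs (e.bind x j (e r - 1 - j))) (b := p.cost.eval M) (fun j hj =>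
        ih _ (hb e he x _ _ (by have := List.mem_range.1 hj; omega) (by omega)))
    have : e r * p.cost.eval M ≤ M * p.cost.eval M := Nat.mul_le_mul_right _ hr
    simp only [eval, cost, Polynomial.eval_add, Polynomial.eval_mul, Polynomial.eval_X,
      Polynomial.eval_ofNat, Polynomial.eval_one]
    rw [List.length_range] at h
    nlinarith
  | bin r =>
    have := length_encodeNat_le (e r + 1)
    have := he r
    simp [eval, cost, bitSyms]
    nlinarith
  | circ x p q ihp ihq =>
    have h := length_flatMap_le gs.zipIdx
      (fun g => p.eval gs (e.bind x g.2 0) ++ g.1 ++ q.eval gs (e.bind x g.2 0))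
      (b := p.cost.eval M + M + q.cost.eval M) (fun g hg => by
        obtain ⟨h₁, h₂, h₃⟩ := List.mem_zipIdx (x := g.1) (i := g.2) hg
        have hmem : g.1 ∈ gs := h₃ ▸ List.getElem_mem _
        have hg' : g.2 ≤ M := by omega
        have h₄ := ihp _ (hb e he x g.2 0 hg' (by omega))
        have h₅ := ihq _ (hb e he x g.2 0 hg' (by omega))
        have h₆ := (length_le_joinData_of_mem hmem).trans hM
        simp only [List.length_append]
        omega)
    rw [List.length_zipIdx] at h
    have : gs.length * (p.cost.eval M + M + q.cost.eval M) ≤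
      M * (p.cost.eval M + M + q.cost.eval M) := Nat.mul_le_mul_right _ hlen
    simp only [eval, cost, Polynomial.eval_add, Polynomial.eval_mul, Polynomial.eval_X,
      Polynomial.eval_ofNat, Polynomial.eval_one]
    nlinarith

/-! ### Reading the input -/

/-- The encoded gate lists of the given circuits. -/
def gateData (cs : List UnitaryCircuit) : List (List Sym) :=
  cs.map fun c => c.gates.flatMap encGate

/-- The total number of ancillas of the given circuits. -/
def ancSum (cs : List UnitaryCircuit) : ℕ := (cs.map UnitaryCircuit.anc).sum

/-- The registers after reading the input. -/
def inputEnv (n m a : ℕ) : Env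
  | .n => n
  | .m => m
  | .a => a
  | _ => 0

theorem close_notMem_encUnary (n : ℕ) : Sym.close ∉ encUnary n := by
  simp [encUnary]

theorem close_notMem_encBinary (n : ℕ) : Sym.close ∉ encBinary n := by
  simp only [encBinary, List.mem_append, List.mem_map, not_or, not_exists, not_and]
  exact ⟨fun b _ => by cases b <;> simp, by simp⟩

theorem close_notMem_encGate (g : Gate) : Sym.close ∉ encGate g := by
  have hu := close_notMem_encUnary
  have hb := close_notMem_encBinary
  rcases g with ⟨u, q⟩ | ⟨c, t⟩ | ⟨a, b⟩ | ⟨c, d, t⟩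
  · cases u <;> simp [encGate, encOneQubit, hu, hb]
  all_goals simp [encGate, hu]

theorem close_notMem_gateData (cs : List UnitaryCircuit) : ∀ g ∈ gateData cs, Sym.close ∉ g := by
  intro g hg
  obtain ⟨c, _, rfl⟩ := List.mem_map.1 hg
  intro h
  obtain ⟨g, _, hg⟩ := List.mem_flatMap.1 h
  exact close_notMem_encGate g hg

theorem encUnitaryCircuit_eq (c : UnitaryCircuit) : encUnitaryCircuit c =
    List.replicate c.anc Sym.tick ++ Sym.sep :: (c.gates.flatMap encGate ++ [Sym.close]) := by
  simp [encUnitaryCircuit, encUnary, encList]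

theorem length_flatMap_encUnitaryCircuit (cs : List UnitaryCircuit) :
    (cs.flatMap encUnitaryCircuit).length =
      ancSum cs + cs.length + (joinData (gateData cs)).length := by
  induction cs with
  | nil => simp [ancSum, joinData, gateData]
  | cons c cs ih =>
    have h₁ : ancSum (c :: cs) = c.anc + ancSum cs := by simp [ancSum]
    have h₂ : joinData (gateData (c :: cs)) =
      c.gates.flatMap encGate ++ Sym.close :: joinData (gateData cs) := joinData_cons _ _
    rw [List.flatMap_cons, List.length_append, ih, encUnitaryCircuit_eq, h₁, h₂]
    simp only [List.length_append, List.length_replicate, List.length_cons, List.length_nil]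
    omega

theorem length_encOIInput (x : OIInput) : (encOIInput x).length =
    x.n + (ancSum x.circuits + x.circuits.length + (joinData (gateData x.circuits)).length) +
      2 := by
  simp [encOIInput, encUnary, encList, -List.length_flatMap, length_flatMap_encUnitaryCircuit]
  omega

open Prog in
/-- The program that reads the input into the registers and the stack of gates. -/
def readProg : Prog Stk :=
  .seq (moveWhile .inp (fun o => decide (o = some Sym.tick)) [.reg .n])
    (.seq (.move .inp [])
      (.seq (.loop .inp (fun o => decide (o ≠ some Sym.close))
          (.seq (moveWhile .inp (fun o => decide (o = some Sym.tick)) [.reg .a])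
            (.seq (.move .inp [])
              (.seq (moveWhile .inp (fun o => decide (o ≠ some Sym.close)) [.back])
                (.seq (.move .inp [.back]) (.push (.reg .m) .tick))))))
        (.seq (.move .inp []) (transfer .back [.data]))))

open Prog in
theorem runIn_readProg (x : OIInput) {M : ℕ} (hM : (encOIInput x).length ≤ M) :
    RunIn readProg (single .inp (encOIInput x)) (20 * (M + 1) ^ 2)
      (config (inputEnv x.n x.circuits.length (ancSum x.circuits)) []
        (joinData (gateData x.circuits)) []) := by
  obtain ⟨n, cs⟩ := x
  rw [length_encOIInput] at hM
  simp only at hM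
  let f' : List Sym → ℕ → ℕ → List Sym → Stacks Stk := fun i m a b s =>
    if s = .inp then i else config (inputEnv n m a) [] [] b s
  let f : ℕ → Stacks Stk := fun j => f' ((cs.drop j).flatMap encUnitaryCircuit ++ [Sym.close]) j
    (ancSum (cs.take j)) (joinData (gateData (cs.take j))).reverse
  have step := (runIn_moveWhile (k := .inp) (P := fun o => decide (o = some Sym.tick))
      (ks := [.reg .n]) (by simp) (by simp) (l := List.replicate n Sym.tick)
      (rest := Sym.sep :: (cs.flatMap encUnitaryCircuit ++ [Sym.close])) (c := M)
      (S := single .inp (encOIInput ⟨n, cs⟩))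
      (by simp [single, encOIInput, encUnary, encList])
      (by intro s hs; simpa using (List.mem_replicate.1 hs).2) (by simp)
      (by simp; omega) (fun _ => rfl)).seq
    ((runIn_pop (k := .inp) (S' := f 0) (fun s => ?_)).seq
      ((runIn_loop (k := .inp) (P := fun o => decide (o ≠ some Sym.close))
        (p := (.seq (moveWhile .inp (fun o => decide (o = some Sym.tick)) [.reg .a])
            (.seq (.move .inp [])
              (.seq (moveWhile .inp (fun o => decide (o ≠ some Sym.close)) [.back])
                (.seq (.move .inp [.back]) (.push (.reg .m) .tick))))))
          ((2 * M + 1) + (1 + ((2 * M + 1) + (1 + 1)))) cs.length f (fun _ => rfl) (fun _ => rfl)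
          ?_ ?_ ?_).seq
        ((runIn_pop (k := .inp) (fun _ => rfl)).seq (runIn_transfer (k := .back) (ks := [.data])
          (by simp) (by simp) (c := M) (S' := config (inputEnv n cs.length (ancSum cs)) []
            (joinData (gateData cs)) []) ?_ ?_))))
  · refine step.mono ?_
    have : cs.length * ((2 * M + 1) + (1 + ((2 * M + 1) + (1 + 1))) + 1) ≤
      M * ((2 * M + 1) + (1 + ((2 * M + 1) + (1 + 1))) + 1) :=
      Nat.mul_le_mul_right _ (by omega)
    nlinarith
  · cases s with
    | inp => simp [f, f']
    | reg r => cases r <;> simp [f, f', config, inputEnv, single, ancSum]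
    | _ => simp [f, f', config, single, joinData, gateData]
  · intro j hj
    have h : (f j .inp).head? ≠ some Sym.close := by
      have h' : f j .inp = encUnitaryCircuit cs[j] ++
          ((cs.drop (j + 1)).flatMap encUnitaryCircuit ++ [Sym.close]) := by
        change (cs.drop j).flatMap encUnitaryCircuit ++ [Sym.close] = _
        rw [List.drop_eq_getElem_cons hj, List.flatMap_cons, List.append_assoc]
      rw [h']
      intro hh
      obtain ⟨t, ht⟩ := List.head?_eq_some_iff.1 hh
      exact noClose_encUnitaryCircuit _ _ _ ht
    simpa using h
  · simp [f, f']
  · intro j hj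
    set c := cs[j] with hc
    set rest := (cs.drop (j + 1)).flatMap encUnitaryCircuit ++ [Sym.close] with hrest
    set G := c.gates.flatMap encGate with hG
    set B := (joinData (gateData (cs.take j))).reverse with hB
    have hmem : c ∈ cs := List.getElem_mem hj
    have hGmem : G ∈ gateData cs := List.mem_map.2 ⟨c, hmem, rfl⟩
    have hGlen : G.length ≤ M := (length_le_joinData_of_mem hGmem).trans (by omega)
    have hclen : c.anc ≤ M := by
      have : c.anc ≤ ancSum cs := List.single_le_sum (by simp) _ (List.mem_map.2 ⟨c, hmem, rfl⟩)
      omega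
    have htake : cs.take (j + 1) = cs.take j ++ [c] := List.take_succ_eq_append_getElem hj
    have hanc : ancSum (cs.take (j + 1)) = c.anc + ancSum (cs.take j) := by
      rw [htake]; simp [ancSum]; omega
    have hdata : (joinData (gateData (cs.take (j + 1)))).reverse =
        Sym.close :: (G.reverse ++ B) := by
      rw [htake, gateData, List.map_append, joinData_append]
      simp [joinData, hB, gateData, hG]
    have hinp : f j .inp =
        List.replicate c.anc Sym.tick ++ (Sym.sep :: (G ++ Sym.close :: rest)) := by
      change (cs.drop j).flatMap encUnitaryCircuit ++ [Sym.close] = _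
      rw [List.drop_eq_getElem_cons hj, List.flatMap_cons, encUnitaryCircuit_eq]
      simp [hrest, hG, hc]
    have hf' : f (j + 1) = f' rest (j + 1) (c.anc + ancSum (cs.take j))
        (Sym.close :: (G.reverse ++ B)) := by
      simp only [f, hanc, hdata, hrest]
    refine (runIn_moveWhile (S' := f' (Sym.sep :: (G ++ Sym.close :: rest)) j
        (c.anc + ancSum (cs.take j)) B) (by simp) (by simp) hinp
        (by intro s hs; simpa using (List.mem_replicate.1 hs).2) (by simp) (by simpa using hclen)
        ?_).seq
      ((runIn_pop (S' := f' (G ++ Sym.close :: rest) j (c.anc + ancSum (cs.take j)) B) ?_).seq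
        ((runIn_moveWhile (S' := f' (Sym.close :: rest) j (c.anc + ancSum (cs.take j))
            (G.reverse ++ B)) (l := G) (by simp) (by simp) rfl ?_ (by simp) hGlen ?_).seq
          ((runIn_move (S' := f' rest j (c.anc + ancSum (cs.take j))
            (Sym.close :: (G.reverse ++ B)))
            (s := .close) (by simp) (by simp) rfl ?_).seq (runIn_push ?_))))
    · intro s
      cases s with
      | reg r =>
        cases r <;> simp [f, f', config, inputEnv]
      | _ => simp [f, f', config, hB]
    · intro s
      cases s <;> simp [f', config]
    · intro s hs
      have : s ≠ Sym.close := fun h => close_notMem_gateData cs _ hGmem (h ▸ hs)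
      simpa using this
    · intro s
      cases s <;> simp [f', config]
    · intro s
      cases s <;> simp [f', config]
    · intro s
      rw [hf']
      cases s with
      | reg r => cases r <;> simp [f', config, inputEnv, List.replicate_succ]
      | _ => simp [f', config]
  · have : (joinData (gateData cs)).length ≤ M := by omega
    simpa [f, f', config] using this
  · intro s
    cases s <;> simp [f, f', config]

open Prog in
/-- The program that reads the input, runs a loop program and writes the string on the output. -/
def fullProg (p : Em) : Prog Stk :=
  .seq readProg (.seq p.prog (.seq (transfer .acc [.out]) (.seq (transfer .data [])
    (.seq (transfer (.reg .n) []) (.seq (transfer (.reg .m) []) (transfer (.reg .a) []))))))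

open Prog in
theorem runIn_fullProg {p : Em} (hwf : p.wf = true) (x : OIInput) :
    RunIn (fullProg p) (single .inp (encOIInput x))
      ((20 * (Polynomial.X + 1) ^ 2 + 3 * p.cost + 20 * (Polynomial.X + 1) : Polynomial ℕ).eval
        (encOIInput x).length)
      (single .out (p.eval (gateData x.circuits)
        (inputEnv x.n x.circuits.length (ancSum x.circuits)))) := by
  obtain ⟨M, hM⟩ : ∃ M, (encOIInput x).length = M := ⟨_, rfl⟩
  have hlen := length_encOIInput x
  rw [hM] at hlen ⊢
  set e := inputEnv x.n x.circuits.length (ancSum x.circuits) with he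
  set gs := gateData x.circuits with hgs
  have hD : (joinData gs).length ≤ M := by omega
  have heM : ∀ r, e r ≤ M := by
    intro r
    cases r <;> simp [he, inputEnv] <;> omega
  have step := (runIn_readProg x hM.le).seq ((Em.runIn_prog (close_notMem_gateData x.circuits)
      hD p e [] (joinData gs) [] hwf (by simp [he, inputEnv]) heM (.inr ⟨rfl, rfl⟩)).seq
    ((runIn_transfer (k := .acc) (ks := [.out]) (by simp) (by simp) (c := p.cost.eval M)
        (by simpa [config] using p.length_eval_le hD e heM) (fun _ => rfl)).seq
      ((runIn_transfer (k := .data) (ks := []) (by simp) (by simp) (c := M)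
        (by simpa [config] using hD) (fun _ => rfl)).seq
      ((runIn_transfer (k := .reg .n) (ks := []) (by simp) (by simp) (c := M)
        (by simpa [config] using heM .n) (fun _ => rfl)).seq
      ((runIn_transfer (k := .reg .m) (ks := []) (by simp) (by simp) (c := M)
        (by simpa [config] using heM .m) (fun _ => rfl)).seq
      (runIn_transfer (k := .reg .a) (ks := []) (by simp) (by simp) (c := M)
        (S' := single .out (p.eval gs e)) (by simpa [config] using heM .a) ?_))))))
  · refine step.mono ?_
    simp
    nlinarith
  · intro s
    cases s with
    | reg r => cases r <;> simp [config, single, he, inputEnv]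
    | _ => simp [config, single, hgs]

/-- What a loop program writes can be computed in polynomial time. -/
theorem computableInPolyTime_of_em {p : Em} (hwf : p.wf = true) {f : OIInput → MeasuredCircuit}
    (hf : ∀ x, p.eval (gateData x.circuits)
      (inputEnv x.n x.circuits.length (ancSum x.circuits)) = encMeasuredCircuit (f x)) :
    Nonempty (Turing.TM2ComputableInPolyTime encOIInput encMeasuredCircuit f) :=
  (fullProg p).computableInPolyTime .inp .out _ fun x => hf x ▸ runIn_fullProg hwf x

/-! ### The circuit -/

/-- The wire of token `s`. The wires from `n` to `n + a - 1` before the tokens are a pool of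
ancillas shared by the given circuits. -/
def tokWire (n a s : ℕ) : ℕ := n + a + s

/-- The wire of qubit `j` of dummy register `i`. -/
def dummyWire (n a m i j : ℕ) : ℕ := n + a + m + i * n + j

/-- The wire of the coin that decides on the swap of tokens `l` and `l + 1` in stage `k`. -/
def coinWire (n a m k l : ℕ) : ℕ := n + a + m + m * n + k * m + l

/-- A swap of the wires `x` and `y` controlled by the wire `c`. -/
def cswapGates (c x y : ℕ) : List Gate := [.cnot y x, .tof c x y, .cnot y x]

/-- The gates that turn `|0⟩` into a coin with amplitudes of squared modulus `1 / (l + 2)` at `0`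
and `(l + 1) / (l + 2)` at `1`: for `z = (1 + i √(l + 1)) / √(l + 2)` the amplitudes are
`(1 ± z²) / 2`. -/
def prepGates (l q : ℕ) : List Gate :=
  [.one .H q, .one (.phase 1 (l + 1)) q, .one (.phase 1 (l + 1)) q, .one .H q]

/-- The inverse of `prepGates`. The phase gates are not the inverses of those of `prepGates`: for
`y = (√(l + 1) + i) / √(l + 2)` the number `-y²` is the conjugate of `z²`. -/
def unprepGates (l q : ℕ) : List Gate :=
  [.one .H q, .one (.phase (l + 1) 1) q, .one (.phase (l + 1) 1) q, .one .Z q, .one .H q]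

/-- The pairs `l < k < m`, which number the coins. -/
def coinList (m : ℕ) : List (ℕ × ℕ) :=
  (List.range m).flatMap fun k => (List.range k).map fun l => (k, l)

/-- The shuffle of the tokens, driven by the coins: stages `m - 1, …, 0`, and in stage `k` swaps of
the neighbours `l` and `l + 1` for `l = 0, …, k - 1`. -/
def shuffleGates (n a m : ℕ) : List Gate :=
  (List.range m).reverse.flatMap fun k => (List.range k).flatMap fun l =>
    cswapGates (coinWire n a m k l) (tokWire n a l) (tokWire n a (l + 1))

/-- The inverse of `shuffleGates`. -/
def unshuffleGates (n a m : ℕ) : List Gate :=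
  (List.range m).flatMap fun k => (List.range k).reverse.flatMap fun l =>
    cswapGates (coinWire n a m k l) (tokWire n a l) (tokWire n a (l + 1))

/-- The swap of the data register with dummy register `i`, controlled by token `i`. -/
def exchangeGates (n a m i : ℕ) : List Gate :=
  (List.range n).flatMap fun j => cswapGates (tokWire n a i) j (dummyWire n a m i j)

/-- All given circuits in turn, circuit `i` acting on dummy register `i` if token `i` is set and on
the data otherwise. -/
def passGates (n a : ℕ) (cs : List UnitaryCircuit) : List Gate :=
  cs.zipIdx.flatMap fun c =>
    exchangeGates n a cs.length c.2 ++ c.1.gates ++ exchangeGates n a cs.length c.2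

/-- Round `t`: token `t` is cleared and the tokens are shuffled, the circuit that is selected by the
cleared token acts on the data, and the tokens are restored. -/
def roundGates (n a : ℕ) (cs : List UnitaryCircuit) (t : ℕ) : List Gate :=
  [.one .X (tokWire n a t)] ++ shuffleGates n a cs.length ++ passGates n a cs ++
    unshuffleGates n a cs.length ++ [.one .X (tokWire n a t)]

/-- All gates of the circuit. -/
def allGates (n a : ℕ) (cs : List UnitaryCircuit) : List Gate :=
  (List.range cs.length).map (fun s => .one .X (tokWire n a s)) ++
    (coinList cs.length).flatMap (fun c => prepGates c.2 (coinWire n a cs.length c.1 c.2)) ++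
    (List.range cs.length).flatMap (roundGates n a cs) ++
    (coinList cs.length).flatMap fun c => unprepGates c.2 (coinWire n a cs.length c.1 c.2)

/-- The circuit that prepares the order interference state. -/
def oiCircuit (x : OIInput) : MeasuredCircuit where
  anc := ancSum x.circuits + x.circuits.length + x.circuits.length * x.n +
    x.circuits.length * x.circuits.length
  gates := allGates x.n (ancSum x.circuits) x.circuits
  measured := (coinList x.circuits.length).map fun c =>
    coinWire x.n (ancSum x.circuits) x.circuits.length c.1 c.2

/-! ### The loop program that writes the circuit -/

namespace Em

/-- The value of a register in unary. -/
def ticks (r : Reg) : Em := loop .u r (sym .tick)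

/-- The product of two registers in unary. -/
def prod (r s : Reg) : Em := loop .v r (ticks s)

/-- Programs one after the other. -/
def seqs : List Em → Em
  | [] => nil
  | p :: ps => seq p (seqs ps)

/-- The encoding of data wire `r`. -/
def dataW (r : Reg) : Em := seqs [ticks r, sym .sep]

/-- The encoding of the wire of token `r`. -/
def tokW (r : Reg) : Em := seqs [ticks .n, ticks .a, ticks r, sym .sep]

/-- The encoding of the wire of token `r + 1`. -/
def tokSuccW (r : Reg) : Em := seqs [ticks .n, ticks .a, ticks r, sym .tick, sym .sep]

/-- The encoding of the wire of qubit `s` of dummy register `r`. -/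
def dummyW (r s : Reg) : Em := seqs [ticks .n, ticks .a, ticks .m, prod r .n, ticks s, sym .sep]

/-- The encoding of the wire of the coin `(r, s)`. -/
def coinW (r s : Reg) : Em :=
  seqs [ticks .n, ticks .a, ticks .m, prod .m .n, prod r .m, ticks s, sym .sep]

/-- The encoding of `cswapGates`, given programs that write the wires. -/
def cswapE (c x y : Em) : Em :=
  seqs [sym .cnot, y, x, sym .tof, c, x, y, sym .cnot, y, x]

/-- The binary encoding of the value of `r` plus one. -/
def binE (r : Reg) : Em := seq (bin r) (sym .sep)

/-- The encoding of `prepGates` for `l = r` on the wire written by `q`. -/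
def prepE (r : Reg) (q : Em) : Em :=
  seqs [sym .H, q, sym .phase, sym .one, sym .sep, binE r, q,
    sym .phase, sym .one, sym .sep, binE r, q, sym .H, q]

/-- The encoding of `unprepGates` for `l = r` on the wire written by `q`. -/
def unprepE (r : Reg) (q : Em) : Em :=
  seqs [sym .H, q, sym .phase, binE r, sym .one, sym .sep, q,
    sym .phase, binE r, sym .one, sym .sep, q, sym .Z, q, sym .H, q]

/-- A loop over all coins. -/
def coinLoop (f : Reg → Reg → Em) : Em :=
  loop .k .m (loop .l (.up .k) (f (.up .k) (.up .l)))

/-- The encoding of `shuffleGates`; the loop over the stages counts downwards. -/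
def shuffleE : Em :=
  loop .k .m (loop .l (.down .k)
    (cswapE (coinW (.down .k) (.up .l)) (tokW (.up .l)) (tokSuccW (.up .l))))

/-- The encoding of `unshuffleGates`. -/
def unshuffleE : Em :=
  loop .k .m (loop .l (.up .k)
    (cswapE (coinW (.up .k) (.down .l)) (tokW (.down .l)) (tokSuccW (.down .l))))

/-- The encoding of `exchangeGates` for the dummy register given by the variable `i`. -/
def exchangeE : Em :=
  loop .j .n (cswapE (tokW (.up .i)) (dataW (.up .j)) (dummyW (.up .i) (.up .j)))

/-- The encoding of the `X` gate on the token given by the variable `t`. -/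
def flipE : Em := seq (sym .X) (tokW (.up .t))

/-- The encoding of `roundGates` for the round given by the variable `t`. -/
def roundE : Em := seqs [flipE, shuffleE, circ .i exchangeE exchangeE, unshuffleE, flipE]

/-- The loop program that writes the description of the circuit. -/
def circuitE : Em :=
  seqs [ticks .a, ticks .m, prod .m .n, prod .m .m, sym .sep,
    loop .t .m flipE, coinLoop (fun k l => prepE l (coinW k l)),
    loop .t .m roundE, coinLoop (fun k l => unprepE l (coinW k l)), sym .close,
    coinLoop coinW, sym .close]

theorem circuitE_wf : circuitE.wf = true := by decide

variable (gs : List (List Sym)) (e : Env)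

theorem eval_seqs (ps : List Em) : (seqs ps).eval gs e = ps.flatMap fun p => p.eval gs e := by
  induction ps with
  | nil => rfl
  | cons p ps ih => simp [seqs, eval, ih]

theorem flatMap_const {α β : Type} (l : List α) (b : β) (k : ℕ) :
    l.flatMap (fun _ => List.replicate k b) = List.replicate (l.length * k) b := by
  induction l with
  | nil => simp
  | cons a l ih =>
    rw [List.flatMap_cons, ih, List.replicate_append_replicate, List.length_cons]
    congr 1; ring

theorem eval_ticks (r : Reg) : (ticks r).eval gs e = List.replicate (e r) Sym.tick := by
  have := flatMap_const (List.range (e r)) Sym.tick 1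
  simpa [ticks, eval] using this

theorem eval_prod (r s : Reg) (h : s ≠ .up .v) (h' : s ≠ .down .v) :
    (prod r s).eval gs e = List.replicate (e r * e s) Sym.tick := by
  simp only [prod, eval, eval_ticks, Env.bind_of_ne _ _ _ _ h h']
  rw [flatMap_const, List.length_range]

theorem eval_dataW (r : Reg) : (dataW r).eval gs e = encUnary (e r) := by
  simp [dataW, eval_seqs, eval_ticks, eval, encUnary]

theorem eval_tokW (r : Reg) :
    (tokW r).eval gs e = encUnary (tokWire (e .n) (e .a) (e r)) := by
  simp [tokW, eval_seqs, eval_ticks, eval, encUnary, tokWire, ← List.append_assoc, Nat.add_assoc]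

theorem eval_tokSuccW (r : Reg) :
    (tokSuccW r).eval gs e = encUnary (tokWire (e .n) (e .a) (e r + 1)) := by
  simp [tokSuccW, eval_seqs, eval_ticks, eval, encUnary, tokWire, List.replicate_add,
    -List.replicate_append_replicate]

theorem eval_dummyW (r s : Reg) : (dummyW r s).eval gs e =
    encUnary (dummyWire (e .n) (e .a) (e .m) (e r) (e s)) := by
  simp [dummyW, eval_seqs, eval_ticks, eval_prod, eval, encUnary, dummyWire, ← List.append_assoc,
    Nat.add_assoc]

theorem eval_coinW (r s : Reg) : (coinW r s).eval gs e =
    encUnary (coinWire (e .n) (e .a) (e .m) (e r) (e s)) := by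
  simp [coinW, eval_seqs, eval_ticks, eval_prod, eval, encUnary, coinWire, ← List.append_assoc,
    Nat.add_assoc]

theorem eval_cswapE {c x y : Em} {c' x' y' : ℕ} (hc : c.eval gs e = encUnary c')
    (hx : x.eval gs e = encUnary x') (hy : y.eval gs e = encUnary y') :
    (cswapE c x y).eval gs e = (cswapGates c' x' y').flatMap encGate := by
  simp [cswapE, cswapGates, eval_seqs, eval, hc, hx, hy, encGate]

theorem encBinary_one : encBinary 1 = [Sym.one, Sym.sep] := by
  have := encodeNat_succ 0
  simp only [zero_add] at this
  rw [encBinary, this]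
  rfl

theorem eval_prepE {r : Reg} {q : Em} {q' : ℕ} (hq : q.eval gs e = encUnary q') :
    (prepE r q).eval gs e = (prepGates (e r) q').flatMap encGate := by
  simp [prepE, prepGates, eval_seqs, eval, hq, encGate, encOneQubit, encBinary_one, binE]
  simp [encBinary, bitSyms]

theorem eval_unprepE {r : Reg} {q : Em} {q' : ℕ} (hq : q.eval gs e = encUnary q') :
    (unprepE r q).eval gs e = (unprepGates (e r) q').flatMap encGate := by
  simp [unprepE, unprepGates, eval_seqs, eval, hq, encGate, encOneQubit, encBinary_one, binE]
  simp [encBinary, bitSyms]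

theorem flatMap_range_down {β : Type} (v : ℕ) (f : ℕ → List β) :
    (List.range v).flatMap (fun j => f (v - 1 - j)) = (List.range v).reverse.flatMap f := by
  rw [List.range_eq_range', List.reverse_range', List.flatMap_map, ← List.range_eq_range']
  simp

theorem eval_shuffleE : shuffleE.eval gs e =
    (shuffleGates (e .n) (e .a) (e .m)).flatMap encGate := by
  simp only [shuffleGates, List.flatMap_assoc]
  rw [← flatMap_range_down]
  simp only [shuffleE, eval]
  congr 1; funext j
  rw [Env.bind_down]
  congr 1; funext l
  rw [eval_cswapE gs _ (eval_coinW gs _ _ _) (eval_tokW gs _ _) (eval_tokSuccW gs _ _)]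
  simp [Env.bind]

theorem eval_unshuffleE : unshuffleE.eval gs e =
    (unshuffleGates (e .n) (e .a) (e .m)).flatMap encGate := by
  simp only [unshuffleGates, List.flatMap_assoc]
  simp only [unshuffleE, eval]
  congr 1; funext j
  rw [Env.bind_up, ← flatMap_range_down]
  congr 1; funext l
  rw [eval_cswapE gs _ (eval_coinW gs _ _ _) (eval_tokW gs _ _) (eval_tokSuccW gs _ _)]
  simp [Env.bind]

theorem eval_exchangeE : exchangeE.eval gs e =
    (exchangeGates (e .n) (e .a) (e .m) (e (.up .i))).flatMap encGate := by
  simp only [exchangeGates, List.flatMap_assoc]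
  simp only [exchangeE, eval]
  congr 1; funext j
  rw [eval_cswapE gs _ (eval_tokW gs _ _) (eval_dataW gs _ _) (eval_dummyW gs _ _ _)]
  simp [Env.bind]

theorem eval_flipE : flipE.eval gs e =
    encGate (.one .X (tokWire (e .n) (e .a) (e (.up .t)))) := by
  simp [flipE, eval, eval_tokW, encGate, encOneQubit]

theorem eval_passE (cs : List UnitaryCircuit) (hm : e .m = cs.length) :
    (circ .i exchangeE exchangeE).eval (gateData cs) e =
      (passGates (e .n) (e .a) cs).flatMap encGate := by
  simp only [eval, eval_exchangeE, passGates, gateData, List.zipIdx_map, List.flatMap_assoc,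
    List.flatMap_map, List.flatMap_append]
  congr 1; funext c
  simp [Env.bind, hm]

theorem eval_roundE (cs : List UnitaryCircuit) (hm : e .m = cs.length) :
    roundE.eval (gateData cs) e = (roundGates (e .n) (e .a) cs (e (.up .t))).flatMap encGate := by
  simp only [roundE, eval_seqs, List.flatMap_cons, List.flatMap_nil, eval_flipE, eval_shuffleE,
    eval_unshuffleE, eval_passE e cs hm, roundGates, List.flatMap_append, hm]
  simp

theorem eval_coinLoop (f : Reg → Reg → Em) (g : ℕ × ℕ → List Sym) (hf : ∀ (e' : Env),
      e' .n = e .n → e' .a = e .a → e' .m = e .m →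
        (f (.up .k) (.up .l)).eval gs e' = g (e' (.up .k), e' (.up .l))) :
    (coinLoop f).eval gs e = (coinList (e .m)).flatMap g := by
  simp only [coinLoop, coinList, eval, List.flatMap_assoc, List.flatMap_map]
  congr 1; funext k
  rw [Env.bind_up]
  congr 1; funext l
  rw [hf _ (by simp [Env.bind]) (by simp [Env.bind]) (by simp [Env.bind])]
  simp [Env.bind]

theorem eval_circuitE (x : OIInput) : circuitE.eval (gateData x.circuits)
    (inputEnv x.n x.circuits.length (ancSum x.circuits)) = encMeasuredCircuit (oiCircuit x) := by
  set e := inputEnv x.n x.circuits.length (ancSum x.circuits) with he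
  have hn : e .n = x.n := rfl
  have hm : e .m = x.circuits.length := rfl
  have ha : e .a = ancSum x.circuits := rfl
  have h₁ := eval_coinLoop (gateData x.circuits) e (fun k l => prepE l (coinW k l))
    (fun c => (prepGates c.2 (coinWire x.n (ancSum x.circuits) x.circuits.length c.1 c.2)).flatMap
      encGate) (fun e' h₁ h₂ h₃ => by
        rw [eval_prepE _ _ (eval_coinW _ _ _ _), h₁, h₂, h₃, hn, hm, ha])
  have h₂ := eval_coinLoop (gateData x.circuits) e (fun k l => unprepE l (coinW k l))
    (fun c => (unprepGates c.2 (coinWire x.n (ancSum x.circuits) x.circuits.length c.1 c.2)).flatMap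
      encGate) (fun e' h₁ h₂ h₃ => by
        rw [eval_unprepE _ _ (eval_coinW _ _ _ _), h₁, h₂, h₃, hn, hm, ha])
  have h₃ := eval_coinLoop (gateData x.circuits) e coinW
    (fun c => encUnary (coinWire x.n (ancSum x.circuits) x.circuits.length c.1 c.2))
    (fun e' h₁ h₂ h₃ => by rw [eval_coinW, h₁, h₂, h₃, hn, hm, ha])
  have h₄ : (loop .t .m flipE).eval (gateData x.circuits) e =
      ((List.range x.circuits.length).map
        (fun s => Gate.one .X (tokWire x.n (ancSum x.circuits) s))).flatMap encGate := by
    rw [List.flatMap_map]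
    simp only [eval, hm, eval_flipE]
    congr 1
  have h₆ (s : Sym) : (sym s).eval (gateData x.circuits) e = [s] := rfl
  have h₅ : (loop .t .m roundE).eval (gateData x.circuits) e =
      ((List.range x.circuits.length).flatMap
        (roundGates x.n (ancSum x.circuits) x.circuits)).flatMap encGate := by
    rw [List.flatMap_assoc]
    simp only [eval, hm]
    congr 1; funext j
    rw [eval_roundE _ _ (by simp [Env.bind, hm])]
    rfl
  simp only [circuitE, eval_seqs, List.flatMap_cons, List.flatMap_nil, h₁, h₂, h₃, h₄, h₅,
    eval_ticks, eval_prod, ne_eq, reduceCtorEq, not_false_eq_true, hn, hm, ha, h₆]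
  simp only [encMeasuredCircuit, oiCircuit, allGates, encList, encUnary, List.flatMap_append,
    List.flatMap_assoc, List.flatMap_map, List.replicate_add, List.append_assoc, List.append_nil]

end Em

/-- The circuit can be computed in polynomial time. -/
theorem oiCircuit_polyTime :
    Nonempty (Turing.TM2ComputableInPolyTime encOIInput encMeasuredCircuit oiCircuit) :=
  computableInPolyTime_of_em Em.circuitE_wf Em.eval_circuitE

/-! ### Amplitudes on infinitely many wires -/

/-- Amplitudes of the basis states of infinitely many wires. The action of gates on them does not
refer to the number of wires of a circuit. -/
abbrev Amp : Type := (ℕ → Bool) → ℂ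

/-- The action of a gate on amplitudes. -/
noncomputable def Gate.act : Gate → Amp → Amp
  | .one u q, F => fun w => ∑ b, u.toMatrix (w q) b * F (Function.update w q b)
  | .cnot c t, F => fun w => F (Function.update w t (xor (w t) (w c)))
  | .swap a b, F => fun w => F fun q => if q = a then w b else if q = b then w a else w q
  | .tof c d t, F => fun w => F (Function.update w t (xor (w t) (w c && w d)))

/-- The action of a list of gates on amplitudes; the head of the list acts first. -/
noncomputable def acts : List Gate → Amp → Amp
  | [], F => F
  | g :: gs, F => acts gs (g.act F)

theorem acts_append (gs gs' : List Gate) (F : Amp) : acts (gs ++ gs') F = acts gs' (acts gs F) := by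
  induction gs generalizing F with
  | nil => rfl
  | cons g gs ih => exact ih _

/-- The assignment that is `z` on the first `N` wires and `w` on the others. -/
def overlay {N : ℕ} (w : ℕ → Bool) (z : Bits N) : ℕ → Bool := fun q =>
  if h : q < N then z ⟨q, h⟩ else w q

theorem overlay_of_lt {N : ℕ} (w : ℕ → Bool) (z : Bits N) {q : ℕ} (h : q < N) :
    overlay w z q = wire z q := by simp [overlay, wire, h]

theorem overlay_of_le {N : ℕ} (w : ℕ → Bool) (z : Bits N) {q : ℕ} (h : N ≤ q) :
    overlay w z q = w q := by simp [overlay, h]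

theorem overlay_restrict (N : ℕ) (w : ℕ → Bool) : overlay w (fun i : Fin N => w i) = w := by
  funext q; simp [overlay]

theorem overlay_false {N : ℕ} (z : Bits N) : overlay (fun _ => false) z = wire z := by
  funext q; simp [overlay, wire]

theorem update_overlay {N : ℕ} (w : ℕ → Bool) (z : Bits N) {q : ℕ} (h : q < N) (b : Bool) :
    Function.update (overlay w z) q b = overlay w (Function.update z ⟨q, h⟩ b) := by
  funext p
  by_cases hp : p = q
  · subst hp; simp [overlay, h]
  · by_cases hN : p < N
    · have : (⟨p, hN⟩ : Fin N) ≠ ⟨q, h⟩ := by simpa using hp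
      simp [overlay, hp, hN, this]
    · simp [overlay, hp, hN]

theorem Op.app_apply {N : ℕ} (A : Op N) (ψ : State N) (x : Bits N) :
    A.app ψ x = ∑ y, A x y * ψ y := by
  simp [Op.app, Matrix.toLpLin_apply, Matrix.mulVec, dotProduct]

theorem Op.app_mul {N : ℕ} (A B : Op N) (ψ : State N) : Op.app (A * B) ψ = A.app (B.app ψ) := by
  simp [Op.app, Matrix.toLpLin_apply]

theorem Op.app_one {N : ℕ} (ψ : State N) : Op.app (1 : Op N) ψ = ψ := by
  simp [Op.app]

theorem Op.app_smul {N : ℕ} (A : Op N) (c : ℂ) (ψ : State N) :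
    A.app (c • ψ) = c • A.app ψ := by
  simp [Op.app]

theorem basisMap_app {N : ℕ} {f : Bits N → Bits N} (hf : Function.Involutive f) (ψ : State N)
    (x : Bits N) : (basisMap f).app ψ x = ψ (f x) := by
  rw [Op.app_apply, Finset.sum_eq_single (f x)]
  · simp [basisMap, hf x]
  · intro y _ hy
    have : x ≠ f y := fun h => hy (by rw [h, hf y])
    simp [basisMap, this]
  · simp

/-- A gate on `N` wires acts on amplitudes as its operator does, and the other wires are
spectators. -/
theorem Gate.toOp_app {N : ℕ} {g : Gate} (hg : g.Valid N) (F : Amp) (w : ℕ → Bool) :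
    (g.toOp N).app (WithLp.toLp 2 fun z => F (overlay w z)) =
      WithLp.toLp 2 fun z => g.act F (overlay w z) := by
  ext x
  rcases g with ⟨u, q⟩ | ⟨c, t⟩ | ⟨a, b⟩ | ⟨c, d, t⟩
  · have hq : q < N := hg.2
    rw [Op.app_apply]
    symm
    change ∑ b, u.toMatrix (overlay w x q) b * F (Function.update (overlay w x) q b) = _
    refine Fintype.sum_of_injective (fun b : Bool => Function.update x ⟨q, hq⟩ b) ?_ _ _ ?_ ?_
    · intro b b' h
      simpa using congrFun h ⟨q, hq⟩
    · intro y hy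
      have : ¬ ∀ j : Fin N, (j : ℕ) ≠ q → x j = y j := by
        intro h
        refine hy ⟨y ⟨q, hq⟩, ?_⟩
        funext j
        by_cases hj : j = ⟨q, hq⟩
        · subst hj; simp
        · refine (Function.update_of_ne hj _ _).trans ?_
          exact h j (fun h' => hj (Fin.ext h'))
      simp [Gate.toOp, this]
    · intro b
      have h₁ : ∀ j : Fin N, (j : ℕ) ≠ q → x j = Function.update x ⟨q, hq⟩ b j := by
        intro j hj
        rw [Function.update_of_ne]
        rintro rfl
        exact hj rfl
      simp only [Gate.toOp, Matrix.of_apply, if_pos h₁, update_overlay w x hq]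
      simp [overlay, hq, wire]
  · obtain ⟨hc, ht, hct⟩ := hg
    refine (basisMap_app ?_ _ _).trans ?_
    · intro y
      funext j
      have := hct
      by_cases hj : (j : ℕ) = t
      · subst hj; simp [wire, hc, hct]
      · simp [hj]
    · simp only [Gate.act, update_overlay w x ht]
      congr 2
      funext j
      by_cases hj : (j : ℕ) = t
      · subst hj; simp [overlay, wire, hc]
      · rw [Function.update_of_ne (by rintro rfl; exact hj rfl)]; simp [hj]
  · obtain ⟨ha, hb, hab⟩ := hg
    refine (basisMap_app ?_ _ _).trans ?_
    · intro y
      funext j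
      by_cases hj : (j : ℕ) = a
      · subst hj; simp [wire, hb, hab.symm]
      · by_cases hj' : (j : ℕ) = b
        · have : j = ⟨b, hb⟩ := Fin.ext hj'
          simp [wire, ha, hb, this, hab.symm]
        · simp [hj, hj']
    · simp only [Gate.act]
      congr 1
      funext q
      by_cases hq : q < N
      · simp [overlay, hq, wire, ha, hb]
      · have h₁ : q ≠ a := by omega
        have h₂ : q ≠ b := by omega
        simp [overlay, hq, h₁, h₂]
  · obtain ⟨hc, hd, ht, hcd, hct, hdt⟩ := hg
    refine (basisMap_app ?_ _ _).trans ?_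
    · intro y
      funext j
      by_cases hj : (j : ℕ) = t
      · subst hj; simp [wire, hc, hd, hct, hdt]
      · simp [hj]
    · simp only [Gate.act, update_overlay w x ht]
      congr 2
      funext j
      by_cases hj : (j : ℕ) = t
      · subst hj; simp [overlay, wire, hc, hd]
      · rw [Function.update_of_ne (by rintro rfl; exact hj rfl)]; simp [hj]

theorem gatesOp_app {N : ℕ} {gs : List Gate} (h : ∀ g ∈ gs, g.Valid N) (F : Amp) (w : ℕ → Bool) :
    (gatesOp N gs).app (WithLp.toLp 2 fun z => F (overlay w z)) =
      WithLp.toLp 2 fun z => acts gs F (overlay w z) := by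
  induction gs generalizing F with
  | nil => exact Op.app_one _
  | cons g gs ih =>
    rw [gatesOp, Op.app_mul, Gate.toOp_app (h g (by simp)), ih fun g hg => h g (by simp [hg])]
    rfl

/-- The amplitudes of the state `Φ w` of the first `n` wires, which may depend on the wires
from `B` on, with the wires from `n` to `B - 1` in the state zero. -/
def lift {n : ℕ} (B : ℕ) (Φ : (ℕ → Bool) → State n) : Amp := fun w =>
  if ∀ q, n ≤ q → q < B → w q = false then Φ w (fun i => w i) else 0

/-- The gates of a circuit that implements `U` act as `U` on the data whenever the ancillas are in
the state zero. -/
theorem acts_lift {n B : ℕ} {c : UnitaryCircuit} {U : QUnitary n} (hc : c.Implements U)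
    (hB : n + c.anc ≤ B) {Φ : (ℕ → Bool) → State n}
    (hΦ : ∀ w w', (∀ q, B ≤ q → w q = w' q) → Φ w = Φ w') :
    acts c.gates (lift B Φ) = lift B fun w => Op.app (U : Op n) (Φ w) := by
  funext w
  have key (V : (ℕ → Bool) → State n) (hV : ∀ w w', (∀ q, B ≤ q → w q = w' q) → V w = V w')
      (z : Bits (n + c.anc)) : lift B V (overlay w z) =
        if ∀ q, n + c.anc ≤ q → q < B → w q = false then withAncilla c.anc (V w) z else 0 := by
    have hz : V (overlay w z) = V w := hV _ _ fun q hq => overlay_of_le _ _ (by omega)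
    simp only [lift, withAncilla, hz]
    by_cases h₁ : ∀ q, n + c.anc ≤ q → q < B → w q = false
    · rw [if_pos h₁]
      by_cases h₂ : ∀ j : Fin c.anc, z (Fin.natAdd n j) = false
      · rw [if_pos h₂, if_pos]
        · refine congrArg (V w) (funext fun i => ?_)
          have : (i : ℕ) < n + c.anc := by omega
          simp [overlay, this]
          rfl
        · intro q hq hq'
          by_cases h : q < n + c.anc
          · have := h₂ ⟨q - n, by omega⟩
            rw [overlay_of_lt _ _ h, wire, dif_pos h, ← this]
            congr 1
            ext; simp; omega
          · rw [overlay_of_le _ _ (by omega)]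
            exact h₁ q (by omega) hq'
      · rw [if_neg h₂, if_neg]
        intro h
        refine h₂ fun j => ?_
        have := h (n + j) (by omega) (by omega)
        rwa [overlay_of_lt _ _ (by omega), wire, dif_pos (by omega)] at this
    · rw [if_neg h₁, if_neg]
      intro h
      refine h₁ fun q hq hq' => ?_
      have := h q (by omega) hq'
      rwa [overlay_of_le _ _ hq] at this
  have h₁ := gatesOp_app hc.1 (lift B Φ) w
  have h₂ := congrArg (fun ψ : State (n + c.anc) => ψ fun i => w i) h₁
  simp only [overlay_restrict] at h₂
  rw [← h₂]
  have h₃ := key (fun w => Op.app (U : Op n) (Φ w)) (fun w w' h => by rw [hΦ w w' h])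
    (fun i => w i)
  rw [overlay_restrict] at h₃
  rw [h₃]
  simp only [key Φ hΦ]
  by_cases h : ∀ q, n + c.anc ≤ q → q < B → w q = false
  · simp only [if_pos h]
    rw [← hc.2]
  · simp only [if_neg h]
    rw [Op.app_apply]
    simp

/-! ### Independent coins and a uniformly random permutation -/

/-- Outcomes of the coins; the coin `(k, l)` decides on swap `l` of stage `k`. -/
abbrev Coins : Type := ℕ × ℕ → Bool

/-- The probability that the coin `(k, l)` shows `b`. -/
noncomputable def coinProb (l : ℕ) (b : Bool) : ℂ := if b then (l + 1) / (l + 2) else 1 / (l + 2)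

/-- The mean of `G` over independent tosses of the listed coins, the others being as in `r`. -/
noncomputable def coinMean : List (ℕ × ℕ) → (Coins → ℂ) → Coins → ℂ
  | [], G, r => G r
  | c :: cs, G, r => ∑ b, coinProb c.2 b * coinMean cs G (Function.update r c b)

theorem coinMean_append (cs cs' : List (ℕ × ℕ)) (G : Coins → ℂ) (r : Coins) :
    coinMean (cs ++ cs') G r = coinMean cs (coinMean cs' G) r := by
  induction cs generalizing r with
  | nil => rfl
  | cons c cs ih => simp only [List.cons_append, coinMean, ih]

theorem coinMean_congr {cs : List (ℕ × ℕ)} {G G' : Coins → ℂ} {r : Coins}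
    (h : ∀ r' : Coins, (∀ c ∉ cs, r' c = r c) → G r' = G' r') :
    coinMean cs G r = coinMean cs G' r := by
  induction cs generalizing r with
  | nil => exact h r fun _ _ => rfl
  | cons c cs ih =>
    simp only [coinMean]
    refine Finset.sum_congr rfl fun b _ => ?_
    rw [ih fun r' hr' => h r' fun c' hc' => ?_]
    rw [List.mem_cons, not_or] at hc'
    rw [hr' c' hc'.2, Function.update_of_ne hc'.1]

theorem coinMean_const {cs : List (ℕ × ℕ)} {r : Coins} (a : ℂ) :
    coinMean cs (fun _ => a) r = a := by
  induction cs generalizing r with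
  | nil => rfl
  | cons c cs ih =>
    have : ((c.2 : ℂ) + 2) ≠ 0 := by exact_mod_cast (by omega : c.2 + 2 ≠ 0)
    simp [coinMean, ih, coinProb]
    field_simp
    ring

/-- The coins of stage `k` below `L`, the last one first. -/
def stageCoins (k L : ℕ) : List (ℕ × ℕ) := ((List.range L).map fun l => (k, l)).reverse

theorem stageCoins_succ (k L : ℕ) : stageCoins k (L + 1) = (k, L) :: stageCoins k L := by
  simp [stageCoins, List.range_succ]

theorem mem_stageCoins {k L : ℕ} {c : ℕ × ℕ} : c ∈ stageCoins k L ↔ c.1 = k ∧ c.2 < L := by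
  simp only [stageCoins, List.mem_reverse, List.mem_map, List.mem_range]
  constructor
  · rintro ⟨l, hl, rfl⟩; exact ⟨rfl, hl⟩
  · rintro ⟨rfl, h⟩; exact ⟨_, h, rfl⟩

theorem coinList_succ_reverse (m : ℕ) :
    (coinList (m + 1)).reverse = stageCoins m m ++ (coinList m).reverse := by
  simp [coinList, stageCoins, List.range_succ]

theorem mem_coinList {m : ℕ} {c : ℕ × ℕ} : c ∈ coinList m ↔ c.1 < m ∧ c.2 < c.1 := by
  simp only [coinList, List.mem_flatMap, List.mem_map, List.mem_range]
  constructor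
  · rintro ⟨k, hk, l, hl, rfl⟩; exact ⟨hk, hl⟩
  · rintro ⟨h, h'⟩; exact ⟨_, h, _, h', rfl⟩

/-- The swap `l` of stage `k`, if the coins command it. -/
def coinSwap (r : Coins) (k l : ℕ) : Equiv.Perm ℕ := if r (k, l) then Equiv.swap l (l + 1) else 1

/-- The permutation of the first `L` swaps of stage `k`. -/
def stagePerm (r : Coins) (k : ℕ) : ℕ → Equiv.Perm ℕ
  | 0 => 1
  | L + 1 => coinSwap r k L * stagePerm r k L

/-- The permutation of the stages below `k`; the highest stage acts first. -/
def shufflePerm (r : Coins) : ℕ → Equiv.Perm ℕ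
  | 0 => 1
  | k + 1 => shufflePerm r k * stagePerm r k k

theorem stagePerm_congr {r r' : Coins} {k L : ℕ} (h : ∀ l < L, r (k, l) = r' (k, l)) :
    stagePerm r k L = stagePerm r' k L := by
  induction L with
  | zero => rfl
  | succ L ih =>
    rw [stagePerm, stagePerm, ih fun l hl => h l (by omega), coinSwap, coinSwap, h L (by omega)]

theorem stagePerm_apply_of_lt (r : Coins) {k L i : ℕ} (h : L < i) : stagePerm r k L i = i := by
  induction L with
  | zero => rfl
  | succ L ih =>
    rw [stagePerm, Equiv.Perm.mul_apply, ih (by omega)]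
    unfold coinSwap
    split_ifs
    · exact Equiv.swap_apply_of_ne_of_ne (by omega) (by omega)
    · rfl

/-- The cycle that carries `j` to `L` and each `i` with `j < i ≤ L` to `i - 1`. -/
def carry : ℕ → ℕ → Equiv.Perm ℕ
  | 0, _ => 1
  | L + 1, j => if j = L + 1 then 1 else Equiv.swap L (L + 1) * carry L j

theorem carry_self (L : ℕ) : carry L L = 1 := by cases L <;> simp [carry]

theorem carry_apply_of_gt {L j i : ℕ} (h : L < i) : carry L j i = i := by
  induction L with
  | zero => rfl
  | succ L ih =>
    rw [carry]
    split_ifs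
    · rfl
    · rw [Equiv.Perm.mul_apply, ih (by omega), Equiv.swap_apply_of_ne_of_ne] <;> omega

theorem carry_apply {L j : ℕ} (h : j ≤ L) : carry L j j = L := by
  induction L with
  | zero => simp [carry]; omega
  | succ L ih =>
    rw [carry]
    split_ifs with hj
    · simp [hj]
    · rw [Equiv.Perm.mul_apply, ih (by omega), Equiv.swap_apply_left]

/-- The mean over stage `k` of a function that is invariant under left multiplication by
permutations of `0, …, L - 1`: the item that stage `k` carries to position `L` is uniformly
distributed. -/
theorem coinMean_stage {k L : ℕ} {h : Equiv.Perm ℕ → ℂ} {r : Coins}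
    (hinv : ∀ g : Equiv.Perm ℕ, (∀ i, L ≤ i → g i = i) → ∀ τ, h (g * τ) = h τ) :
    coinMean (stageCoins k L) (fun r => h (stagePerm r k L)) r =
      1 / (L + 1) * ∑ j ∈ Finset.range (L + 1), h (carry L j) := by
  induction L generalizing h r with
  | zero => simp [stageCoins, coinMean, stagePerm, carry]
  | succ L ih =>
    rw [stageCoins_succ, coinMean, Fintype.sum_bool]
    have key (b : Bool) : coinMean (stageCoins k L) (fun r => h (stagePerm r k (L + 1)))
        (Function.update r (k, L) b) = coinMean (stageCoins k L)
          (fun r => h ((if b then Equiv.swap L (L + 1) else 1) * stagePerm r k L))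
            (Function.update r (k, L) b) := by
      refine coinMean_congr fun r' hr' => ?_
      have := hr' (k, L) (by simp [mem_stageCoins])
      rw [stagePerm, coinSwap, this, Function.update_self]
    rw [key true, key false]
    -- without the last swap, the item of position `L + 1` stays there
    have h₀ (r : Coins) : coinMean (stageCoins k L)
        (fun r => h ((if false = true then Equiv.swap L (L + 1) else 1) * stagePerm r k L)) r =
          h 1 := by
      rw [show (fun r => h ((if false = true then Equiv.swap L (L + 1) else 1) *
        stagePerm r k L)) = fun _ => h 1 from ?_, coinMean_const]
      funext r
      have := hinv (stagePerm r k L) (fun i hi => stagePerm_apply_of_lt r (by omega)) 1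
      simpa using this
    rw [h₀]
    have h₁ := ih (h := fun τ => h (Equiv.swap L (L + 1) * τ)) (r := Function.update r (k, L) true)
      (by
        intro g hg τ
        -- `g` fixes `L` and `L + 1`
        have hcomm : Equiv.swap L (L + 1) * g = g * Equiv.swap L (L + 1) := by
          have := Equiv.swap_mul_eq_mul_swap g (g L) (g (L + 1))
          simpa [hg L le_rfl, hg (L + 1) (by omega)] using
            (Equiv.mul_swap_eq_swap_mul g L (L + 1)).symm
        rw [← mul_assoc, hcomm, mul_assoc]
        exact hinv g (fun i hi => hg i (by omega)) _)
    simp only [if_true]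
    rw [h₁, Finset.sum_range_succ _ (L + 1), carry_self]
    have h₂ : ∑ j ∈ Finset.range (L + 1), h (carry (L + 1) j) =
        ∑ j ∈ Finset.range (L + 1), h (Equiv.swap L (L + 1) * carry L j) := by
      refine Finset.sum_congr rfl fun j hj => ?_
      have := Finset.mem_range.1 hj
      rw [carry, if_neg (by omega)]
    rw [h₂]
    have a₁ : ((L : ℂ) + 1) ≠ 0 := by exact_mod_cast L.succ_ne_zero
    have a₂ : ((L : ℂ) + 2) ≠ 0 := by exact_mod_cast (by omega : L + 2 ≠ 0)
    have a₃ : ((L : ℂ) + 1 + 1) ≠ 0 := by exact_mod_cast (by omega : L + 1 + 1 ≠ 0)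
    simp only [coinProb]
    push_cast
    have a₄ : ((L : ℂ) + 1 + 1) = L + 2 := by ring
    rw [a₄]
    field_simp

/-- The permutation of `ℕ` that is `s` on `0, …, k - 1` and fixes the other numbers. -/
def extendPerm {k : ℕ} (s : Equiv.Perm (Fin k)) : Equiv.Perm ℕ := s.extendDomain Fin.equivSubtype

theorem extendPerm_apply {k : ℕ} (s : Equiv.Perm (Fin k)) (i : Fin k) : extendPerm s i = s i :=
  s.extendDomain_apply_image Fin.equivSubtype i

theorem extendPerm_apply_of_le {k : ℕ} (s : Equiv.Perm (Fin k)) {i : ℕ} (h : k ≤ i) :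
    extendPerm s i = i :=
  s.extendDomain_apply_not_subtype Fin.equivSubtype (by omega)

theorem extendPerm_injective (k : ℕ) : Function.Injective (extendPerm (k := k)) :=
  Equiv.Perm.extendDomainHom_injective Fin.equivSubtype

/-- The permutations of `ℕ` that fix all numbers from `k` on. -/
def permsBelow (k : ℕ) : Finset (Equiv.Perm ℕ) :=
  Finset.univ.map ⟨extendPerm, extendPerm_injective k⟩

theorem mem_permsBelow {k : ℕ} {g : Equiv.Perm ℕ} : g ∈ permsBelow k ↔ ∀ i, k ≤ i → g i = i := by
  simp only [permsBelow, Finset.mem_map, Finset.mem_univ, true_and, Function.Embedding.coeFn_mk]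
  constructor
  · rintro ⟨g, rfl⟩ i hi
    exact extendPerm_apply_of_le g hi
  · intro h
    have hlt (x : ℕ) : x < k ↔ g x < k := by
      constructor
      · intro hx
        by_contra hg
        have := g.injective (h (g x) (by omega))
        omega
      · intro hx
        by_contra hg
        rw [h x (by omega)] at hx
        exact hg hx
    refine ⟨Fin.equivSubtype.symm.permCongr (g.subtypePerm fun x => (hlt x).symm), ?_⟩
    ext i
    by_cases hi : i < k
    · exact extendPerm_apply _ ⟨i, hi⟩
    · exact (extendPerm_apply_of_le _ (by omega)).trans (h i (by omega)).symm

theorem sum_permsBelow_mul {k : ℕ} {g : Equiv.Perm ℕ} (hg : g ∈ permsBelow k)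
    (f : Equiv.Perm ℕ → ℂ) : ∑ s ∈ permsBelow k, f (s * g) = ∑ s ∈ permsBelow k, f s := by
  rw [mem_permsBelow] at hg
  have hg' (i : ℕ) (hi : k ≤ i) : g⁻¹ i = i := by
    rw [Equiv.Perm.inv_eq_iff_eq]; exact (hg i hi).symm
  refine Finset.sum_nbij' (fun s => s * g) (fun s => s * g⁻¹) ?_ ?_ ?_ ?_ ?_
  · intro s hs
    rw [mem_permsBelow] at hs ⊢
    intro i hi
    rw [Equiv.Perm.mul_apply, hg i hi, hs i hi]
  · intro s hs
    rw [mem_permsBelow] at hs ⊢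
    intro i hi
    rw [Equiv.Perm.mul_apply, hg' i hi, hs i hi]
  · intro s _; simp
  · intro s _; simp
  · intro s _; rfl

/-- Every permutation of `0, …, k` is in a unique way a permutation of `0, …, k - 1` after a
`carry`. -/
theorem sum_permsBelow_succ (k : ℕ) (f : Equiv.Perm ℕ → ℂ) :
    ∑ s ∈ permsBelow (k + 1), f s =
      ∑ j ∈ Finset.range (k + 1), ∑ s ∈ permsBelow k, f (s * carry k j) := by
  rw [Finset.sum_comm, ← Finset.sum_product']
  symm
  refine Finset.sum_nbij' (fun x => x.1 * carry k x.2) (fun g => (g * (carry k (g⁻¹ k))⁻¹, g⁻¹ k))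
    ?_ ?_ ?_ ?_ ?_
  · rintro ⟨s, j⟩ hs
    rw [Finset.mem_product, mem_permsBelow] at hs
    rw [mem_permsBelow]
    intro i hi
    rw [Equiv.Perm.mul_apply, carry_apply_of_gt (by omega), hs.1 i (by omega)]
  · intro g hg
    rw [mem_permsBelow] at hg
    have hle : g⁻¹ k ≤ k := by
      by_contra h
      have h₁ := hg (g⁻¹ k) (by omega)
      have h₂ : g (g⁻¹ k) = k := g.apply_symm_apply k
      omega
    rw [Finset.mem_product, mem_permsBelow]
    refine ⟨fun i hi => ?_, by simpa using by omega⟩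
    rw [Equiv.Perm.mul_apply]
    rcases Nat.lt_or_ge k i with h | h
    · have : (carry k (g⁻¹ k))⁻¹ i = i := by
        rw [Equiv.Perm.inv_eq_iff_eq, carry_apply_of_gt h]
      rw [this, hg i (by omega)]
    · obtain rfl : i = k := by omega
      have : (carry i (g⁻¹ i))⁻¹ i = g⁻¹ i := by
        rw [Equiv.Perm.inv_eq_iff_eq, carry_apply hle]
      rw [this]; exact g.apply_symm_apply i
  · rintro ⟨s, j⟩ hs
    rw [Finset.mem_product, mem_permsBelow, Finset.mem_range] at hs
    have h₁ : (s * carry k j)⁻¹ k = j := by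
      rw [Equiv.Perm.inv_eq_iff_eq, Equiv.Perm.mul_apply, carry_apply (by omega)]
      exact (hs.1 k le_rfl).symm
    simp only [h₁]
    simp
  · intro g _; simp
  · intro x _; rfl

/-- Independent coins shuffle uniformly: the mean over the tosses of all coins is the mean over all
permutations. -/
theorem coinMean_shuffle (m : ℕ) (f : Equiv.Perm ℕ → ℂ) (r : Coins) :
    coinMean (coinList m).reverse (fun r => f (shufflePerm r m)) r =
      1 / (m.factorial : ℂ) * ∑ s ∈ permsBelow m, f s := by
  induction m generalizing f r with
  | zero =>
    have : permsBelow 0 = {1} := by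
      ext g
      rw [mem_permsBelow, Finset.mem_singleton]
      constructor
      · intro h; ext i; simp [h i]
      · rintro rfl i _; rfl
    simp [coinList, coinMean, shufflePerm, this]
  | succ k ih =>
    rw [coinList_succ_reverse, coinMean_append]
    have h₁ : coinMean (stageCoins k k)
        (coinMean (coinList k).reverse fun r => f (shufflePerm r (k + 1))) r =
          coinMean (stageCoins k k) (fun r => (fun τ => 1 / (k.factorial : ℂ) *
            ∑ s ∈ permsBelow k, f (s * τ)) (stagePerm r k k)) r := by
      refine coinMean_congr fun r' _ => ?_
      refine Eq.trans ?_ (ih (fun s => f (s * stagePerm r' k k)) r')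
      refine coinMean_congr fun r'' hr'' => ?_
      rw [shufflePerm, stagePerm_congr (r := r'') (r' := r')]
      intro l _
      refine hr'' _ ?_
      rw [List.mem_reverse, mem_coinList]
      omega
    refine h₁.trans ((coinMean_stage (h := fun τ => 1 / (k.factorial : ℂ) *
      ∑ s ∈ permsBelow k, f (s * τ)) ?_).trans ?_)
    rotate_left
    · rw [sum_permsBelow_succ, Nat.factorial_succ, ← Finset.mul_sum]
      push_cast
      field_simp
    · intro g hg τ
      have := sum_permsBelow_mul (mem_permsBelow.2 hg) (fun s => f (s * τ))
      simp only [mul_assoc] at this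
      rw [this]

/-! ### Wires and the states that occur in the circuit -/

theorem mul_add_inj {d i j i' j' : ℕ} (hj : j < d) (hj' : j' < d) (h : i * d + j = i' * d + j') :
    i = i' ∧ j = j' := by
  have hd : 0 < d := by omega
  have h₁ : (i * d + j) / d = i := by
    rw [Nat.add_comm, Nat.add_mul_div_right _ _ hd, Nat.div_eq_of_lt hj, zero_add]
  have h₂ : (i' * d + j') / d = i' := by
    rw [Nat.add_comm, Nat.add_mul_div_right _ _ hd, Nat.div_eq_of_lt hj', zero_add]
  have h₃ : i = i' := by rw [← h₁, h, h₂]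
  subst h₃
  exact ⟨rfl, by omega⟩

theorem mul_add_lt {d m i j : ℕ} (hi : i < m) (hj : j < d) : i * d + j < m * d := by
  have := Nat.mul_le_mul_right d hi
  rw [Nat.succ_mul] at this
  omega

/-- The bits of the coins; pairs that do not number a coin get the bit zero. -/
def coinBits (n a m : ℕ) (w : ℕ → Bool) : Coins := fun c =>
  if c.2 < c.1 ∧ c.1 < m then w (coinWire n a m c.1 c.2) else false

/-- The bits of dummy register `i`. -/
def dummyBits (n a m : ℕ) (w : ℕ → Bool) (i : ℕ) : Bits n := fun j => w (dummyWire n a m i j)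

/-- The ancillas at the places in the coin region that are no coins are in the state zero. -/
def spareZero (n a m : ℕ) (w : ℕ → Bool) : Prop :=
  ∀ k < m, ∀ l < m, ¬ l < k → w (coinWire n a m k l) = false

open Classical in
/-- The amplitudes of a superposition over the outcomes `r` of the coins: for each `r` the data are
in the state `φ r`, dummy register `i` is in the state `δ r i`, token `s` has the value `x r s`, and
the pool and the spare ancillas are zero. -/
noncomputable def form (n a m : ℕ) (φ : Coins → State n) (δ : Coins → ℕ → State n)
    (x : Coins → ℕ → Bool) : Amp :=
  lift (n + a) fun w =>
    (if (∀ s < m, w (tokWire n a s) = x (coinBits n a m w) s) ∧ spareZero n a m w then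
      ∏ i ∈ Finset.range m, δ (coinBits n a m w) i (dummyBits n a m w i) else 0) •
        φ (coinBits n a m w)

section

variable {n a m : ℕ}

theorem coinBits_congr {w w' : ℕ → Bool} (h : ∀ q, n + a + m + m * n ≤ q → w q = w' q) :
    coinBits n a m w = coinBits n a m w' := by
  funext c
  simp only [coinBits]
  split_ifs
  · exact h _ (by unfold coinWire; omega)
  · rfl

theorem spareZero_congr {w w' : ℕ → Bool} (h : ∀ q, n + a + m + m * n ≤ q → w q = w' q) :
    spareZero n a m w ↔ spareZero n a m w' := by
  have h' (k l : ℕ) : w (coinWire n a m k l) = w' (coinWire n a m k l) :=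
    h _ (by unfold coinWire; omega)
  simp only [spareZero, h']

theorem dummyWire_lt {i j : ℕ} (hi : i < m) (hj : j < n) :
    dummyWire n a m i j < n + a + m + m * n := by
  have := mul_add_lt hi hj
  unfold dummyWire
  omega

theorem le_dummyWire {i j : ℕ} : n + a + m ≤ dummyWire n a m i j := by
  unfold dummyWire; omega

theorem le_coinWire {k l : ℕ} : n + a + m + m * n ≤ coinWire n a m k l := by
  unfold coinWire; omega

theorem coinWire_lt {k l : ℕ} (hk : k < m) (hl : l < m) :
    coinWire n a m k l < n + (a + m + m * n + m * m) := by
  have := mul_add_lt hk hl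
  unfold coinWire
  omega

/-- Changes on the tokens only change the condition on the tokens. -/
theorem form_eq_of_tok {φ : Coins → State n} {δ : Coins → ℕ → State n} {x x' : Coins → ℕ → Bool}
    {w w' : ℕ → Bool} (h : ∀ q, q < n + a ∨ n + a + m ≤ q → w' q = w q)
    (hx : (∀ s < m, w' (tokWire n a s) = x (coinBits n a m w) s) ↔
      ∀ s < m, w (tokWire n a s) = x' (coinBits n a m w) s) :
    form n a m φ δ x w' = form n a m φ δ x' w := by
  have h₁ : coinBits n a m w' = coinBits n a m w := coinBits_congr fun q hq => h q (by omega)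
  have h₂ : spareZero n a m w' ↔ spareZero n a m w := spareZero_congr fun q hq => h q (by omega)
  have h₃ (i : ℕ) : dummyBits n a m w' i = dummyBits n a m w i :=
    funext fun j => h _ (.inr le_dummyWire)
  have h₄ : (fun i : Fin n => w' i) = fun i : Fin n => w i := funext fun i => h _ (by omega)
  have h₅ : (∀ q, n ≤ q → q < n + a → w' q = false) ↔ ∀ q, n ≤ q → q < n + a → w q = false :=
    forall_congr' fun q => forall_congr' fun _ => forall_congr' fun hq => by rw [h q (.inl hq)]
  have h₆ : ((∀ s < m, w' (tokWire n a s) = x (coinBits n a m w') s) ∧ spareZero n a m w') ↔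
      (∀ s < m, w (tokWire n a s) = x' (coinBits n a m w) s) ∧ spareZero n a m w := by
    rw [h₁]; exact and_congr hx h₂
  by_cases hc : (∀ s < m, w (tokWire n a s) = x' (coinBits n a m w) s) ∧ spareZero n a m w
  · simp only [form, lift, if_pos hc, if_pos (h₆.2 hc), h₁, h₃, h₄, h₅]
  · simp only [form, lift, if_neg hc, if_neg (mt h₆.1 hc), h₁, h₄, h₅]

theorem form_congr {φ φ' : Coins → State n} {δ δ' : Coins → ℕ → State n} {x x' : Coins → ℕ → Bool}
    (hφ : ∀ r, φ r = φ' r) (hδ : ∀ r, ∀ i < m, δ r i = δ' r i) (hx : ∀ r, ∀ s < m, x r s = x' r s) :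
    form n a m φ δ x = form n a m φ' δ' x' := by
  funext w
  have h₁ : (∀ s < m, w (tokWire n a s) = x (coinBits n a m w) s) ↔
      ∀ s < m, w (tokWire n a s) = x' (coinBits n a m w) s :=
    forall_congr' fun s => forall_congr' fun hs => by rw [hx _ s hs]
  have h₂ : ∏ i ∈ Finset.range m, δ (coinBits n a m w) i (dummyBits n a m w i) =
      ∏ i ∈ Finset.range m, δ' (coinBits n a m w) i (dummyBits n a m w i) :=
    Finset.prod_congr rfl fun i hi => by rw [hδ _ i (Finset.mem_range.1 hi)]
  by_cases hc : (∀ s < m, w (tokWire n a s) = x' (coinBits n a m w) s) ∧ spareZero n a m w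
  · simp only [form, lift, if_pos hc, if_pos (⟨h₁.2 hc.1, hc.2⟩ : _ ∧ _), h₂, hφ]
  · have hc' : ¬ ((∀ s < m, w (tokWire n a s) = x (coinBits n a m w) s) ∧ spareZero n a m w) :=
      fun h => hc ⟨h₁.1 h.1, h.2⟩
    simp only [form, lift, if_neg hc, if_neg hc', hφ]

/-! ### Controlled swaps and the shuffle of the tokens -/

theorem act_X (q : ℕ) (F : Amp) (w : ℕ → Bool) :
    (Gate.one .X q).act F w = F (Function.update w q (!w q)) := by
  simp only [Gate.act, OneQubit.toMatrix, Matrix.of_apply, Fintype.sum_bool]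
  cases w q <;> simp

theorem acts_cswap {c x y : ℕ} (hcx : c ≠ x) (hcy : c ≠ y) (hxy : x ≠ y) (F : Amp)
    (w : ℕ → Bool) :
    acts (cswapGates c x y) F w = F (if w c then w ∘ Equiv.swap x y else w) := by
  simp only [cswapGates, acts, Gate.act]
  congr 1
  funext q
  by_cases hq : q = x
  · subst hq
    cases h : w c <;> simp [hcx, hxy, hxy.symm, h]
  · by_cases hq' : q = y
    · subst hq'
      cases h : w c <;> simp [hcx, hxy.symm, h]
      cases w x <;> simp
    · cases h : w c <;> simp [hq, hq', Equiv.swap_apply_of_ne_of_ne]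

theorem acts_flip {t : ℕ} (ht : t < m) (φ : Coins → State n) (δ : Coins → ℕ → State n)
    (x : Coins → ℕ → Bool) :
    acts [.one .X (tokWire n a t)] (form n a m φ δ x) =
      form n a m φ δ fun r => Function.update (x r) t (!x r t) := by
  funext w
  refine (act_X _ _ _).trans (form_eq_of_tok (fun q hq => ?_) ?_)
  · rw [Function.update_of_ne]
    unfold tokWire; omega
  · refine forall_congr' fun s => forall_congr' fun hs => ?_
    by_cases hst : s = t
    · subst hst
      simp only [Function.update_self]
      cases w (tokWire n a s) <;> cases x (coinBits n a m w) s <;> simp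
    · rw [Function.update_of_ne (by unfold tokWire; omega), Function.update_of_ne hst]

theorem acts_coinSwap {k l : ℕ} (hk : k < m) (hl : l < k) (φ : Coins → State n)
    (δ : Coins → ℕ → State n) (x : Coins → ℕ → Bool) :
    acts (cswapGates (coinWire n a m k l) (tokWire n a l) (tokWire n a (l + 1)))
      (form n a m φ δ x) = form n a m φ δ fun r => x r ∘ coinSwap r k l := by
  funext w
  have hc := @le_coinWire n a m k l
  have hcl : tokWire n a l < n + a + m := by unfold tokWire; omega
  have hcl' : tokWire n a (l + 1) < n + a + m := by unfold tokWire; omega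
  have hb : coinBits n a m w (k, l) = w (coinWire n a m k l) := by simp [coinBits, hk, hl]
  have htok (s : ℕ) : Equiv.swap (tokWire n a l) (tokWire n a (l + 1)) (tokWire n a s) =
      tokWire n a (Equiv.swap l (l + 1) s) := by
    simp only [Equiv.swap_apply_def, tokWire]
    split_ifs <;> omega
  rw [acts_cswap (by omega) (by omega) (by unfold tokWire; omega)]
  refine form_eq_of_tok (fun q hq => ?_) ?_
  · split_ifs
    · rw [Function.comp_apply, Equiv.swap_apply_of_ne_of_ne] <;> unfold tokWire <;> omega
    · rfl
  · simp only [coinSwap, hb]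
    cases w (coinWire n a m k l) with
    | false => simp
    | true =>
      simp only [if_true, Function.comp_apply, htok]
      have hlt (s : ℕ) (hs : s < m) : Equiv.swap l (l + 1) s < m := by
        rw [Equiv.swap_apply_def]; split_ifs <;> omega
      constructor
      · intro h s hs
        have := h _ (hlt s hs)
        rwa [Equiv.swap_apply_self] at this
      · intro h s hs
        have := h _ (hlt s hs)
        rwa [Equiv.swap_apply_self] at this

theorem acts_stage {k : ℕ} (hk : k < m) (L : ℕ) (hL : L ≤ k) (φ : Coins → State n)
    (δ : Coins → ℕ → State n) (x : Coins → ℕ → Bool) :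
    acts ((List.range L).flatMap fun l =>
      cswapGates (coinWire n a m k l) (tokWire n a l) (tokWire n a (l + 1))) (form n a m φ δ x) =
        form n a m φ δ fun r => x r ∘ ⇑((stagePerm r k L)⁻¹ : Equiv.Perm ℕ) := by
  induction L with
  | zero => rfl
  | succ L ih =>
    rw [List.range_succ, List.flatMap_append, acts_append, ih (by omega), List.flatMap_cons,
      List.flatMap_nil, List.append_nil, acts_coinSwap hk (by omega)]
    congr 1
    funext r
    have : (coinSwap r k L)⁻¹ = coinSwap r k L := by
      unfold coinSwap; split_ifs <;> simp
    rw [stagePerm, mul_inv_rev, this]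
    rfl

theorem acts_stage_reverse {k : ℕ} (hk : k < m) (L : ℕ) (hL : L ≤ k) (φ : Coins → State n)
    (δ : Coins → ℕ → State n) (x : Coins → ℕ → Bool) :
    acts ((List.range L).reverse.flatMap fun l =>
      cswapGates (coinWire n a m k l) (tokWire n a l) (tokWire n a (l + 1))) (form n a m φ δ x) =
        form n a m φ δ fun r => x r ∘ stagePerm r k L := by
  induction L generalizing x with
  | zero => rfl
  | succ L ih =>
    rw [List.range_succ, List.reverse_append, List.flatMap_append, acts_append]
    simp only [List.reverse_singleton, List.flatMap_cons, List.flatMap_nil, List.append_nil]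
    rw [acts_coinSwap hk (by omega), ih (by omega)]
    rfl

theorem acts_shuffle_aux (K : ℕ) (hK : K ≤ m) (φ : Coins → State n) (δ : Coins → ℕ → State n)
    (x : Coins → ℕ → Bool) :
    acts ((List.range K).reverse.flatMap fun k => (List.range k).flatMap fun l =>
      cswapGates (coinWire n a m k l) (tokWire n a l) (tokWire n a (l + 1))) (form n a m φ δ x) =
        form n a m φ δ fun r => x r ∘ ⇑((shufflePerm r K)⁻¹ : Equiv.Perm ℕ) := by
  induction K generalizing x with
  | zero => rfl
  | succ K ih =>
    rw [List.range_succ, List.reverse_append, List.flatMap_append, acts_append]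
    simp only [List.reverse_singleton, List.flatMap_cons, List.flatMap_nil, List.append_nil]
    rw [acts_stage (by omega) _ le_rfl, ih (by omega)]
    congr 1

theorem acts_shuffle (φ : Coins → State n) (δ : Coins → ℕ → State n) (x : Coins → ℕ → Bool) :
    acts (shuffleGates n a m) (form n a m φ δ x) =
      form n a m φ δ fun r => x r ∘ ⇑((shufflePerm r m)⁻¹ : Equiv.Perm ℕ) :=
  acts_shuffle_aux m le_rfl φ δ x

theorem acts_unshuffle_aux (K : ℕ) (hK : K ≤ m) (φ : Coins → State n) (δ : Coins → ℕ → State n)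
    (x : Coins → ℕ → Bool) :
    acts ((List.range K).flatMap fun k => (List.range k).reverse.flatMap fun l =>
      cswapGates (coinWire n a m k l) (tokWire n a l) (tokWire n a (l + 1))) (form n a m φ δ x) =
        form n a m φ δ fun r => x r ∘ shufflePerm r K := by
  induction K with
  | zero => rfl
  | succ K ih =>
    rw [List.range_succ, List.flatMap_append, acts_append, ih (by omega), List.flatMap_cons,
      List.flatMap_nil, List.append_nil, acts_stage_reverse (by omega) _ le_rfl]
    rfl

theorem acts_unshuffle (φ : Coins → State n) (δ : Coins → ℕ → State n) (x : Coins → ℕ → Bool) :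
    acts (unshuffleGates n a m) (form n a m φ δ x) =
      form n a m φ δ fun r => x r ∘ shufflePerm r m :=
  acts_unshuffle_aux m le_rfl φ δ x

/-! ### Exchange of the data with a dummy register -/

/-- The exchange of the wires `0, …, J - 1` with the wires `d, …, d + J - 1`. -/
def exchangeMap (d J : ℕ) : ℕ → ℕ := fun q =>
  if q < J then d + q else if d ≤ q ∧ q < d + J then q - d else q

theorem acts_exchangeGates {i : ℕ} (hi : i < m) (F : Amp) (w : ℕ → Bool) :
    acts (exchangeGates n a m i) F w =
      F (if w (tokWire n a i) then w ∘ exchangeMap (dummyWire n a m i 0) n else w) := by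
  have key : ∀ J ≤ n, ∀ w, acts ((List.range J).flatMap fun j =>
      cswapGates (tokWire n a i) j (dummyWire n a m i j)) F w =
        F (if w (tokWire n a i) then w ∘ exchangeMap (dummyWire n a m i 0) J else w) := by
    intro J
    induction J with
    | zero =>
      intro _ w
      have : exchangeMap (dummyWire n a m i 0) 0 = id := by
        funext q; simp [exchangeMap]
      simp [acts, this]
    | succ J ih =>
      intro hJ w
      have hd := @le_dummyWire n a m i J
      have hd' := @le_dummyWire n a m i 0
      have ht : tokWire n a i < n + a + m := by unfold tokWire; omega
      have ht' : n + a ≤ tokWire n a i := by unfold tokWire; omega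
      have hd0 : dummyWire n a m i J = dummyWire n a m i 0 + J := rfl
      rw [List.range_succ, List.flatMap_append, acts_append, List.flatMap_cons,
        List.flatMap_nil, List.append_nil, acts_cswap (by omega) (by omega) (by omega),
        ih (by omega)]
      congr 1
      have htok : (if w (tokWire n a i) then w ∘ Equiv.swap J (dummyWire n a m i J) else w)
          (tokWire n a i) = w (tokWire n a i) := by
        split_ifs
        · rw [Function.comp_apply, Equiv.swap_apply_of_ne_of_ne] <;> omega
        · rfl
      rw [htok]
      split_ifs
      · funext q
        simp only [Function.comp_apply]
        congr 1
        simp only [exchangeMap, Equiv.swap_apply_def, hd0]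
        split_ifs <;> omega
      · rfl
  exact key n le_rfl w

theorem acts_exchange {i : ℕ} (hi : i < m) (φ : Coins → State n) (δ : Coins → ℕ → State n)
    (x : Coins → ℕ → Bool) :
    acts (exchangeGates n a m i) (form n a m φ δ x) =
      form n a m (fun r => if x r i then δ r i else φ r)
        (fun r => if x r i then Function.update (δ r) i (φ r) else δ r) x := by
  funext w
  rw [acts_exchangeGates hi]
  have hdi : dummyWire n a m i 0 + n ≤ n + a + m + m * n := by
    have := Nat.mul_le_mul_right n hi
    rw [Nat.succ_mul] at this
    unfold dummyWire; omega
  have hd := @le_dummyWire n a m i 0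
  by_cases hw : w (tokWire n a i) = true
  · rw [if_pos hw]
    set w' := w ∘ exchangeMap (dummyWire n a m i 0) n with hw'
    have hout (q : ℕ) (h₁ : n ≤ q) (h₂ : q < dummyWire n a m i 0 ∨ dummyWire n a m i 0 + n ≤ q) :
        w' q = w q := by
      simp only [hw', Function.comp_apply, exchangeMap]
      rw [if_neg (by omega), if_neg (by omega)]
    have h₁ : coinBits n a m w' = coinBits n a m w :=
      coinBits_congr fun q hq => hout q (by omega) (by omega)
    have h₂ : spareZero n a m w' ↔ spareZero n a m w :=
      spareZero_congr fun q hq => hout q (by omega) (by omega)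
    have h₃ (i' : ℕ) (hi' : i' ≠ i) : dummyBits n a m w' i' = dummyBits n a m w i' := by
      funext j
      have hj := j.2
      refine hout _ (by have := @le_dummyWire n a m i' j; omega) ?_
      by_contra hcon
      have : i' * n + j = i * n + (dummyWire n a m i' j - dummyWire n a m i 0) := by
        unfold dummyWire at hcon ⊢; omega
      exact hi' (mul_add_inj hj (by omega) this).1
    have h₄ : (fun j : Fin n => w' j) = dummyBits n a m w i := by
      funext j
      simp [hw', exchangeMap, dummyBits, dummyWire]
    have h₅ : dummyBits n a m w' i = fun j : Fin n => w j := by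
      funext j
      have hj := j.2
      have e : dummyWire n a m i j = dummyWire n a m i 0 + j := rfl
      simp only [hw', dummyBits, Function.comp_apply, exchangeMap]
      rw [if_neg (by omega), if_pos (by omega)]
      congr 1; omega
    have h₆ : (∀ q, n ≤ q → q < n + a → w' q = false) ↔ ∀ q, n ≤ q → q < n + a → w q = false :=
      forall_congr' fun q => forall_congr' fun hq => forall_congr' fun hq' => by
        rw [hout q hq (by omega)]
    have h₇ (s : ℕ) (hs : s < m) : w' (tokWire n a s) = w (tokWire n a s) :=
      hout _ (by unfold tokWire; omega) (by unfold tokWire; omega)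
    have h₈ : ((∀ s < m, w' (tokWire n a s) = x (coinBits n a m w') s) ∧ spareZero n a m w') ↔
        (∀ s < m, w (tokWire n a s) = x (coinBits n a m w) s) ∧ spareZero n a m w := by
      rw [h₁]
      exact and_congr (forall_congr' fun s => forall_congr' fun hs => by rw [h₇ s hs]) h₂
    by_cases hc : (∀ s < m, w (tokWire n a s) = x (coinBits n a m w) s) ∧ spareZero n a m w
    · have hxi : x (coinBits n a m w) i = true := (hc.1 i hi).symm.trans hw
      simp only [form, lift, if_pos hc, if_pos (h₈.2 hc), h₁, h₆, h₄, hxi, if_true]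
      split_ifs
      · simp only [PiLp.smul_apply, smul_eq_mul]
        have hmem : i ∈ Finset.range m := Finset.mem_range.2 hi
        rw [← Finset.mul_prod_erase _ _ hmem, ← Finset.mul_prod_erase _ _ hmem, h₅,
          Function.update_self]
        have : ∏ i' ∈ (Finset.range m).erase i, δ (coinBits n a m w) i' (dummyBits n a m w' i') =
            ∏ i' ∈ (Finset.range m).erase i, Function.update (δ (coinBits n a m w)) i
              (φ (coinBits n a m w)) i' (dummyBits n a m w i') := by
          refine Finset.prod_congr rfl fun i' hi' => ?_
          have := Finset.ne_of_mem_erase hi'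
          rw [h₃ i' this, Function.update_of_ne this]
        rw [this]
        ring
      · rfl
    · simp [form, lift, if_neg hc, if_neg (mt h₈.1 hc)]
  · rw [if_neg hw]
    simp only [form, lift]
    by_cases hx : x (coinBits n a m w) i = true
    · have : ¬ ∀ s < m, w (tokWire n a s) = x (coinBits n a m w) s := fun h =>
        hw ((h i hi).trans hx)
      simp [this]
    · simp [hx]

end

/-! ### The rounds of the circuit -/

section

variable {n a m : ℕ}

/-- If token `i` is set, the circuit acts on dummy register `i`, and otherwise on the data. -/
theorem acts_controlled {i : ℕ} (hi : i < m) {c : UnitaryCircuit} {V : QUnitary n}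
    (hc : c.Implements V) (ha : c.anc ≤ a) (φ : Coins → State n) (δ : Coins → ℕ → State n)
    (x : Coins → ℕ → Bool) :
    acts (exchangeGates n a m i ++ c.gates ++ exchangeGates n a m i) (form n a m φ δ x) =
      form n a m (fun r => if x r i then φ r else Op.app (V : Op n) (φ r))
        (fun r => if x r i then Function.update (δ r) i (Op.app (V : Op n) (δ r i)) else δ r)
        x := by
  have key (φ : Coins → State n) (δ : Coins → ℕ → State n) :
      acts c.gates (form n a m φ δ x) = form n a m (fun r => Op.app (V : Op n) (φ r)) δ x := by
    unfold form
    rw [acts_lift hc (by omega)]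
    · simp only [Op.app_smul]
    · intro w w' h
      have h₁ : coinBits n a m w = coinBits n a m w' := coinBits_congr fun q hq => h q (by omega)
      have h₂ : spareZero n a m w ↔ spareZero n a m w' :=
        spareZero_congr fun q hq => h q (by omega)
      have h₃ (i : ℕ) : dummyBits n a m w i = dummyBits n a m w' i :=
        funext fun j => h _ (by have := @le_dummyWire n a m i j; omega)
      have h₄ : ((∀ s < m, w (tokWire n a s) = x (coinBits n a m w) s) ∧ spareZero n a m w) ↔
          (∀ s < m, w' (tokWire n a s) = x (coinBits n a m w') s) ∧ spareZero n a m w' := by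
        rw [h₁]
        exact and_congr (forall_congr' fun s => by rw [h _ (by unfold tokWire; omega)]) h₂
      by_cases hc : (∀ s < m, w' (tokWire n a s) = x (coinBits n a m w') s) ∧ spareZero n a m w'
      · simp only [if_pos hc, if_pos (h₄.2 hc), h₁, h₃]
      · simp only [if_neg hc, if_neg (mt h₄.1 hc), h₁]
  rw [acts_append, acts_append, acts_exchange hi, key, acts_exchange hi]
  refine form_congr (fun r => ?_) (fun r i' _ => ?_) fun r s _ => rfl
  · cases x r i <;> simp
  · cases x r i <;> simp

/-- If all tokens but `p r` are set, a pass over the circuits applies circuit `p r` to the data and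
all others to their dummy registers. -/
theorem acts_pass_aux (V : ℕ → QUnitary n) (p : Coins → ℕ) {x : Coins → ℕ → Bool}
    (hx : ∀ r, ∀ s < m, x r s = decide (s ≠ p r)) (cs : List UnitaryCircuit) (k : ℕ)
    (hk : k + cs.length ≤ m) (hV : ∀ i (h : i < cs.length), cs[i].Implements (V (k + i)))
    (ha : ∀ c ∈ cs, c.anc ≤ a) (φ : Coins → State n) (δ : Coins → ℕ → State n) :
    acts ((cs.zipIdx k).flatMap fun c =>
        exchangeGates n a m c.2 ++ c.1.gates ++ exchangeGates n a m c.2) (form n a m φ δ x) =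
      form n a m
        (fun r => if k ≤ p r ∧ p r < k + cs.length then Op.app (V (p r) : Op n) (φ r) else φ r)
        (fun r i => if i ≠ p r ∧ k ≤ i ∧ i < k + cs.length then Op.app (V i : Op n) (δ r i)
          else δ r i) x := by
  induction cs generalizing k φ δ with
  | nil =>
    refine form_congr (fun r => ?_) (fun r i _ => ?_) fun r s _ => rfl
    · rw [if_neg (by simp)]
    · rw [if_neg (by simp)]
  | cons c cs ih =>
    have hlen : (c :: cs).length = cs.length + 1 := rfl
    rw [hlen] at hk
    have hc : c.Implements (V k) := hV 0 (by simp)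
    rw [List.zipIdx_cons, List.flatMap_cons, acts_append]
    dsimp only
    rw [acts_controlled (by omega) hc (ha c (by simp)),
      ih (k + 1) (by omega) (fun i h => by
        have := hV (i + 1) (by rw [hlen]; omega)
        rwa [show k + (i + 1) = k + 1 + i by omega] at this) fun c hc => ha c (by simp [hc])]
    refine form_congr (fun r => ?_) (fun r i hi => ?_) fun r s _ => rfl
    · simp only [hx r k (by omega), hlen]
      by_cases h : k = p r
      · subst h
        have h₁ : ¬ (p r + 1 ≤ p r ∧ p r < p r + 1 + cs.length) := by omega
        have h₂ : p r ≤ p r ∧ p r < p r + (cs.length + 1) := by omega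
        rw [if_neg h₁, if_pos h₂]
        simp
      · simp only [ne_eq, h, not_false_eq_true, decide_true, if_true]
        exact if_congr (by omega) rfl rfl
    · simp only [hx r k (by omega), hlen]
      by_cases h : i = k
      · subst h
        have h₁ : ¬ (i ≠ p r ∧ i + 1 ≤ i ∧ i < i + 1 + cs.length) := by omega
        have h₂ : i ≤ i ∧ i < i + (cs.length + 1) := by omega
        rw [if_neg h₁]
        by_cases h' : i = p r
        · simp [h']
        · simp [h']
      · have : (if decide (k ≠ p r) = true then
            Function.update (δ r) k (Op.app (V k : Op n) (δ r k)) else δ r) i = δ r i := by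
          split_ifs
          · rw [Function.update_of_ne h]
          · rfl
        rw [this]
        exact if_congr (by omega) rfl rfl

theorem acts_pass {cs : List UnitaryCircuit} (hm : cs.length = m) (V : ℕ → QUnitary n)
    (hV : ∀ i (h : i < cs.length), cs[i].Implements (V i)) (ha : ∀ c ∈ cs, c.anc ≤ a)
    {p : Coins → ℕ} (hp : ∀ r, p r < m) {x : Coins → ℕ → Bool}
    (hx : ∀ r, ∀ s < m, x r s = decide (s ≠ p r)) (φ : Coins → State n)
    (δ : Coins → ℕ → State n) :
    acts (passGates n a cs) (form n a m φ δ x) =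
      form n a m (fun r => Op.app (V (p r) : Op n) (φ r))
        (fun r i => if i ≠ p r then Op.app (V i : Op n) (δ r i) else δ r i) x := by
  unfold passGates
  rw [hm, acts_pass_aux V p hx cs 0 (by omega) (by simpa using hV) ha]
  refine form_congr (fun r => ?_) (fun r i hi => ?_) fun r s _ => rfl
  · rw [if_pos ⟨Nat.zero_le _, by have := hp r; omega⟩]
  · exact if_congr (by omega) rfl rfl

theorem shufflePerm_apply_of_le (r : Coins) {k i : ℕ} (h : k ≤ i) : shufflePerm r k i = i := by
  induction k with
  | zero => rfl
  | succ k ih => rw [shufflePerm, Equiv.Perm.mul_apply, stagePerm_apply_of_lt r h, ih (by omega)]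

theorem shufflePerm_lt (r : Coins) {k i : ℕ} (h : i < k) : shufflePerm r k i < k := by
  by_contra h'
  have := (shufflePerm r k).injective (shufflePerm_apply_of_le r (not_lt.1 h'))
  omega

/-- In round `t` unitary `σ t` acts on the data and all others on their dummy registers, where `σ`
is the permutation chosen by the coins. -/
theorem acts_round {cs : List UnitaryCircuit} (hm : cs.length = m) (V : ℕ → QUnitary n)
    (hV : ∀ i (h : i < cs.length), cs[i].Implements (V i)) (ha : ∀ c ∈ cs, c.anc ≤ a)
    {t : ℕ} (ht : t < m) (φ : Coins → State n) (δ : Coins → ℕ → State n) :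
    acts (roundGates n a cs t) (form n a m φ δ fun _ _ => true) =
      form n a m (fun r => Op.app (V (shufflePerm r m t) : Op n) (φ r))
        (fun r i => if i ≠ shufflePerm r m t then Op.app (V i : Op n) (δ r i) else δ r i)
        fun _ _ => true := by
  unfold roundGates
  rw [hm, acts_append, acts_append, acts_append, acts_append, acts_flip ht, acts_shuffle,
    acts_pass hm V hV ha (p := fun r => shufflePerm r m t) (fun r => shufflePerm_lt r ht),
    acts_unshuffle, acts_flip ht]
  · refine form_congr (fun r => rfl) (fun r i hi => rfl) fun r s _ => ?_
    by_cases h : s = t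
    · subst h; simp
    · simp [h]
  · intro r s _
    simp only [Function.comp_apply, Bool.not_true]
    by_cases h : s = shufflePerm r m t
    · subst h; simp
    · have : (shufflePerm r m)⁻¹ s ≠ t := fun h' => h (by simp [← h'])
      rw [Function.update_of_ne this]
      simp [h]

/-- The product `V (s (T - 1)) ⋯ V (s 0)` applied to a state. -/
noncomputable def applySeq (V : ℕ → QUnitary n) (s : ℕ → ℕ) : ℕ → State n → State n
  | 0, φ => φ
  | T + 1, φ => Op.app (V (s T) : Op n) (applySeq V s T φ)

/-- The dummy register of a unitary that has already acted on the data lags behind by one round. -/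
theorem acts_rounds {cs : List UnitaryCircuit} (hm : cs.length = m) (V : ℕ → QUnitary n)
    (hV : ∀ i (h : i < cs.length), cs[i].Implements (V i)) (ha : ∀ c ∈ cs, c.anc ≤ a)
    (T : ℕ) (hT : T ≤ m) (φ : Coins → State n) (δ : ℕ → State n) :
    acts ((List.range T).flatMap (roundGates n a cs)) (form n a m φ (fun _ => δ) fun _ _ => true) =
      form n a m (fun r => applySeq V (shufflePerm r m) T (φ r))
        (fun r i => (Op.app (V i : Op n))^[if (shufflePerm r m)⁻¹ i < T then T - 1 else T] (δ i))
        fun _ _ => true := by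
  induction T with
  | zero => exact form_congr (fun r => rfl) (fun r i hi => by simp) fun r s _ => rfl
  | succ T ih =>
    rw [List.range_succ, List.flatMap_append, acts_append, ih (by omega), List.flatMap_cons,
      List.flatMap_nil, List.append_nil, acts_round hm V hV ha (by omega)]
    refine form_congr (fun r => rfl) (fun r i hi => ?_) fun r s _ => rfl
    have hiff : i = shufflePerm r m T ↔ (shufflePerm r m)⁻¹ i = T := by
      rw [Equiv.Perm.inv_eq_iff_eq]
    by_cases h : i = shufflePerm r m T
    · rw [if_neg (by simpa using h), hiff.1 h]
      simp
    · have h' := mt hiff.2 h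
      rw [if_pos h]
      refine (Function.iterate_succ_apply' (Op.app (V i : Op n)) _ _).symm.trans ?_
      congr 2
      split_ifs <;> omega

/-- After all rounds every dummy unitary has been applied once less than the number of rounds, in
whatever order the unitaries acted on the data. -/
theorem acts_allRounds {cs : List UnitaryCircuit} (hm : cs.length = m) (V : ℕ → QUnitary n)
    (hV : ∀ i (h : i < cs.length), cs[i].Implements (V i)) (ha : ∀ c ∈ cs, c.anc ≤ a)
    (φ : Coins → State n) (δ : ℕ → State n) :
    acts ((List.range m).flatMap (roundGates n a cs)) (form n a m φ (fun _ => δ) fun _ _ => true) =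
      form n a m (fun r => applySeq V (shufflePerm r m) m (φ r))
        (fun _ i => (Op.app (V i : Op n))^[m - 1] (δ i)) fun _ _ => true := by
  rw [acts_rounds hm V hV ha m le_rfl]
  refine form_congr (fun r => rfl) (fun r i hi => ?_) fun r s _ => rfl
  have : (shufflePerm r m)⁻¹ i < m := by
    by_contra h
    have h' := shufflePerm_apply_of_le r (not_lt.1 h)
    rw [show shufflePerm r m ((shufflePerm r m)⁻¹ i) = i by simp] at h'
    omega
  rw [if_pos this]

end

/-! ### Preparation and interference of the coins -/

section

variable {n a m : ℕ}

/-- The gates act on the qubit `q` as the matrix `M`. -/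
def ActOn (gs : List Gate) (q : ℕ) (M : Matrix Bool Bool ℂ) : Prop :=
  ∀ (F : Amp) (w : ℕ → Bool), acts gs F w = ∑ b, M (w q) b * F (Function.update w q b)

theorem actOn_one (u : OneQubit) (q : ℕ) : ActOn [.one u q] q u.toMatrix := fun _ _ => rfl

theorem ActOn.cons {u : OneQubit} {q : ℕ} {gs : List Gate} {M : Matrix Bool Bool ℂ}
    (h : ActOn gs q M) : ActOn (.one u q :: gs) q (M * u.toMatrix) := by
  intro F w
  change acts gs ((Gate.one u q).act F) w = _
  rw [h]
  simp only [Gate.act, Function.update_self, Function.update_idem, Matrix.mul_apply,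
    Fintype.sum_bool]
  ring

/-- The matrix of `prepGates`. -/
noncomputable def prepMatrix (l : ℕ) : Matrix Bool Bool ℂ :=
  OneQubit.H.toMatrix * (OneQubit.phase 1 (l + 1)).toMatrix * (OneQubit.phase 1 (l + 1)).toMatrix *
    OneQubit.H.toMatrix

/-- The matrix of `unprepGates`. -/
noncomputable def unprepMatrix (l : ℕ) : Matrix Bool Bool ℂ :=
  OneQubit.H.toMatrix * OneQubit.Z.toMatrix * (OneQubit.phase (l + 1) 1).toMatrix *
    (OneQubit.phase (l + 1) 1).toMatrix * OneQubit.H.toMatrix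

theorem actOn_prepGates (l q : ℕ) : ActOn (prepGates l q) q (prepMatrix l) :=
  (((actOn_one _ _).cons).cons).cons

theorem actOn_unprepGates (l q : ℕ) : ActOn (unprepGates l q) q (unprepMatrix l) :=
  ((((actOn_one _ _).cons).cons).cons).cons

/-- The amplitude for preparing a coin, keeping it in the state `b` and finding it zero after the
undoing of the preparation is the probability of `b`. -/
theorem unprepMatrix_mul_prepMatrix (l : ℕ) (b : Bool) :
    unprepMatrix l false b * prepMatrix l b false = coinProb l b := by
  have hs : ((Real.sqrt ((l : ℝ) + 1) : ℝ) : ℂ) ^ 2 = l + 1 := by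
    rw [← Complex.ofReal_pow, Real.sq_sqrt (by positivity)]; push_cast; rfl
  have hu : ((Real.sqrt ((l : ℝ) + 1 + 1) : ℝ) : ℂ) ^ 2 = l + 2 := by
    rw [← Complex.ofReal_pow, Real.sq_sqrt (by positivity)]; push_cast; ring
  have h2 : ((Real.sqrt 2 : ℝ) : ℂ) ^ 2 = 2 := by
    rw [← Complex.ofReal_pow, Real.sq_sqrt (by positivity)]; push_cast; rfl
  have hl : (l : ℂ) + 2 ≠ 0 := by exact_mod_cast (by omega : l + 2 ≠ 0)
  have e : (1 : ℝ) + ((l : ℝ) + 1) = (l : ℝ) + 1 + 1 := by ring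
  have hI := Complex.I_sq
  simp only [unprepMatrix, prepMatrix, OneQubit.toMatrix, phaseMatrix, Matrix.mul_apply,
    Fintype.sum_bool, Matrix.of_apply, Matrix.diagonal_apply, coinProb, Nat.cast_add, Nat.cast_one,
    Real.sqrt_one, Complex.ofReal_one, e]
  generalize ((Real.sqrt ((l : ℝ) + 1) : ℝ) : ℂ) = s at *
  generalize ((Real.sqrt ((l : ℝ) + 1 + 1) : ℝ) : ℂ) = u at *
  generalize ((Real.sqrt 2 : ℝ) : ℂ) = v at *
  have hu0 : u ≠ 0 := by rintro rfl; simp at hu; exact hl hu.symm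
  have hv0 : v ≠ 0 := by rintro rfl; simp at h2
  have hl' : (l : ℂ) = s ^ 2 - 1 := by rw [hs]; ring
  have hu' : u ^ 2 = s ^ 2 + 1 := by rw [hu, hl']; ring
  rw [← hu]
  generalize hI' : Complex.I = i at *
  have hv4 : v ^ 4 = 4 := by rw [show v ^ 4 = (v ^ 2) ^ 2 by ring, h2]; norm_num
  have h₁ : (s + i) ^ 2 = s ^ 2 + 2 * s * i - 1 := by linear_combination hI
  have h₂ : (1 + s * i) ^ 2 = 1 + 2 * s * i - s ^ 2 := by linear_combination s ^ 2 * hI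
  cases b
  · simp
    field_simp
    rw [hv4, hu', h₁, h₂]
    linear_combination -4 * s ^ 2 * hI
  · simp
    field_simp
    rw [hv4, hu', h₁, h₂, hl']
    linear_combination -4 * s ^ 2 * hI

theorem coinWire_inj {k l k' l' : ℕ} (hl : l < m) (hl' : l' < m)
    (h : coinWire n a m k l = coinWire n a m k' l') : k = k' ∧ l = l' :=
  mul_add_inj hl hl' (by unfold coinWire at h; omega)

/-- Gates on one coin act on the dependence of the data on the coins. -/
theorem acts_coin {k l : ℕ} (hk : k < m) (hl : l < k) {gs : List Gate} {M : Matrix Bool Bool ℂ}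
    (h : ActOn gs (coinWire n a m k l) M) (φ : Coins → State n) (δ : ℕ → State n) (x : ℕ → Bool) :
    acts gs (form n a m φ (fun _ => δ) fun _ => x) =
      form n a m (fun r => ∑ b, M (r (k, l)) b • φ (Function.update r (k, l) b)) (fun _ => δ)
        fun _ => x := by
  funext w
  rw [h]
  have hb : coinBits n a m w (k, l) = w (coinWire n a m k l) := by simp [coinBits, hk, hl]
  set q := coinWire n a m k l with hq
  have hqle : n + a + m + m * n ≤ q := le_coinWire
  have hlow (b : Bool) (p : ℕ) (hp : p < n + a + m + m * n) : Function.update w q b p = w p :=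
    Function.update_of_ne (by omega) _ _
  have h₁ (b : Bool) : coinBits n a m (Function.update w q b) =
      Function.update (coinBits n a m w) (k, l) b := by
    funext c
    by_cases hc : c = (k, l)
    · subst hc
      rw [Function.update_self]
      simp [coinBits, hk, hl, hq]
    · rw [Function.update_of_ne hc]
      simp only [coinBits]
      split_ifs with hc'
      · refine Function.update_of_ne (fun h => hc ?_) _ _
        obtain ⟨h₁, h₂⟩ := coinWire_inj (by omega) (by omega) h
        exact Prod.ext h₁ h₂
      · rfl
  have h₂ (b : Bool) : spareZero n a m (Function.update w q b) ↔ spareZero n a m w := by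
    refine forall_congr' fun k' => forall_congr' fun hk' => forall_congr' fun l' =>
      forall_congr' fun hl' => forall_congr' fun hlt => ?_
    rw [Function.update_of_ne]
    intro h
    obtain ⟨rfl, rfl⟩ := coinWire_inj hl' (by omega) h
    exact hlt hl
  have h₃ (b : Bool) (i : ℕ) (hi : i ∈ Finset.range m) :
      dummyBits n a m (Function.update w q b) i = dummyBits n a m w i :=
    funext fun j => hlow _ _ (dummyWire_lt (Finset.mem_range.1 hi) j.2)
  have h₄ (b : Bool) : (fun i : Fin n => Function.update w q b i) = fun i : Fin n => w i :=
    funext fun i => hlow _ _ (by omega)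
  have h₅ (b : Bool) : (∀ p, n ≤ p → p < n + a → Function.update w q b p = false) ↔
      ∀ p, n ≤ p → p < n + a → w p = false :=
    forall_congr' fun p => forall_congr' fun _ => forall_congr' fun hp => by
      rw [hlow _ _ (by omega)]
  have h₆ (b : Bool) : ((∀ s < m, Function.update w q b (tokWire n a s) = x s) ∧
      spareZero n a m (Function.update w q b)) ↔
      (∀ s < m, w (tokWire n a s) = x s) ∧ spareZero n a m w :=
    and_congr (forall_congr' fun s => forall_congr' fun hs => by
      rw [hlow _ _ (by unfold tokWire; omega)]) (h₂ b)
  by_cases hc : (∀ s < m, w (tokWire n a s) = x s) ∧ spareZero n a m w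
  · have h₇ (b : Bool) : ∏ i ∈ Finset.range m, δ i (dummyBits n a m (Function.update w q b) i) =
        ∏ i ∈ Finset.range m, δ i (dummyBits n a m w i) :=
      Finset.prod_congr rfl fun i hi => by rw [h₃ b i hi]
    simp only [form, lift, Fintype.sum_bool, if_pos hc, if_pos ((h₆ true).2 hc),
      if_pos ((h₆ false).2 hc), h₁, h₇, h₄, h₅, hb]
    split_ifs
    · simp only [PiLp.smul_apply, PiLp.add_apply, smul_eq_mul]
      ring
    · simp
  · simp [form, lift, if_neg hc, if_neg (mt (h₆ true).1 hc), if_neg (mt (h₆ false).1 hc)]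

/-- The action of one-qubit matrices on the coins of a list, the head of the list first. -/
noncomputable def coinOp (M : ℕ → Matrix Bool Bool ℂ) :
    List (ℕ × ℕ) → (Coins → State n) → Coins → State n
  | [], φ => φ
  | c :: cs, φ => coinOp M cs fun r => ∑ b, M c.2 (r c) b • φ (Function.update r c b)

theorem coinOp_concat (M : ℕ → Matrix Bool Bool ℂ) (cs : List (ℕ × ℕ)) (c : ℕ × ℕ)
    (φ : Coins → State n) :
    coinOp M (cs ++ [c]) φ =
      fun r => ∑ b, M c.2 (r c) b • coinOp M cs φ (Function.update r c b) := by
  induction cs generalizing φ with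
  | nil => rfl
  | cons c' cs ih => rw [List.cons_append, coinOp, ih]; rfl

theorem acts_coins {gs : ℕ → ℕ → List Gate} {M : ℕ → Matrix Bool Bool ℂ}
    (h : ∀ l q, ActOn (gs l q) q (M l)) {cs : List (ℕ × ℕ)} (hcs : ∀ c ∈ cs, c.1 < m ∧ c.2 < c.1)
    (φ : Coins → State n) (δ : ℕ → State n) (x : ℕ → Bool) :
    acts (cs.flatMap fun c => gs c.2 (coinWire n a m c.1 c.2))
        (form n a m φ (fun _ => δ) fun _ => x) =
      form n a m (coinOp M cs φ) (fun _ => δ) fun _ => x := by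
  induction cs generalizing φ with
  | nil => rfl
  | cons c cs ih =>
    obtain ⟨h₁, h₂⟩ := hcs c (by simp)
    rw [List.flatMap_cons, acts_append, acts_coin h₁ h₂ (h _ _),
      ih fun c hc => hcs c (by simp [hc])]
    rfl

/-- The amplitude of the outcomes `r` of the prepared coins. -/
noncomputable def coinAmp (cs : List (ℕ × ℕ)) (r : Coins) : ℂ :=
  (cs.map fun c => prepMatrix c.2 (r c) false).prod

open Classical in
/-- Preparation of the coins from the state zero gives the product of their amplitudes. -/
theorem coinOp_prep {cs : List (ℕ × ℕ)} (hcs : cs.Nodup) {G : Coins → State n}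
    (hG : ∀ c ∈ cs, ∀ r b, G (Function.update r c b) = G r) (r : Coins) :
    coinOp prepMatrix cs (fun r => if ∀ c ∈ cs, r c = false then G r else 0) r =
      coinAmp cs r • G r := by
  induction cs generalizing G with
  | nil => simp [coinOp, coinAmp]
  | cons c cs ih =>
    obtain ⟨hc, hcs⟩ := List.nodup_cons.1 hcs
    have h₁ : (fun r : Coins => ∑ b, prepMatrix c.2 (r c) b •
        (if ∀ c' ∈ c :: cs, Function.update r c b c' = false then G (Function.update r c b)
          else 0)) =
        fun r => if ∀ c' ∈ cs, r c' = false then prepMatrix c.2 (r c) false • G r else 0 := by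
      funext r
      have hiff (b : Bool) : (∀ c' ∈ c :: cs, Function.update r c b c' = false) ↔
          b = false ∧ ∀ c' ∈ cs, r c' = false := by
        rw [List.forall_mem_cons, Function.update_self]
        refine and_congr Iff.rfl (forall_congr' fun c' => forall_congr' fun hc' => ?_)
        rw [Function.update_of_ne (by rintro rfl; exact hc hc')]
      simp only [hiff, Fintype.sum_bool, hG c (by simp)]
      simp
    rw [coinOp, h₁, ih hcs]
    · rw [coinAmp, coinAmp, List.map_cons, List.prod_cons, smul_smul, mul_comm]
    · intro c' hc' r b
      rw [hG c' (by simp [hc']), Function.update_of_ne (by rintro rfl; exact hc hc')]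

theorem coinMean_mul_left (cs : List (ℕ × ℕ)) (s : ℂ) (G : Coins → ℂ) (r : Coins) :
    coinMean cs (fun r => s * G r) r = s * coinMean cs G r := by
  induction cs generalizing r with
  | nil => rfl
  | cons c cs ih =>
    simp only [coinMean, ih, Finset.mul_sum]
    exact Finset.sum_congr rfl fun b _ => by ring

/-- Undoing the preparation of the coins and finding them all zero averages over their tosses. -/
theorem coinOp_unprep {cs : List (ℕ × ℕ)} (hcs : cs.Nodup) (G : Coins → State n) {r : Coins}
    (hr : ∀ c ∈ cs, r c = false) (z : Bits n) :
    coinOp unprepMatrix cs.reverse (fun r => coinAmp cs r • G r) r z =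
      coinMean cs (fun r => G r z) r := by
  induction cs generalizing G r with
  | nil => simp [coinOp, coinAmp, coinMean]
  | cons c cs ih =>
    obtain ⟨hc, hcs⟩ := List.nodup_cons.1 hcs
    have h₁ : (fun r => coinAmp (c :: cs) r • G r) =
        fun r => coinAmp cs r • (prepMatrix c.2 (r c) false • G r) := by
      funext r
      rw [coinAmp, coinAmp, List.map_cons, List.prod_cons, smul_smul, mul_comm]
    rw [List.reverse_cons, coinOp_concat, h₁, coinMean]
    simp only [WithLp.ofLp_sum, Finset.sum_apply, PiLp.smul_apply, smul_eq_mul]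
    refine Finset.sum_congr rfl fun b _ => ?_
    rw [ih hcs]
    · rw [coinMean_congr (G' := fun r => prepMatrix c.2 b false * G r z), coinMean_mul_left,
        ← mul_assoc, hr c (by simp), unprepMatrix_mul_prepMatrix]
      intro r' hr'
      rw [hr' c hc, Function.update_self]
      rfl
    · intro c' hc'
      rw [Function.update_of_ne (by rintro rfl; exact hc hc')]
      exact hr c' (by simp [hc'])

theorem coinList_nodup (m : ℕ) : (coinList m).Nodup := by
  unfold coinList
  rw [List.nodup_flatMap]
  refine ⟨fun k _ => List.nodup_range.map fun l l' h => by simpa using h, ?_⟩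
  refine (List.nodup_range (n := m)).pairwise_of_forall_ne fun k _ k' _ hne => ?_
  simp only [Function.onFun, List.disjoint_left, List.mem_map]
  rintro _ ⟨l, _, rfl⟩ ⟨l', _, h⟩
  exact hne (by simpa using (congrArg Prod.fst h).symm)

/-- If the state of the data is a function of the permutation chosen by the coins, then undoing
their preparation and finding them all zero averages it uniformly over all permutations. -/
theorem coinOp_unprep_shuffle (m : ℕ) (f : Equiv.Perm ℕ → State n) {r : Coins}
    (hr : ∀ c ∈ coinList m, r c = false) :
    coinOp unprepMatrix (coinList m) (fun r => coinAmp (coinList m) r • f (shufflePerm r m)) r =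
      (1 / (m.factorial : ℂ)) • ∑ s ∈ permsBelow m, f s := by
  ext z
  have h := coinOp_unprep (List.nodup_reverse.2 (coinList_nodup m)) (fun r => f (shufflePerm r m))
    (r := r) (fun c hc => hr c (List.mem_reverse.1 hc)) z
  rw [List.reverse_reverse, coinMean_shuffle m fun s => f s z] at h
  have h' (r : Coins) : coinAmp (coinList m).reverse r = coinAmp (coinList m) r :=
    ((List.reverse_perm _).map _).prod_eq
  simp only [h'] at h
  rw [h]
  simp

end

/-! ### The amplitudes before the measurement -/

theorem norm_app_unitary {n : ℕ} (U : QUnitary n) (ψ : State n) :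
    ‖Op.app (U : Op n) ψ‖ = ‖ψ‖ := by
  have h : inner ℂ (Op.app (U : Op n) ψ) (Op.app (U : Op n) ψ) = inner ℂ ψ ψ := by
    have hU : (U : Op n).conjTranspose * (U : Op n) = 1 := Matrix.mem_unitaryGroup_iff'.1 U.2
    have h₁ : Op.app ((U : Op n).conjTranspose) (Op.app (U : Op n) ψ) = ψ := by
      rw [← Op.app_mul, hU, Op.app_one]
    nth_rewrite 4 [← h₁]
    simp only [Op.app]
    rw [Matrix.toEuclideanLin_conjTranspose_eq_adjoint, LinearMap.adjoint_inner_right]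
  rw [inner_self_eq_norm_sq_to_K, inner_self_eq_norm_sq_to_K] at h
  have h' : ‖Op.app (U : Op n) ψ‖ ^ 2 = ‖ψ‖ ^ 2 := by exact_mod_cast h
  exact (pow_left_inj₀ (norm_nonneg _) (norm_nonneg _) two_ne_zero).1 h'

/-- The state `|0^n⟩`. -/
noncomputable def zeroState (n : ℕ) : State n := EuclideanSpace.single (fun _ => false) 1

theorem zeroState_apply {n : ℕ} (x : Bits n) :
    zeroState n x = if ∀ j, x j = false then 1 else 0 := by
  simp [zeroState, funext_iff]

/-- The state of dummy register `i` at the end of the circuit. -/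
noncomputable def dummyState {n : ℕ} (m : ℕ) (V : ℕ → QUnitary n) (i : ℕ) : State n :=
  (Op.app (V i : Op n))^[m - 1] (zeroState n)

theorem norm_dummyState {n : ℕ} (m : ℕ) (V : ℕ → QUnitary n) (i : ℕ) : ‖dummyState m V i‖ = 1 := by
  have (k : ℕ) : ‖(Op.app (V i : Op n))^[k] (zeroState n)‖ = 1 := by
    induction k with
    | zero => simp [zeroState]
    | succ k ih => rw [Function.iterate_succ_apply', norm_app_unitary, ih]
  exact this _

section

variable {n a m : ℕ}

/-- Every ancilla belongs to the pool, the tokens, a dummy register or the coin region. -/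
theorem ancilla_cases {q : ℕ} (h' : q < n + (a + m + m * n + m * m)) :
    q < n + a ∨ (∃ s < m, q = tokWire n a s) ∨ (∃ i < m, ∃ j : Fin n, q = dummyWire n a m i j) ∨
      ∃ k < m, ∃ l < m, q = coinWire n a m k l := by
  have div {p d : ℕ} (h : p < m * d) : p / d < m ∧ p % d < d ∧ p = p / d * d + p % d := by
    have hd : 0 < d := Nat.pos_of_ne_zero (by rintro rfl; simp at h)
    exact ⟨Nat.div_lt_of_lt_mul (by rwa [mul_comm]), Nat.mod_lt _ hd, (Nat.div_add_mod' _ _).symm⟩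
  by_cases h₁ : q < n + a
  · exact .inl h₁
  by_cases h₂ : q < n + a + m
  · exact .inr (.inl ⟨q - (n + a), by omega, by unfold tokWire; omega⟩)
  by_cases h₃ : q < n + a + m + m * n
  · obtain ⟨e₁, e₂, e₃⟩ := div (p := q - (n + a + m)) (d := n) (by omega)
    exact .inr (.inr (.inl ⟨_, e₁, ⟨_, e₂⟩, by simp only [dummyWire]; omega⟩))
  · obtain ⟨e₁, e₂, e₃⟩ := div (p := q - (n + a + m + m * n)) (d := m) (by omega)
    exact .inr (.inr (.inr ⟨_, e₁, _, e₂, by simp only [coinWire]; omega⟩))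

open Classical in
/-- The initial amplitudes in the form of a superposition over the coins. -/
theorem initial_eq_form (ψ : State n) (w : ℕ → Bool) :
    (if ∀ q, n ≤ q → q < n + (a + m + m * n + m * m) → w q = false then ψ fun i => w i else 0) =
      form n a m (fun r => if ∀ c ∈ coinList m, r c = false then ψ else 0)
        (fun _ _ => zeroState n) (fun _ _ => false) w := by
  have hb (c : ℕ × ℕ) (hc : c ∈ coinList m) :
      coinBits n a m w c = w (coinWire n a m c.1 c.2) := by
    rw [mem_coinList] at hc
    simp [coinBits, hc.1, hc.2]
  by_cases h : ∀ q, n ≤ q → q < n + (a + m + m * n + m * m) → w q = false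
  · have h₁ : ∀ q, n ≤ q → q < n + a → w q = false := fun q hq hq' => h q hq (by omega)
    have h₂ : ∀ s < m, w (tokWire n a s) = false := fun s hs =>
      h _ (by unfold tokWire; omega) (by unfold tokWire; omega)
    have h₃ : spareZero n a m w := fun k hk l hl _ =>
      h _ (by unfold coinWire; omega) (coinWire_lt hk hl)
    have h₄ : ∀ c ∈ coinList m, coinBits n a m w c = false := fun c hc => by
      rw [hb c hc]
      rw [mem_coinList] at hc
      exact h _ (by unfold coinWire; omega) (coinWire_lt hc.1 (by omega))
    have h₅ : ∏ i ∈ Finset.range m, zeroState n (dummyBits n a m w i) = 1 := by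
      refine Finset.prod_eq_one fun i hi => ?_
      rw [zeroState_apply, if_pos]
      intro j
      exact h _ (by unfold dummyWire; omega)
        (lt_of_lt_of_le (dummyWire_lt (Finset.mem_range.1 hi) j.2) (by omega))
    rw [if_pos h]
    simp only [form, lift]
    rw [if_pos h₁, if_pos ⟨h₂, h₃⟩, if_pos h₄, h₅, one_smul]
  · rw [if_neg h]
    simp only [form, lift]
    split_ifs with h₁ h₂ h₃
    · rw [Finset.prod_eq_zero_iff.2, zero_smul]
      · rfl
      · by_contra hcon
        refine h fun q hq hq' => ?_
        rcases ancilla_cases hq' with hq | ⟨s, hs, rfl⟩ | ⟨i, hi, j, rfl⟩ | ⟨k, hk, l, hl, rfl⟩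
        · exact h₁ _ (by omega) hq
        · exact h₂.1 s hs
        · by_contra hw
          refine hcon ⟨i, Finset.mem_range.2 hi, ?_⟩
          rw [zeroState_apply, if_neg]
          exact fun h => hw (h j)
        · by_cases hlk : l < k
          · have hc : (k, l) ∈ coinList m := mem_coinList.2 ⟨hk, hlk⟩
            rw [← hb _ hc]
            exact h₃ _ hc
          · exact h₂.2 k hk l hl hlk
    all_goals simp

theorem acts_setTokens (T : ℕ) (hT : T ≤ m) (φ : Coins → State n) (δ : Coins → ℕ → State n) :
    acts ((List.range T).map fun s => .one .X (tokWire n a s)) (form n a m φ δ fun _ _ => false) =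
      form n a m φ δ fun _ s => decide (s < T) := by
  induction T with
  | zero => exact form_congr (fun r => rfl) (fun r i _ => rfl) fun r s _ => by simp
  | succ T ih =>
    rw [List.range_succ, List.map_append, acts_append, ih (by omega), List.map_singleton,
      acts_flip (by omega)]
    refine form_congr (fun r => rfl) (fun r i _ => rfl) fun r s _ => ?_
    by_cases h : s = T
    · subst h; simp
    · rw [Function.update_of_ne h]
      exact decide_eq_decide.2 (by omega)

theorem applySeq_smul (V : ℕ → QUnitary n) (s : ℕ → ℕ) (T : ℕ) (c : ℂ) (φ : State n) :
    applySeq V s T (c • φ) = c • applySeq V s T φ := by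
  induction T with
  | zero => rfl
  | succ T ih => rw [applySeq, ih, Op.app_smul, applySeq]

open Classical in
theorem acts_allGates {cs : List UnitaryCircuit} (hm : cs.length = m) (V : ℕ → QUnitary n)
    (hV : ∀ i (h : i < cs.length), cs[i].Implements (V i)) (ha : ∀ c ∈ cs, c.anc ≤ a)
    (ψ : State n) :
    acts (allGates n a cs) (form n a m (fun r => if ∀ c ∈ coinList m, r c = false then ψ else 0)
        (fun _ _ => zeroState n) fun _ _ => false) =
      form n a m (coinOp unprepMatrix (coinList m) fun r =>
          coinAmp (coinList m) r • applySeq V (shufflePerm r m) m ψ)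
        (fun _ => dummyState m V) fun _ _ => true := by
  have hcs : ∀ c ∈ coinList m, c.1 < m ∧ c.2 < c.1 := fun c hc => mem_coinList.1 hc
  have h₁ : form n a m (fun r => if ∀ c ∈ coinList m, r c = false then ψ else 0)
        (fun _ _ => zeroState n) (fun _ s => decide (s < m)) =
      form n a m (fun r => if ∀ c ∈ coinList m, r c = false then ψ else 0)
        (fun _ => fun _ => zeroState n) fun _ => fun _ => true :=
    form_congr (fun r => rfl) (fun r i _ => rfl) fun r s hs => by simpa using hs
  have h₂ : form n a m (coinOp prepMatrix (coinList m)
        fun r => if ∀ c ∈ coinList m, r c = false then ψ else 0)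
        (fun _ => fun _ => zeroState n) (fun _ => fun _ => true) =
      form n a m (fun r => coinAmp (coinList m) r • ψ) (fun _ => fun _ => zeroState n)
        fun _ _ => true :=
    form_congr (fun r => coinOp_prep (coinList_nodup m) (fun _ _ _ _ => rfl) r)
      (fun r i _ => rfl) fun r s _ => rfl
  unfold allGates
  rw [hm, acts_append, acts_append, acts_append, acts_setTokens m le_rfl, h₁,
    acts_coins actOn_prepGates hcs, h₂, acts_allRounds hm V hV ha]
  simp only [applySeq_smul]
  exact acts_coins actOn_unprepGates hcs _ (dummyState m V) fun _ => true

/-- The mean over all orders of the products of the unitaries, applied to `ψ`. -/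
noncomputable def meanState (m : ℕ) (V : ℕ → QUnitary n) (ψ : State n) : State n :=
  (1 / (m.factorial : ℂ)) • ∑ s ∈ permsBelow m, applySeq V s m ψ

/-- The amplitudes of the ancillas after a successful measurement, where `w` gives the bits of all
wires. -/
noncomputable def ancillaAmp (n a m : ℕ) (δ : ℕ → State n) : Amp :=
  open Classical in fun w =>
    if (∀ q, n ≤ q → q < n + a → w q = false) ∧ (∀ s < m, w (tokWire n a s) = true) ∧
        ∀ k < m, ∀ l < m, w (coinWire n a m k l) = false then
      ∏ i ∈ Finset.range m, δ i (dummyBits n a m w i) else 0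

open Classical in
/-- Projection to the outcome zero on all coins leaves a product of the mean state of the data and a
state of the ancillas. -/
theorem form_measured (V : ℕ → QUnitary n) (ψ : State n) (δ : ℕ → State n) (w : ℕ → Bool) :
    (if ∀ c ∈ coinList m, w (coinWire n a m c.1 c.2) = false then
      form n a m (coinOp unprepMatrix (coinList m) fun r =>
          coinAmp (coinList m) r • applySeq V (shufflePerm r m) m ψ) (fun _ => δ)
          (fun _ _ => true) w else 0) =
      meanState m V ψ (fun i => w i) * ancillaAmp n a m δ w := by
  by_cases hc : ∀ c ∈ coinList m, w (coinWire n a m c.1 c.2) = false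
  · have hr : coinBits n a m w = fun _ => false := by
      funext c
      simp only [coinBits]
      split_ifs with h
      · exact hc c (mem_coinList.2 ⟨h.2, h.1⟩)
      · rfl
    have hiff : spareZero n a m w ↔ ∀ k < m, ∀ l < m, w (coinWire n a m k l) = false := by
      refine forall_congr' fun k => forall_congr' fun hk => forall_congr' fun l =>
        forall_congr' fun hl => ⟨fun h => ?_, fun h _ => h⟩
      by_cases hlk : l < k
      · exact hc (k, l) (mem_coinList.2 ⟨hk, hlk⟩)
      · exact h hlk
    have := coinOp_unprep_shuffle m (fun s => applySeq V s m ψ) (r := fun _ => false)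
      fun _ _ => rfl
    rw [if_pos hc]
    simp only [form, lift, hr, this, ancillaAmp, meanState]
    by_cases h₁ : ∀ q, n ≤ q → q < n + a → w q = false
    · by_cases h₂ : (∀ s < m, w (tokWire n a s) = true) ∧ spareZero n a m w
      · rw [if_pos h₁, if_pos h₂, if_pos ⟨h₁, h₂.1, hiff.1 h₂.2⟩, PiLp.smul_apply, smul_eq_mul,
          mul_comm]
      · rw [if_pos h₁, if_neg h₂, if_neg fun h => h₂ ⟨h.2.1, hiff.2 h.2.2⟩]
        simp
    · rw [if_neg h₁, if_neg fun h => h₁ h.1, mul_zero]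
  · rw [if_neg hc, ancillaAmp, if_neg, mul_zero]
    rintro ⟨-, -, h⟩
    refine hc fun c hc => ?_
    rw [mem_coinList] at hc
    exact h _ hc.1 _ (by omega)

end

/-! ### Validity of the circuit -/

section

variable {n a m N : ℕ}

theorem Gate.Valid.mono {g : Gate} {N N' : ℕ} (h : g.Valid N) (hN : N ≤ N') : g.Valid N' := by
  rcases g with ⟨u, q⟩ | ⟨c, t⟩ | ⟨a, b⟩ | ⟨c, d, t⟩
  · exact ⟨h.1, h.2.trans_le hN⟩
  · exact ⟨h.1.trans_le hN, h.2.1.trans_le hN, h.2.2⟩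
  · exact ⟨h.1.trans_le hN, h.2.1.trans_le hN, h.2.2⟩
  · exact ⟨h.1.trans_le hN, h.2.1.trans_le hN, h.2.2.1.trans_le hN, h.2.2.2⟩

theorem valid_cswapGates {c x y : ℕ} (hc : c < N) (hx : x < N) (hy : y < N) (hcx : c ≠ x)
    (hcy : c ≠ y) (hxy : x ≠ y) : ∀ g ∈ cswapGates c x y, g.Valid N := by
  simp [cswapGates, Gate.Valid, *, hxy.symm]

theorem valid_tokenSwap (hN : n + (a + m + m * n + m * m) = N) {k l : ℕ} (hk : k < m)
    (hl : l < k) :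
    ∀ g ∈ cswapGates (coinWire n a m k l) (tokWire n a l) (tokWire n a (l + 1)), g.Valid N := by
  have h₁ := @coinWire_lt n a m k l hk (by omega)
  have h₂ := @le_coinWire n a m k l
  have h₃ : tokWire n a l < n + a + m := by unfold tokWire; omega
  have h₄ : tokWire n a (l + 1) < n + a + m := by unfold tokWire; omega
  exact valid_cswapGates (by omega) (by omega) (by omega) (by omega) (by omega)
    (by unfold tokWire; omega)

theorem valid_exchangeGates (hN : n + (a + m + m * n + m * m) = N) {i : ℕ} (hi : i < m) :
    ∀ g ∈ exchangeGates n a m i, g.Valid N := by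
  intro g hg
  obtain ⟨j, hj, hg⟩ := List.mem_flatMap.1 hg
  rw [List.mem_range] at hj
  have h₁ := @dummyWire_lt n a m i j hi hj
  have h₂ := @le_dummyWire n a m i j
  have h₃ : tokWire n a i < n + a + m := by unfold tokWire; omega
  have h₄ : n ≤ tokWire n a i := by unfold tokWire; omega
  exact valid_cswapGates (by omega) (by omega) (by omega) (by omega) (by omega) (by omega) g hg

theorem valid_allGates {cs : List UnitaryCircuit} (hm : cs.length = m) (V : ℕ → QUnitary n)
    (hV : ∀ i (h : i < cs.length), cs[i].Implements (V i)) (ha : ∀ c ∈ cs, c.anc ≤ a)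
    (hN : n + (a + m + m * n + m * m) = N) : ∀ g ∈ allGates n a cs, g.Valid N := by
  have hflip (s : ℕ) (hs : s < m) : (Gate.one .X (tokWire n a s)).Valid N :=
    ⟨trivial, by unfold tokWire; omega⟩
  have hcoin (c : ℕ × ℕ) (hc : c ∈ coinList m) : coinWire n a m c.1 c.2 < N := by
    rw [mem_coinList] at hc
    rw [← hN]
    exact coinWire_lt hc.1 (by omega)
  intro g hg
  simp only [allGates, hm, List.mem_append, List.mem_map, List.mem_flatMap, List.mem_range] at hg
  rcases hg with ((⟨s, hs, rfl⟩ | ⟨c, hc, hg⟩) | ⟨t, ht, hg⟩) | ⟨c, hc, hg⟩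
  · exact hflip s hs
  · have := hcoin c hc
    simp only [prepGates, List.mem_cons, List.not_mem_nil, or_false] at hg
    rcases hg with rfl | rfl | rfl | rfl
    · exact ⟨trivial, this⟩
    · exact ⟨show 0 < 1 + (c.2 + 1) by omega, this⟩
    · exact ⟨show 0 < 1 + (c.2 + 1) by omega, this⟩
    · exact ⟨trivial, this⟩
  · simp only [roundGates, hm, List.mem_append, List.mem_singleton, shuffleGates, unshuffleGates,
      passGates, List.mem_flatMap, List.mem_reverse, List.mem_range] at hg
    rcases hg with (((rfl | ⟨k, hk, l, hl, hg⟩) | ⟨c, hc, (hg | hg) | hg⟩) |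
      ⟨k, hk, l, hl, hg⟩) | rfl
    · exact hflip t ht
    · exact valid_tokenSwap hN hk hl g hg
    · exact valid_exchangeGates hN (by rw [← hm]; exact List.snd_lt_of_mem_zipIdx hc) g hg
    · have hlt : c.2 < cs.length := List.snd_lt_of_mem_zipIdx hc
      have heq : cs[c.2] = c.1 := by
        have := List.fst_eq_of_mem_zipIdx hc
        simpa using this.symm
      have hc₁ := (hV _ hlt).1
      rw [heq] at hc₁
      refine (hc₁ g hg).mono ?_
      have := ha c.1 (heq ▸ List.getElem_mem hlt)
      omega
    · exact valid_exchangeGates hN (by rw [← hm]; exact List.snd_lt_of_mem_zipIdx hc) g hg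
    · exact valid_tokenSwap hN hk hl g hg
    · exact hflip t ht
  · have := hcoin c hc
    simp only [unprepGates, List.mem_cons, List.not_mem_nil, or_false] at hg
    rcases hg with rfl | rfl | rfl | rfl | rfl
    · exact ⟨trivial, this⟩
    · exact ⟨show 0 < c.2 + 1 + 1 by omega, this⟩
    · exact ⟨show 0 < c.2 + 1 + 1 by omega, this⟩
    · exact ⟨trivial, this⟩
    · exact ⟨trivial, this⟩

/-! ### The state after a successful measurement -/

theorem anc_le_ancSum {cs : List UnitaryCircuit} : ∀ c ∈ cs, c.anc ≤ ancSum cs := fun c hc =>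
  List.single_le_sum (by simp) _ (List.mem_map.2 ⟨c, hc, rfl⟩)

theorem oiCircuit_valid {cs : List UnitaryCircuit} (V : ℕ → QUnitary n)
    (hV : ∀ i (h : i < cs.length), cs[i].Implements (V i)) : (oiCircuit ⟨n, cs⟩).Valid n := by
  refine ⟨valid_allGates rfl V hV anc_le_ancSum rfl, fun q hq => ?_⟩
  obtain ⟨c, hc, rfl⟩ := List.mem_map.1 hq
  rw [mem_coinList] at hc
  exact coinWire_lt hc.1 (hc.2.trans hc.1)

theorem ancillaAmp_congr {δ : ℕ → State n} {w w' : ℕ → Bool} (h : ∀ q, n ≤ q → w q = w' q) :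
    ancillaAmp n a m δ w = ancillaAmp n a m δ w' := by
  have h₁ : (∀ q, n ≤ q → q < n + a → w q = false) ↔ ∀ q, n ≤ q → q < n + a → w' q = false :=
    forall_congr' fun q => forall_congr' fun hq => by rw [h q hq]
  have h₂ (s : ℕ) : w (tokWire n a s) = w' (tokWire n a s) := h _ (by unfold tokWire; omega)
  have h₃ (k l : ℕ) : w (coinWire n a m k l) = w' (coinWire n a m k l) :=
    h _ (by unfold coinWire; omega)
  have h₄ (i : ℕ) : dummyBits n a m w i = dummyBits n a m w' i :=
    funext fun j => h _ (by unfold dummyWire; omega)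
  simp only [ancillaAmp, h₁, h₂, h₃, h₄]

theorem wire_append_of_le {n k : ℕ} (x : Bits n) (y : Bits k) {q : ℕ} (h : n ≤ q) :
    wire (Fin.append x y) q = wire y (q - n) := by
  by_cases hq : q < n + k
  · have hq' : q - n < k := by omega
    have : (⟨q, hq⟩ : Fin (n + k)) = Fin.natAdd n ⟨q - n, hq'⟩ := by ext; simp; omega
    rw [wire, wire, dif_pos hq, dif_pos hq', this, Fin.append_right]
  · rw [wire, wire, dif_neg hq, dif_neg (by omega)]

theorem wire_append_of_lt {n k : ℕ} (x : Bits n) (y : Bits k) (i : Fin n) :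
    wire (Fin.append x y) i = x i := by
  have hi : (i : ℕ) < n + k := by omega
  rw [wire, dif_pos hi]
  exact Fin.append_left x y i

/-- After a successful measurement the data are in the mean state and in no way entangled with the
ancillas. -/
theorem oiCircuit_successState {cs : List UnitaryCircuit} (V : ℕ → QUnitary n)
    (hV : ∀ i (h : i < cs.length), cs[i].Implements (V i)) (ψ : State n) (x : Bits n)
    (y : Bits (oiCircuit ⟨n, cs⟩).anc) :
    (oiCircuit ⟨n, cs⟩).successState ψ (Fin.append x y) = meanState cs.length V ψ x *
      ancillaAmp n (ancSum cs) cs.length (dummyState cs.length V) fun q => wire y (q - n) := by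
  classical
  set N := n + (oiCircuit ⟨n, cs⟩).anc with hN
  have hanc : (oiCircuit ⟨n, cs⟩).anc =
    ancSum cs + cs.length + cs.length * n + cs.length * cs.length := rfl
  have h₁ : withAncilla (oiCircuit ⟨n, cs⟩).anc ψ = WithLp.toLp 2 fun z : Bits N =>
      form n (ancSum cs) cs.length (fun r => if ∀ c ∈ coinList cs.length, r c = false then ψ else 0)
        (fun _ _ => zeroState n) (fun _ _ => false) (overlay (fun _ => false) z) := by
    ext z
    refine Eq.trans ?_ (initial_eq_form (a := ancSum cs) (m := cs.length) ψ
      (overlay (fun _ => false) z))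
    rw [overlay_false]
    have h (i : Fin n) : wire z i = z (Fin.castAdd _ i) := by
      rw [wire, dif_pos (by omega)]; rfl
    simp only [h, withAncilla, ← hanc]
    refine if_congr ⟨fun hz q hq hq' => ?_, fun hz j => ?_⟩ rfl rfl
    · have := hz ⟨q - n, by omega⟩
      rw [wire, dif_pos hq', ← this]
      congr 1
      ext; simp; omega
    · have hj := j.2
      have := hz (n + j) (by omega) (by omega)
      rwa [wire, dif_pos (by omega)] at this
  have h₂ := gatesOp_app (oiCircuit_valid V hV).1 (form n (ancSum cs) cs.length
    (fun r => if ∀ c ∈ coinList cs.length, r c = false then ψ else 0)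
    (fun _ _ => zeroState n) (fun _ _ => false)) fun _ => false
  have h₃ : (oiCircuit ⟨n, cs⟩).finalState ψ = _ :=
    (congrArg (Op.app (gatesOp N (oiCircuit ⟨n, cs⟩).gates)) h₁).trans h₂
  have h₄ := acts_allGates rfl V hV anc_le_ancSum ψ
  change acts (oiCircuit ⟨n, cs⟩).gates _ = _ at h₄
  rw [h₄] at h₃
  have h₅ := form_measured (a := ancSum cs) (m := cs.length) V ψ (dummyState cs.length V)
    (wire (Fin.append x y))
  rw [ancillaAmp_congr fun q hq => wire_append_of_le x y hq] at h₅
  simp only [wire_append_of_lt] at h₅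
  rw [← h₅]
  simp only [MeasuredCircuit.successState, h₃, overlay_false]
  refine if_congr ?_ rfl rfl
  simp only [oiCircuit, List.forall_mem_map]

/-- The ancillas are in a normalized state after a successful measurement. -/
theorem sum_ancillaAmp {k : ℕ} (hk : k = a + m + m * n + m * m) {δ : ℕ → State n}
    (hδ : ∀ i, ‖δ i‖ = 1) :
    ∑ y : Bits k, ‖ancillaAmp n a m δ fun q => wire y (q - n)‖ ^ 2 = 1 := by
  classical
  -- the bits of the ancillas when the dummy registers have the bits `d`
  let e (d : Fin m → Bits n) : Bits k := fun q =>
    if (q : ℕ) < a then false else if (q : ℕ) < a + m then true else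
      if h : (q : ℕ) - (a + m) < m * n then
        d ⟨((q : ℕ) - (a + m)) / n, Nat.div_lt_of_lt_mul (by rwa [mul_comm])⟩
          ⟨((q : ℕ) - (a + m)) % n, Nat.mod_lt _ (Nat.pos_of_ne_zero (by rintro rfl; simp at h))⟩
      else false
  have he_pool (d) (q : ℕ) (h : n ≤ q) (h' : q < n + a) : wire (e d) (q - n) = false := by
    have h₁ : q - n < k := by omega
    have h₂ : q - n < a := by omega
    simp [wire, h₁, e, h₂]
  have he_tok (d) (s : ℕ) (hs : s < m) : wire (e d) (tokWire n a s - n) = true := by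
    have h₁ : tokWire n a s - n < k := by unfold tokWire; omega
    have h₂ : ¬ tokWire n a s - n < a := by unfold tokWire; omega
    have h₃ : tokWire n a s - n < a + m := by unfold tokWire; omega
    simp [wire, h₁, e, h₂, h₃]
  have he_coin (d) (p l : ℕ) (hp : p < m) (hl : l < m) :
      wire (e d) (coinWire n a m p l - n) = false := by
    have h₀ := coinWire_lt (n := n) (a := a) hp hl
    have h₀' := @le_coinWire n a m p l
    have h₁ : coinWire n a m p l - n < k := by omega
    have h₂ : ¬ coinWire n a m p l - n < a := by omega
    have h₃ : ¬ coinWire n a m p l - n < a + m := by omega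
    have h₄ : ¬ coinWire n a m p l - n - (a + m) < m * n := by omega
    simp only [wire, h₁, e, h₂, h₃, h₄, dif_pos, if_false, dif_neg, not_false_eq_true]
  have he_dummy (d) (i : Fin m) (j : Fin n) : wire (e d) (dummyWire n a m i j - n) = d i j := by
    have h₀ := dummyWire_lt (n := n) (a := a) i.2 j.2
    have h₀' := @le_dummyWire n a m i j
    have h₁ : dummyWire n a m i j - n < k := by omega
    have h₂ : ¬ dummyWire n a m i j - n < a := by omega
    have h₃ : ¬ dummyWire n a m i j - n < a + m := by omega
    have h₄ : dummyWire n a m i j - n - (a + m) = i * n + j := by unfold dummyWire; omega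
    have h₅ := mul_add_lt i.2 j.2
    have hn : 0 < n := j.pos
    have h₆ : ((i : ℕ) * n + j) / n = i := by
      rw [Nat.add_comm, Nat.add_mul_div_right _ _ hn, Nat.div_eq_of_lt j.2, zero_add]
    have h₇ : ((i : ℕ) * n + j) % n = j := by
      rw [Nat.add_comm, Nat.add_mul_mod_self_right, Nat.mod_eq_of_lt j.2]
    simp only [wire, h₁, e, h₂, h₃, h₄, h₅, h₆, h₇, dif_pos, if_false]
  have h₁ : ∑ y : Bits k, ‖ancillaAmp n a m δ fun q => wire y (q - n)‖ ^ 2 =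
      ∑ d : Fin m → Bits n, ∏ i : Fin m, ‖δ i (d i)‖ ^ 2 := by
    symm
    refine Fintype.sum_of_injective e ?_ _ _ ?_ ?_
    · intro d d' h
      funext i j
      rw [← he_dummy d i j, h, he_dummy]
    · intro y hy
      rw [ancillaAmp, if_neg, norm_zero, zero_pow two_ne_zero]
      rintro ⟨h₁, h₂, h₃⟩
      refine hy ⟨fun i j => wire y (dummyWire n a m i j - n), ?_⟩
      have key (d : Fin m → Bits n) (hd : ∀ i j, d i j = wire y (dummyWire n a m i j - n)) :
          e d = y := by
        funext q
        have hq := q.2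
        have hwire (z : Bits k) : z q = wire z (n + q - n) := by
          simp [wire]
        rw [hwire (e d), hwire y]
        rcases ancilla_cases (n := n) (a := a) (m := m) (q := n + q) (by omega) with
          h | ⟨s, hs, h⟩ | ⟨i, hi, j, h⟩ | ⟨p, hp, l, hl, h⟩
        · rw [he_pool d _ (by omega) h, h₁ _ (by omega) h]
        · rw [h, he_tok d s hs, h₂ s hs]
        · rw [h, he_dummy d ⟨i, hi⟩ j, hd]
        · rw [h, he_coin d p l hp hl, h₃ p hp l hl]
      exact key _ fun _ _ => rfl
    · intro d
      rw [ancillaAmp, if_pos ⟨he_pool d, he_tok d, fun p hp l hl => he_coin d p l hp hl⟩,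
        norm_prod, Finset.prod_range, Finset.prod_pow]
      congr 1
      refine Finset.prod_congr rfl fun i _ => ?_
      have hb : dummyBits n a m (fun q => wire (e d) (q - n)) i = d i := funext (he_dummy d i)
      rw [hb]
  have h₂ := Finset.prod_univ_sum (fun _ : Fin m => (Finset.univ : Finset (Bits n)))
    fun i b => ‖δ i b‖ ^ 2
  rw [Fintype.piFinset_univ] at h₂
  rw [h₁, ← h₂]
  refine Finset.prod_eq_one fun i _ => ?_
  rw [← EuclideanSpace.norm_sq_eq, hδ, one_pow]

theorem oiCircuit_successProb {cs : List UnitaryCircuit} (V : ℕ → QUnitary n)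
    (hV : ∀ i (h : i < cs.length), cs[i].Implements (V i)) (ψ : State n) :
    (oiCircuit ⟨n, cs⟩).successProb ψ = ‖meanState cs.length V ψ‖ ^ 2 := by
  rw [MeasuredCircuit.successProb, EuclideanSpace.norm_sq_eq,
    ← (Fin.appendEquiv n (oiCircuit ⟨n, cs⟩).anc).sum_comp, Fintype.sum_prod_type]
  have h (x : Bits n) (y : Bits (oiCircuit ⟨n, cs⟩).anc) :
      ‖(oiCircuit ⟨n, cs⟩).successState ψ (Fin.appendEquiv n _ (x, y))‖ ^ 2 =
        ‖meanState cs.length V ψ x‖ ^ 2 * ‖ancillaAmp n (ancSum cs) cs.length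
          (dummyState cs.length V) fun q => wire y (q - n)‖ ^ 2 := by
    rw [← mul_pow, ← norm_mul, ← oiCircuit_successState V hV]
    rfl
  have hs := sum_ancillaAmp (k := (oiCircuit ⟨n, cs⟩).anc) (a := ancSum cs) rfl
    (norm_dummyState cs.length V)
  simp only [h, ← Finset.mul_sum, hs, mul_one]
  exact (EuclideanSpace.norm_sq_eq _).symm

theorem oiCircuit_outputDensity {cs : List UnitaryCircuit} (V : ℕ → QUnitary n)
    (hV : ∀ i (h : i < cs.length), cs[i].Implements (V i)) (ψ : State n) :
    (oiCircuit ⟨n, cs⟩).outputDensity ψ =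
      pureDensity (normalization (meanState cs.length V ψ)) := by
  ext x x'
  have hs := sum_ancillaAmp (k := (oiCircuit ⟨n, cs⟩).anc) (a := ancSum cs) rfl
    (norm_dummyState cs.length V)
  have h (s t g : ℂ) : s * g * star (t * g) =
      s * star t * ((‖g‖ ^ 2 : ℝ) : ℂ) := by
    rw [star_mul', Complex.ofReal_pow, ← Complex.mul_conj', ← starRingEnd_apply]
    simp only [starRingEnd_apply]
    ring
  simp only [MeasuredCircuit.outputDensity, Matrix.of_apply, oiCircuit_successState V hV,
    oiCircuit_successProb V hV, pureDensity, normalization, PiLp.smul_apply, smul_eq_mul]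
  simp only [h, ← Finset.mul_sum, ← Complex.ofReal_sum]
  rw [hs]
  simp
  ring

/-! ### The mean state and order interference -/

theorem applySeq_eq_prod {T : ℕ} {f : Fin T → Op n} {V : ℕ → QUnitary n} {s : ℕ → ℕ}
    (h : ∀ i : Fin T, (V (s i) : Op n) = f i) (ψ : State n) :
    applySeq V s T ψ = Op.app (List.ofFn f).reverse.prod ψ := by
  induction T with
  | zero => simp [applySeq, Op.app_one]
  | succ T ih =>
    rw [applySeq, ih (f := fun i => f i.castSucc) fun i => h i.castSucc, List.ofFn_succ',
      List.concat_eq_append, List.reverse_append, List.reverse_singleton, List.singleton_append,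
      List.prod_cons, Op.app_mul, ← h (Fin.last T)]
    rfl

theorem meanState_eq (U : Fin m → QUnitary n) {V : ℕ → QUnitary n}
    (h : ∀ i : Fin m, V i = U i) (ψ : State n) :
    meanState m V ψ = (1 / (m.factorial : ℂ)) • OI U ψ := by
  rw [meanState, permsBelow, Finset.sum_map, OI, ← (Equiv.inv _).sum_comp]
  congr 1
  refine Finset.sum_congr rfl fun σ _ => applySeq_eq_prod (fun i => ?_) ψ
  simp only [Function.Embedding.coeFn_mk, extendPerm_apply, h]
  congr 2
  simp

theorem norm_meanState (U : Fin m → QUnitary n) {V : ℕ → QUnitary n}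
    (h : ∀ i : Fin m, V i = U i) (ψ : State n) :
    ‖meanState m V ψ‖ = ‖OI U ψ‖ / (m.factorial : ℝ) := by
  rw [meanState_eq U h, norm_smul, norm_div, norm_one, Complex.norm_natCast]
  ring

theorem normalization_smul {c : ℝ} (hc : 0 < c) (φ : State n) :
    normalization ((c : ℂ) • φ) = normalization φ := by
  rw [normalization, normalization, norm_smul, smul_smul, Complex.norm_real,
    Real.norm_of_nonneg hc.le]
  congr 1
  have : (c : ℂ) ≠ 0 := by exact_mod_cast hc.ne'
  rw [Complex.ofReal_mul, mul_inv, mul_comm, ← mul_assoc, mul_inv_cancel₀ this, one_mul]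

end

end OrderInterference

theorem mainTheorem8 :
    ∃ Q : QPTAlgorithm encOIInput,
      ∀ (n m : ℕ) (c : Fin m → UnitaryCircuit) (U : Fin m → QUnitary n),
        (∀ i, (c i).Implements (U i)) →
          (Q.circuit ⟨n, List.ofFn c⟩).Valid n ∧
          ∀ ψ : State n, ‖ψ‖ = 1 →
            (‖OI U ψ‖ / (m.factorial : ℝ)) ^ 2 ≤ (Q.circuit ⟨n, List.ofFn c⟩).successProb ψ ∧
            (0 < (Q.circuit ⟨n, List.ofFn c⟩).successProb ψ →
              (Q.circuit ⟨n, List.ofFn c⟩).outputDensity ψ =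
                pureDensity (normalization (OI U ψ))) := by
  refine ⟨⟨oiCircuit, oiCircuit_polyTime⟩, fun n m c U hU => ?_⟩
  let V : ℕ → QUnitary n := fun i => if h : i < m then U ⟨i, h⟩ else 1
  have hVU (i : Fin m) : V i = U i := dif_pos i.2
  have hV (i : ℕ) (h : i < (List.ofFn c).length) : (List.ofFn c)[i].Implements (V i) := by
    have hi : i < m := by simpa using h
    rw [List.getElem_ofFn]
    exact hVU ⟨i, hi⟩ ▸ hU ⟨i, hi⟩
  refine ⟨oiCircuit_valid V hV, fun ψ _ => ⟨?_, fun _ => ?_⟩⟩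
  · rw [oiCircuit_successProb V hV, List.length_ofFn, norm_meanState U hVU]
  · rw [oiCircuit_outputDensity V hV, List.length_ofFn, meanState_eq U hVU]
    have := normalization_smul (c := 1 / (m.factorial : ℝ)) (by positivity) (OI U ψ)
    push_cast at this
    rw [this]
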